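/- Let $d\in\mathbb N$, $T>0$, $\gamma>1$, $p(\rho)=\rho^\gamma$, let $\mathbb X$ be $\mathbb R^d$ or the flat torus $\mathbb T^d=(\mathbb R/\mathbb Z)^d$, and let $\Omega\subset\mathbb X$ be open. For $m\in\mathbb R^d$ put $m\circ m=m\otimes m-\frac1d|m|^2I_d$, let $S^d_0$ be the space of trace-free symmetric $d\times d$ matrices, and for $\rho>0$, $M\in S_0^d$ put $e_{\rm kin}(\rho,m,M)=\frac d2\lambda_{\max}\big(\frac{m\otimes m}{\rho}-M\big)$. Let $$K=\Big\{(\rho,m,M,Q):\ \rho>0,\ M=\tfrac{m\circ m}{\rho},\ Q=p(\rho)+\tfrac{|m|^2}{\rho d}\Big\}.$$ The relaxed system is $\partial_t m+\operatorname{div}M+\nabla Q=0$, $\partial_t\rho+\operatorname{div}m=0$ in the sense of distributions on $(0,T)\times\mathbb X$. Let $z_0=(\rho_0,m_0,M_0,Q_0):[0,T]\times\mathbb X\to(0,\infty)\times\mathbb R^d\times S_0^d\times\mathbb R$ be a continuous solution of the relaxed system with $Q_0\in C([0,T];L^1\cap L^2(\Omega))$, with $z_0(t,x)\in K$ for all $t\in[0,T]$,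 $x\notin\Omega$, and with $$Q_0>p(\rho_0)+\tfrac2d e_{\rm kin}(\rho_0,m_0,M_0)\quad\text{on }(0,T)\times\Omega .$$ Let $X_0$ be the set of pairs $(\rho,m)\in C([0,T];L^\gamma_w(\mathbb X))\times C([0,T];L^2_w(\mathbb X;\mathbb R^d))$ with $\rho>0$ such that $(\rho,m)=(\rho_0,m_0)$ at $t=0$ and $t=T$, $\operatorname{supp}(m-m_0)(t,\cdot)$ is a compact subset of $\Omega$ for every $t\in[0,T]$, and for which there is an $S_0^d$-valued $M$, integrable on $(0,T)\times\Omega$, such that $(\rho,m,M,Q_0)$ solves the relaxed system, agrees with $z_0$ almost everywhere outside $\Omega$, is continuous on $[0,T]\times\Omega$, and satisfies $$Q_0>p(\rho)+\tfrac2d e_{\rm kin}(\rho,m,M)>p(\rho)+\tfrac{|m|^2}{d\rho}\quad\text{on }(0,T)\times\Omega .$$ Let $X_{\rho_0}$ (the space "$X\cap\{\rho=\rho_0\}$") be the closure of $\{(\rho,m)\in X_0:\rho=\rho_0\}$ in $C([0,T];L^\gamma_w)\times C([0,T];L^2_w)$, with the topology of uniform convergence in time with respect to the weak topologies. **Theorem.**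 The set of those $(\rho,m)\in X_{\rho_0}$ that are weak solutions on $(0,T)\times\mathbb X$ of the compressible Euler system $$\partial_t m+\operatorname{div}\Big(\frac{m\otimes m}{\rho}\Big)+\nabla p(\rho)=0,\qquad \partial_t\rho+\operatorname{div}m=0,$$ with $\rho=\rho_0$ everywhere in $[0,T]\times\mathbb X$, $m=m_0$ at $t=0$, at $t=T$ and on $(0,T)\times(\mathbb X\setminus\Omega)$, and $$Q_0=p(\rho_0)+\frac{|m|^2}{\rho_0 d}\quad\text{a.e. in }[0,T]\times\Omega,$$ is residual (comeagre) in $X_{\rho_0}$. This holds both for $\mathbb X=\mathbb R^d$ and for $\mathbb X=\mathbb T^d$. -/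

import Mathlib

open MeasureTheory Set Filter Topology
open scoped ENNReal

noncomputable section

namespace IsentropicEuler

/-- Euclidean space of dimension `d`, the value space of the momentum. -/
abbrev E (d : ℕ) : Type := EuclideanSpace ℝ (Fin d)

/-- The flat torus `(ℝ/ℤ)^d`. -/
abbrev Torus (d : ℕ) : Type := UnitAddTorus (Fin d)

/-- The quotient map `ℝ^d → (ℝ/ℤ)^d`. -/
def torusProj (d : ℕ) (y : E d) : Torus d := fun i => ((y i : ℝ) : UnitAddCircle)

/-- The trivial covering `ℝ^d → ℝ^d`. -/
def spaceProj (d : ℕ) (y : E d) : E d := y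

/-- The pressure law `p(ρ) = ρ^γ`. -/
def pressure (γ r : ℝ) : ℝ := r ^ γ

section Pointwise

variable {d : ℕ}

/-- `a ⊗ a`. -/
def tensorSq (a : E d) : Matrix (Fin d) (Fin d) ℝ := Matrix.of fun i j => a i * a j

/-- `a ∘ a = a ⊗ a - (|a|²/d) I`, the trace-free part of `a ⊗ a`. -/
def circSq (a : E d) : Matrix (Fin d) (Fin d) ℝ :=
  tensorSq a - (‖a‖ ^ 2 / (d : ℝ)) • (1 : Matrix (Fin d) (Fin d) ℝ)

/-- The largest eigenvalue of a real symmetric matrix. -/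
def lambdaMax (A : Matrix (Fin d) (Fin d) ℝ) : ℝ := sSup (spectrum ℝ A)

/-- The generalised kinetic energy density `(d/2) λ_max(m ⊗ m / ρ - M)`. -/
def ekin (r : ℝ) (a : E d) (B : Matrix (Fin d) (Fin d) ℝ) : ℝ :=
  (d : ℝ) / 2 * lambdaMax (r⁻¹ • tensorSq a - B)

/-- The constitutive set `K`. -/
def constitutiveSet (d : ℕ) (γ : ℝ) : Set (ℝ × E d × Matrix (Fin d) (Fin d) ℝ × ℝ) :=
  {z | 0 < z.1 ∧ z.2.2.1 = z.1⁻¹ • circSq z.2.1 ∧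
    z.2.2.2 = pressure γ z.1 + ‖z.2.1‖ ^ 2 / (z.1 * d)}

end Pointwise

/-- A space-time dependent quadruple `z = (ρ, m, M, Q)` over the spatial domain `𝕏`. -/
structure Quadruple (d : ℕ) (𝕏 : Type) where
  ρ : ℝ → 𝕏 → ℝ
  m : ℝ → 𝕏 → E d
  M : ℝ → 𝕏 → Matrix (Fin d) (Fin d) ℝ
  Q : ℝ → 𝕏 → ℝ

section Domain

/- The spatial domain `𝕏` is `ℝ^d` or the torus; `π : ℝ^d → 𝕏` is the identity or the quotient map.
Both are additive homomorphisms and local diffeomorphisms, so that smoothness and partial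
derivatives on `𝕏` are those of the pull-back along `π`. -/

variable {d : ℕ} {𝕏 : Type} [AddCommGroup 𝕏] [TopologicalSpace 𝕏] [MeasureSpace 𝕏]

/-- The time derivative. -/
def dt (φ : ℝ × 𝕏 → ℝ) (t : ℝ) (x : 𝕏) : ℝ := deriv (fun s : ℝ => φ (s, x)) t

/-- The partial derivative in the `j`-th space direction. -/
def dx (π : E d → 𝕏) (j : Fin d) (φ : ℝ × 𝕏 → ℝ) (t : ℝ) (x : 𝕏) : ℝ :=
  deriv (fun s : ℝ => φ (t, x + π (s • EuclideanSpace.single j (1 : ℝ)))) 0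

/-- `φ ∈ C_c^∞((0,T) × 𝕏)`. -/
structure IsTestFunction (π : E d → 𝕏) (T : ℝ) (φ : ℝ × 𝕏 → ℝ) : Prop where
  smooth : ContDiff ℝ (⊤ : ℕ∞) (fun y : ℝ × E d => φ (y.1, π y.2))
  compact : HasCompactSupport φ
  support : tsupport φ ⊆ Ioo 0 T ×ˢ (univ : Set 𝕏)

/-- The relaxed linear system `∂ₜ m + div M + ∇ Q = 0`, `∂ₜ ρ + div m = 0` on `(0,T) × 𝕏`, in the
sense of distributions. -/
def SolvesRelaxedSystem (π : E d → 𝕏) (T : ℝ) (z : Quadruple d 𝕏) : Prop :=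
  ∀ φ : ℝ × 𝕏 → ℝ, IsTestFunction π T φ →
    (∀ i : Fin d, ∫ t in Ioo 0 T, ∫ x, (z.m t x i * dt φ t x
        + ∑ j, (z.M t x + z.Q t x • (1 : Matrix (Fin d) (Fin d) ℝ)) i j * dx π j φ t x) = 0) ∧
    ∫ t in Ioo 0 T, ∫ x, (z.ρ t x * dt φ t x + ∑ j, z.m t x j * dx π j φ t x) = 0

/-- `(ρ, m)` is a weak solution of the isentropic compressible Euler system on `(0,T) × 𝕏`:
`ρ > 0` almost everywhere, `|m|²/ρ` is locally integrable, and
`∂ₜ m + div (m ⊗ m / ρ) + ∇ p(ρ) = 0`, `∂ₜ ρ + div m = 0` in the sense of distributions. -/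
structure IsWeakSolution (π : E d → 𝕏) (γ T : ℝ) (ρ : ℝ → 𝕏 → ℝ) (m : ℝ → 𝕏 → E d) : Prop where
  pos : ∀ᵐ t ∂(volume.restrict (Ioo 0 T)), ∀ᵐ x, 0 < ρ t x
  locallyIntegrable : ∀ C : Set 𝕏, IsCompact C →
    ∫⁻ t in Ioo 0 T, ∫⁻ x in C, ENNReal.ofReal (‖m t x‖ ^ 2 / ρ t x) < ∞
  momentum : ∀ φ : ℝ × 𝕏 → ℝ, IsTestFunction π T φ → ∀ i : Fin d,
    ∫ t in Ioo 0 T, ∫ x, (m t x i * dt φ t x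
      + ∑ j, ((ρ t x)⁻¹ • tensorSq (m t x)
          + pressure γ (ρ t x) • (1 : Matrix (Fin d) (Fin d) ℝ)) i j * dx π j φ t x) = 0
  mass : ∀ φ : ℝ × 𝕏 → ℝ, IsTestFunction π T φ →
    ∫ t in Ioo 0 T, ∫ x, (ρ t x * dt φ t x + ∑ j, m t x j * dx π j φ t x) = 0

/-- `f ∈ C([0,T]; L^q(Ω))`, for the norm topology of `L^q(Ω)`. -/
def ContinuousIntoLp (T : ℝ) (Ω : Set 𝕏) (q : ℝ≥0∞) (f : ℝ → 𝕏 → ℝ) : Prop :=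
  ∀ t ∈ Icc 0 T, MemLp (f t) q (volume.restrict Ω) ∧
    Tendsto (fun s => eLpNorm (fun x => f s x - f t x) q (volume.restrict Ω))
      (𝓝[Icc 0 T] t) (𝓝 0)

instance factOneLeOfReal (γ : ℝ) [h : Fact (1 < γ)] : Fact (1 ≤ ENNReal.ofReal γ) :=
  ⟨ENNReal.one_le_ofReal.2 h.out.le⟩

variable (𝕏) in
/-- `C([0,T]; L^q_w(𝕏; F))`: maps from `[0,T]` to `L^q` that are continuous for the weak topology,
with the topology of uniform convergence in time (the compact-open topology). -/
abbrev WeaklyContinuous (T : ℝ) (F : Type) [NormedAddCommGroup F] [NormedSpace ℝ F]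
    (q : ℝ≥0∞) [Fact (1 ≤ q)] : Type :=
  C(Icc (0 : ℝ) T, WeakSpace ℝ (Lp F q (volume : Measure 𝕏)))

/-- The function `f(t)` of space, with the value `0` for `t ∉ [0,T]`. -/
def valueAt {T : ℝ} {F : Type} [NormedAddCommGroup F] [NormedSpace ℝ F] {q : ℝ≥0∞}
    [Fact (1 ≤ q)] (f : WeaklyContinuous 𝕏 T F q) (t : ℝ) : 𝕏 → F :=
  open Classical in
  if h : t ∈ Icc (0 : ℝ) T then
    (((toWeakSpace ℝ (Lp F q (volume : Measure 𝕏))).symm (f ⟨t, h⟩) :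
      Lp F q (volume : Measure 𝕏)) : 𝕏 → F)
  else 0

variable (d 𝕏) in
/-- The space `C([0,T]; L^γ_w(𝕏)) × C([0,T]; L²_w(𝕏; ℝ^d))` of pairs `(ρ, m)`. -/
abbrev StateSpace (γ T : ℝ) [Fact (1 < γ)] : Type :=
  WeaklyContinuous 𝕏 T ℝ (ENNReal.ofReal γ) × WeaklyContinuous 𝕏 T (E d) 2

/-- The quadruple `z` is a subsolution with respect to the generalised pressure `z.Q`, and `(ρ, m)`
is (the class in the state space of) its density and momentum. -/
structure IsSubsolution (π : E d → 𝕏) (γ T : ℝ) [Fact (1 < γ)] (Ω : Set 𝕏)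
    (w : StateSpace d 𝕏 γ T) (z : Quadruple d 𝕏) : Prop where
  density : ∀ t ∈ Icc 0 T, valueAt w.1 t =ᵐ[volume] z.ρ t
  momentum : ∀ t ∈ Icc 0 T, valueAt w.2 t =ᵐ[volume] z.m t
  pos : ∀ t ∈ Icc 0 T, ∀ x, 0 < z.ρ t x
  symm : ∀ t ∈ Icc 0 T, ∀ x, (z.M t x).IsSymm
  traceFree : ∀ t ∈ Icc 0 T, ∀ x, (z.M t x).trace = 0
  integrable : ∀ i j, IntegrableOn (fun y : ℝ × 𝕏 => z.M y.1 y.2 i j) (Ioo 0 T ×ˢ Ω)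
  relaxed : SolvesRelaxedSystem π T z
  le : ∀ t ∈ Ioo 0 T, ∀ x ∈ Ω,
    pressure γ (z.ρ t x) + 2 / (d : ℝ) * ekin (z.ρ t x) (z.m t x) (z.M t x) ≤ z.Q t x

/-- The hypotheses on the initial strict subsolution `z₀`: it is a continuous solution of the
relaxed system on `[0,T] × 𝕏`, takes values in `K` outside `Ω`, its generalised pressure is in
`C([0,T]; L¹ ∩ L²(Ω))`, and `Q₀ > p(ρ₀) + (2/d) e_kin(ρ₀, m₀, M₀)` on `(0,T) × Ω`. -/
structure IsStrictSubsolution (π : E d → 𝕏) (γ T : ℝ) (Ω : Set 𝕏) (z₀ : Quadruple d 𝕏) :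
    Prop where
  continuous_density : ContinuousOn (fun y : ℝ × 𝕏 => z₀.ρ y.1 y.2) (Icc 0 T ×ˢ univ)
  continuous_momentum : ContinuousOn (fun y : ℝ × 𝕏 => z₀.m y.1 y.2) (Icc 0 T ×ˢ univ)
  continuous_flux : ContinuousOn (fun y : ℝ × 𝕏 => z₀.M y.1 y.2) (Icc 0 T ×ˢ univ)
  continuous_pressure : ContinuousOn (fun y : ℝ × 𝕏 => z₀.Q y.1 y.2) (Icc 0 T ×ˢ univ)
  pressure_L1 : ContinuousIntoLp T Ω 1 z₀.Q
  pressure_L2 : ContinuousIntoLp T Ω 2 z₀.Q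
  pos : ∀ t ∈ Icc 0 T, ∀ x, 0 < z₀.ρ t x
  symm : ∀ t ∈ Icc 0 T, ∀ x, (z₀.M t x).IsSymm
  traceFree : ∀ t ∈ Icc 0 T, ∀ x, (z₀.M t x).trace = 0
  relaxed : SolvesRelaxedSystem π T z₀
  outside : ∀ t ∈ Icc 0 T, ∀ x ∉ Ω,
    (z₀.ρ t x, z₀.m t x, z₀.M t x, z₀.Q t x) ∈ constitutiveSet d γ
  strict : ∀ t ∈ Ioo 0 T, ∀ x ∈ Ω,
    pressure γ (z₀.ρ t x) + 2 / (d : ℝ) * ekin (z₀.ρ t x) (z₀.m t x) (z₀.M t x) < z₀.Q t x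

/-- The approximating space `X₀`: pairs `(ρ, m)` belonging to a subsolution `z` with `Q = Q₀` that
is continuous on `[0,T] × Ω`, agrees with `z₀` outside `Ω` and (in `ρ` and `m`) at `t = 0, T`, for
which `(m - m₀)(t)` has compact support in `Ω` for every `t`, and which satisfies
`Q > p(ρ) + (2/d) e_kin(ρ, m, M) > p(ρ) + |m|²/(dρ)` on `(0,T) × Ω`. The functions `z.ρ`, `z.m`,
`z.M` are representatives, chosen so as to agree with `z₀` at every point outside `Ω`. -/
def approximatingSpace (π : E d → 𝕏) (γ T : ℝ) [Fact (1 < γ)] (Ω : Set 𝕏)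
    (z₀ : Quadruple d 𝕏) : Set (StateSpace d 𝕏 γ T) :=
  {w | ∃ z : Quadruple d 𝕏, z.Q = z₀.Q ∧ IsSubsolution π γ T Ω w z ∧
    ContinuousOn (fun y : ℝ × 𝕏 => z.ρ y.1 y.2) (Icc 0 T ×ˢ Ω) ∧
    ContinuousOn (fun y : ℝ × 𝕏 => z.m y.1 y.2) (Icc 0 T ×ˢ Ω) ∧
    ContinuousOn (fun y : ℝ × 𝕏 => z.M y.1 y.2) (Icc 0 T ×ˢ Ω) ∧
    (∀ t ∈ Icc 0 T, ∀ x ∉ Ω, z.ρ t x = z₀.ρ t x ∧ z.m t x = z₀.m t x ∧ z.M t x = z₀.M t x) ∧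
    (∀ t ∈ ({0, T} : Set ℝ), ∀ᵐ x, z.ρ t x = z₀.ρ t x ∧ z.m t x = z₀.m t x) ∧
    (∀ t ∈ Icc 0 T, ∃ C : Set 𝕏, IsCompact C ∧ C ⊆ Ω ∧ ∀ x ∉ C, z.m t x = z₀.m t x) ∧
    ∀ t ∈ Ioo 0 T, ∀ x ∈ Ω,
      pressure γ (z.ρ t x) + ‖z.m t x‖ ^ 2 / (d * z.ρ t x)
        < pressure γ (z.ρ t x) + 2 / (d : ℝ) * ekin (z.ρ t x) (z.m t x) (z.M t x) ∧
      pressure γ (z.ρ t x) + 2 / (d : ℝ) * ekin (z.ρ t x) (z.m t x) (z.M t x) < z.Q t x}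

/-- The space `X` with the density held fixed: the closure, in the topology of the state space, of
the elements of `X₀` with density `ρ₀`. -/
def fixedDensitySpace (π : E d → 𝕏) (γ T : ℝ) [Fact (1 < γ)] (Ω : Set 𝕏)
    (z₀ : Quadruple d 𝕏) : Set (StateSpace d 𝕏 γ T) :=
  closure {w | w ∈ approximatingSpace π γ T Ω z₀ ∧
    ∀ t ∈ Icc 0 T, valueAt w.1 t =ᵐ[volume] z₀.ρ t}

/-- `(ρ, m)` is a weak solution of the Euler system with `ρ = ρ₀` everywhere, `m = m₀` at
`t = 0, T` and outside `Ω`, and `Q₀ = p(ρ₀) + |m|²/(ρ₀ d)` almost everywhere in `[0,T] × Ω`. -/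
structure IsExactSolution (π : E d → 𝕏) (γ T : ℝ) [Fact (1 < γ)] (Ω : Set 𝕏)
    (z₀ : Quadruple d 𝕏) (w : StateSpace d 𝕏 γ T) : Prop where
  weakSolution : IsWeakSolution π γ T (valueAt w.1) (valueAt w.2)
  density : ∀ t ∈ Icc 0 T, valueAt w.1 t =ᵐ[volume] z₀.ρ t
  endpoints : ∀ t ∈ ({0, T} : Set ℝ), valueAt w.2 t =ᵐ[volume] z₀.m t
  outside : ∀ t ∈ Ioo 0 T, ∀ᵐ x, x ∉ Ω → valueAt w.2 t x = z₀.m t x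
  energy : ∀ᵐ t ∂(volume.restrict (Icc 0 T)), ∀ᵐ x ∂(volume.restrict Ω),
    z₀.Q t x = pressure γ (z₀.ρ t x) + ‖valueAt w.2 t x‖ ^ 2 / (z₀.ρ t x * d)

end Domain

end IsentropicEuler

end

noncomputable section

namespace IsentropicEuler

/-! ### The largest eigenvalue -/

section LinearAlgebra

variable {d : ℕ}

/-! The argument is convex integration in its Baire category form. To a state attach the symmetric
matrix P = (Q₀ - p(ρ₀)) I - (m ⊗ m / ρ₀ - M), called `defect`. The two strict inequalities in X₀ say
exactly that P is positive definite and is not a multiple of the identity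
(`isAdmissible_defect_iff`). Its trace is d (Q₀ - p(ρ₀)) - |m|²/ρ₀, so |m|²/ρ₀ ≤ d (Q₀ - p(ρ₀)) on
Ω, and this convex constraint survives weak closure (`ae_mem_of_mem_closure`). Two facts remain: an
element with equality almost everywhere in Ω solves the Euler system, and equality is generic.

Equality gives Euler (`integral_momentum_equation`). Let v be the momentum of the limit and (a, B)
the fields of an approximating subsolution. The fluxes B + Q₀ I and v ⊗ v / ρ₀ + p I differ by a
term linear in a - v plus the positive semidefinite matrix P + (a - v) ⊗ (a - v) / ρ₀. The entries
of the latter are bounded by its trace, which equals -2 ⟨v, a - v⟩ / ρ₀ when v saturates the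
constraint. Hence the whole difference is controlled by expressions linear in a - v
(`abs_flux_sub_le`), and these vanish in the weak limit. No limit of the fluxes B is ever taken.

Genericity. The energy ∫ |m|²/ρ₀ is the supremum over ψ of 2 ∫ ⟨ψ, m⟩ - ∫ ρ₀ |ψ|². Finite suprema
over a dense sequence of ψ, integrated in time, are continuous on the state space
(`continuous_integral_lowerEnergy`), so nearly maximal energy on a cylinder is an open condition
(`isOpen_energySet`). Countably many cylinders and tolerances 1/(k+1) force equality
(`energy_eq_of_forall_mem_energySet`). Thus everything reduces to density of each of these open
sets; residuality needs neither metrizability nor the Baire property of the space.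

Density. Weakly small perturbations inside X₀ with density ρ₀ raise the energy by a fixed multiple
of the square of the integrated gap (`exists_cylinder_perturbation`). As the energy is bounded
above, a subsolution of nearly maximal energy in a given neighbourhood has small gap
(`exists_small_gap`). The building block is the plane wave with momentum cos(N(ξ·x - κt)) e and flux
κ cos(N(ξ·x - κt)) (e ⊗ ξ + ξ ⊗ e), where e ⟂ ξ. It is divergence free, so it does not touch the
density. If m = ⟨e, m⟩ e + ρ₀ κ ξ at a point, adding the wave changes P there only by a multiple of
e ⊗ e (`defect_add_wave`). Choosing e near a top eigenvector of P, but not an eigenvector, allows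
amplitudes proportional to tr P while P stays positive definite and nonscalar
(`exists_unit_posDef_add_smul_tensorSq`, `exists_wave_direction`). Compactly supported versions come
from a fourth order potential (`exists_localised_planeWave`). They tend weakly to zero uniformly in
time, yet raise the energy by half the squared amplitude (`IsWaveSequence.tendsto_addWave`,
`IsWaveSequence.tendsto_energy`). -/

theorem spectrum_smul_one_sub (A : Matrix (Fin d) (Fin d) ℝ) (c : ℝ) :
    spectrum ℝ (c • (1 : Matrix (Fin d) (Fin d) ℝ) - A) = (fun x => c - x) '' spectrum ℝ A := by
  have h := spectrum.singleton_sub_eq (R := ℝ) A c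
  rw [Set.singleton_sub, Algebra.algebraMap_eq_smul_one] at h
  exact h.symm

theorem isHermitian_smul_one_sub {A : Matrix (Fin d) (Fin d) ℝ} (hA : A.IsHermitian) (c : ℝ) :
    (c • (1 : Matrix (Fin d) (Fin d) ℝ) - A).IsHermitian := by
  refine Matrix.IsHermitian.sub ?_ hA
  ext i j
  simp [Matrix.one_apply, eq_comm]

theorem isHermitian_iff_isSymm {A : Matrix (Fin d) (Fin d) ℝ} : A.IsHermitian ↔ A.IsSymm := by
  simp [Matrix.IsHermitian, Matrix.IsSymm, Matrix.conjTranspose_eq_transpose_of_trivial]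

theorem spectrum_nonempty_of_isHermitian [NeZero d] {A : Matrix (Fin d) (Fin d) ℝ}
    (hA : A.IsHermitian) : (spectrum ℝ A).Nonempty := by
  rw [hA.spectrum_real_eq_range_eigenvalues]
  exact range_nonempty _

/-- The eigenvalues of `c • 1 - A` are `c - x` with `x` in the spectrum of `A`. That spectrum is
finite and nonempty, so its supremum is attained and strict inequalities are preserved. -/
theorem lambdaMax_lt_iff [NeZero d] {A : Matrix (Fin d) (Fin d) ℝ} (hA : A.IsHermitian) (c : ℝ) :
    lambdaMax A < c ↔ (c • (1 : Matrix (Fin d) (Fin d) ℝ) - A).PosDef := by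
  have hB := isHermitian_smul_one_sub hA c
  have hfin : (spectrum ℝ A).Finite := Matrix.finite_real_spectrum
  rw [hB.posDef_iff_eigenvalues_pos, lambdaMax,
    hfin.csSup_lt_iff (spectrum_nonempty_of_isHermitian hA)]
  have h : (∀ i, 0 < hB.eigenvalues i) ↔ ∀ x ∈ spectrum ℝ (c • (1 : Matrix _ _ ℝ) - A), 0 < x := by
    rw [hB.spectrum_real_eq_range_eigenvalues, forall_mem_range]
  rw [h, spectrum_smul_one_sub, forall_mem_image]
  simp

theorem lambdaMax_le_iff [NeZero d] {A : Matrix (Fin d) (Fin d) ℝ} (hA : A.IsHermitian) (c : ℝ) :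
    lambdaMax A ≤ c ↔ (c • (1 : Matrix (Fin d) (Fin d) ℝ) - A).PosSemidef := by
  have hB := isHermitian_smul_one_sub hA c
  have hfin : (spectrum ℝ A).Finite := Matrix.finite_real_spectrum
  rw [hB.posSemidef_iff_eigenvalues_nonneg, lambdaMax,
    csSup_le_iff hfin.bddAbove (spectrum_nonempty_of_isHermitian hA)]
  have h : 0 ≤ hB.eigenvalues ↔ ∀ x ∈ spectrum ℝ (c • (1 : Matrix _ _ ℝ) - A), 0 ≤ x := by
    rw [hB.spectrum_real_eq_range_eigenvalues, forall_mem_range]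
    rfl
  rw [h, spectrum_smul_one_sub, forall_mem_image]
  simp

theorem trace_smul_one_sub (A : Matrix (Fin d) (Fin d) ℝ) (c : ℝ) :
    (c • (1 : Matrix (Fin d) (Fin d) ℝ) - A).trace = d * c - A.trace := by
  simp [Matrix.trace_sub, Matrix.trace_smul, mul_comm]

/-- If the largest eigenvalue does not exceed the mean of the eigenvalues, then `(A.trace / d) • 1 -
A` is positive semidefinite with trace zero, hence zero. -/
theorem trace_div_lt_lambdaMax_iff [NeZero d] {A : Matrix (Fin d) (Fin d) ℝ}
    (hA : A.IsHermitian) :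
    A.trace / d < lambdaMax A ↔ ∀ c : ℝ, A ≠ c • (1 : Matrix (Fin d) (Fin d) ℝ) := by
  have hd : (d : ℝ) ≠ 0 := NeZero.ne _
  constructor
  · rintro h c rfl
    refine h.not_ge ((lambdaMax_le_iff hA _).2 ?_)
    have : (c • (1 : Matrix (Fin d) (Fin d) ℝ)).trace / d = c := by
      simp [Matrix.trace_smul]
    rw [this, sub_self]
    exact Matrix.PosSemidef.zero
  · intro h
    by_contra! hle
    have hP := (lambdaMax_le_iff hA _).1 hle
    refine h (A.trace / d) (sub_eq_zero.1 (hP.trace_eq_zero_iff.1 ?_)).symm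
    rw [trace_smul_one_sub]
    field_simp
    ring

/-! ### Rank one matrices -/

theorem isHermitian_tensorSq (a : E d) : (tensorSq a).IsHermitian := by
  ext i j
  simp [tensorSq, mul_comm]

theorem norm_sq_eq_sum (a : E d) : ‖a‖ ^ 2 = ∑ i, a i * a i := by
  rw [EuclideanSpace.norm_sq_eq]
  simp [sq]

theorem trace_tensorSq (a : E d) : (tensorSq a).trace = ‖a‖ ^ 2 := by
  simp [norm_sq_eq_sum, tensorSq, Matrix.trace]

theorem tensorSq_mulVec (a : E d) (x : Fin d → ℝ) :
    (tensorSq a).mulVec x = (x ⬝ᵥ (a : Fin d → ℝ)) • (a : Fin d → ℝ) := by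
  ext i
  simp only [tensorSq, Matrix.mulVec, dotProduct, Matrix.of_apply, Pi.smul_apply, smul_eq_mul,
    Finset.sum_mul]
  exact Finset.sum_congr rfl fun j _ => by ring

theorem dotProduct_tensorSq_mulVec (a : E d) (x : Fin d → ℝ) :
    x ⬝ᵥ (tensorSq a).mulVec x = (x ⬝ᵥ (a : Fin d → ℝ)) ^ 2 := by
  rw [tensorSq_mulVec, dotProduct_smul, smul_eq_mul, sq]

/-- Evaluating the quadratic form on the sum and difference of two basis vectors gives |P_ij| ≤
(P_ii + P_jj)/2. This is what lets the trace alone control the whole defect matrix. -/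
theorem abs_entry_le_trace {P : Matrix (Fin d) (Fin d) ℝ} (hP : P.PosSemidef) (i j : Fin d) :
    |P i j| ≤ P.trace := by
  have hdiag : ∀ k, 0 ≤ P k k := fun k => hP.diag_nonneg
  have hii : ∀ k, P k k ≤ P.trace := fun k =>
    Finset.single_le_sum (f := fun k => P k k) (fun k _ => hdiag k) (Finset.mem_univ k)
  have hsym : P j i = P i j := by simpa using congrFun (congrFun hP.isHermitian i) j
  have key : ∀ s : ℝ, 0 ≤ P i i + s * P i j + s * P j i + s * s * P j j := by
    intro s
    have h := hP.dotProduct_mulVec_nonneg (Pi.single i 1 + Pi.single j s)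
    simp [Matrix.mulVec_add, Matrix.mulVec_single] at h
    linarith
  have h1 := key 1
  have h2 := key (-1)
  rw [hsym] at h1 h2
  rw [abs_le]
  constructor <;> linarith [hii i, hii j]

/-! ### Oscillation directions -/

theorem dotProduct_mulVec_eq_sum_eigenvalues {P : Matrix (Fin d) (Fin d) ℝ} (hP : P.IsHermitian)
    (x : E d) :
    (x : Fin d → ℝ) ⬝ᵥ P.mulVec x
      = ∑ i, hP.eigenvalues i * (inner ℝ x (hP.eigenvectorBasis i)) ^ 2 := by
  have h := hP.eigenvectorBasis.sum_inner_mul_inner x (WithLp.toLp 2 (P.mulVec x))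
  have h1 : ∀ i, inner ℝ (hP.eigenvectorBasis i) (WithLp.toLp 2 (P.mulVec x))
      = hP.eigenvalues i * inner ℝ x (hP.eigenvectorBasis i) := by
    intro i
    have hi := hP.mulVec_eigenvectorBasis i
    simp only [EuclideanSpace.inner_eq_star_dotProduct, star_trivial]
    rw [dotProduct_comm, Matrix.dotProduct_mulVec, ← Matrix.mulVec_transpose,
      isHermitian_iff_isSymm.1 hP, hi, smul_dotProduct]
    rfl
  simp only [h1] at h
  have h2 : inner ℝ x (WithLp.toLp 2 (P.mulVec x)) = (x : Fin d → ℝ) ⬝ᵥ P.mulVec x := by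
    simp only [EuclideanSpace.inner_eq_star_dotProduct, star_trivial]
    rw [dotProduct_comm]
  rw [← h2, ← h]
  exact Finset.sum_congr rfl fun i _ => by ring

/-- Here `X` is the quadratic form of `P` at a vector, `x0`, `x1` are its coordinates along two
eigenvectors, and `(c, s)` is the tilted direction. By (u + w)² ≤ 2u² + 2w², the loss is at most (1
- s²) l0 x0² + l1 x1²/4, which leaves a positive remainder unless both coordinates vanish; then `hX`
alone suffices. -/
theorem add_mul_sq_pos {g l0 l1 s c x0 x1 X h : ℝ} (hg : 0 < g) (hgl : g ≤ l0) (hl0 : 0 < l0)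
    (hl1 : 0 < l1) (hs : 0 < s) (hs1 : s ≤ 1 / 2) (hs2 : s * (2 * g) ≤ l1) (hc2 : c ^ 2 = 1 - s ^ 2)
    (hX : 0 < X) (hge : l0 * x0 ^ 2 + l1 * x1 ^ 2 ≤ X) (hh : -(g / 2) ≤ h) :
    0 < X + h * (c * x0 + s * x1) ^ 2 := by
  have hA : (c * x0 + s * x1) ^ 2 ≤ 2 * (c ^ 2 * x0 ^ 2) + 2 * (s ^ 2 * x1 ^ 2) := by
    nlinarith [sq_nonneg (c * x0 - s * x1)]
  have hB : g * (c ^ 2 * x0 ^ 2) ≤ (1 - s ^ 2) * (l0 * x0 ^ 2) := by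
    rw [hc2]
    have := mul_le_mul_of_nonneg_right hgl (mul_nonneg (by nlinarith : 0 ≤ 1 - s ^ 2)
      (sq_nonneg x0))
    linarith
  have hC : g * (s ^ 2 * x1 ^ 2) ≤ (1 / 4) * (l1 * x1 ^ 2) := by
    have h1 : g * s ^ 2 ≤ 1 / 4 * l1 := by nlinarith
    nlinarith [mul_le_mul_of_nonneg_right h1 (sq_nonneg x1)]
  have hq : (g / 2) * (c * x0 + s * x1) ^ 2
      ≤ (1 - s ^ 2) * (l0 * x0 ^ 2) + (1 / 4) * (l1 * x1 ^ 2) := by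
    have := mul_le_mul_of_nonneg_left hA (half_pos hg).le
    linarith
  have hfin : -(g / 2) * (c * x0 + s * x1) ^ 2 ≤ h * (c * x0 + s * x1) ^ 2 :=
    mul_le_mul_of_nonneg_right hh (sq_nonneg _)
  have h3 : 0 ≤ s ^ 2 * (l0 * x0 ^ 2) := by positivity
  have h4 : 0 ≤ l1 * x1 ^ 2 := by positivity
  rcases eq_or_ne x0 0 with rfl | hx0
  · rcases eq_or_ne x1 0 with rfl | hx1
    · simpa using hX
    · have : 0 < l1 * x1 ^ 2 := by positivity
      linarith
  · have : 0 < s ^ 2 * (l0 * x0 ^ 2) := by positivity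
    linarith

/-- A positive definite matrix `P` that is not a multiple of the identity remains so if a multiple
`h e ⊗ e` is added, for a suitable unit vector `e` and all `h ≥ -tr P / (2 d)`. -/
theorem exists_unit_posDef_add_smul_tensorSq [NeZero d] {P : Matrix (Fin d) (Fin d) ℝ}
    (hP : P.PosDef) (hns : ∀ c : ℝ, P ≠ c • (1 : Matrix (Fin d) (Fin d) ℝ)) {g : ℝ}
    (hg : P.trace = d * g) :
    ∃ e : E d, ‖e‖ = 1 ∧ ∀ h : ℝ, -(g / 2) ≤ h → (P + h • tensorSq e).PosDef ∧
      ∀ c : ℝ, P + h • tensorSq e ≠ c • (1 : Matrix (Fin d) (Fin d) ℝ) := by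
  have hH := hP.isHermitian
  have hd : (0 : ℝ) < d := Nat.cast_pos.2 (NeZero.pos d)
  set b := hH.eigenvectorBasis with hb
  set l := hH.eigenvalues with hl
  have hlpos : ∀ i, 0 < l i := hP.eigenvalues_pos
  obtain ⟨i0, hi0⟩ := Finite.exists_max l
  have htr : P.trace = ∑ i, l i := by simpa using hH.trace_eq_sum_eigenvalues
  have hgpos : 0 < g := by
    have : 0 < ∑ i, l i := Finset.sum_pos (fun i _ => hlpos i) ⟨i0, Finset.mem_univ _⟩
    rw [← htr, hg] at this
    exact pos_of_mul_pos_right this hd.le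
  have hgle : g ≤ l i0 := by
    have : ∑ i, l i ≤ ∑ _i : Fin d, l i0 := Finset.sum_le_sum fun i _ => hi0 i
    rw [← htr, hg] at this
    simp only [Finset.sum_const, Finset.card_univ, Fintype.card_fin, nsmul_eq_mul] at this
    exact le_of_mul_le_mul_left this hd
  obtain ⟨i1, hi1⟩ : ∃ i, l i ≠ l i0 := by
    by_contra! hall
    have hps : (l i0 • (1 : Matrix (Fin d) (Fin d) ℝ) - P).PosSemidef := by
      rw [← lambdaMax_le_iff hH, lambdaMax, hH.spectrum_real_eq_range_eigenvalues]
      exact csSup_le (range_nonempty _) (forall_mem_range.2 hi0)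
    refine hns (l i0) (sub_eq_zero.1 (hps.trace_eq_zero_iff.1 ?_)).symm
    rw [trace_smul_one_sub, htr]
    simp [hall]
  have hne : i1 ≠ i0 := fun h => hi1 (by rw [h])
  -- The tilt must be nonzero, so that `e` is not an eigenvector, and small enough that the loss
  -- along the `i1` direction, of order `g * s ^ 2`, stays below `l i1 / 4`.
  set s : ℝ := min (1 / 2) (l i1 / (2 * g)) with hs
  have hspos : 0 < s := lt_min (by norm_num) (div_pos (hlpos _) (by positivity))
  have hs1 : s ≤ 1 / 2 := min_le_left _ _
  have hs2 : s * (2 * g) ≤ l i1 := by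
    have := min_le_right (1 / 2) (l i1 / (2 * g))
    rwa [← hs, le_div_iff₀ (by positivity)] at this
  set c : ℝ := Real.sqrt (1 - s ^ 2) with hc
  have hc2 : c ^ 2 = 1 - s ^ 2 := Real.sq_sqrt (by nlinarith)
  have hcpos : 0 < c := Real.sqrt_pos.2 (by nlinarith)
  have hb00 : inner ℝ (b i0) (b i0) = (1 : ℝ) := by simp [b.orthonormal.1]
  have hb11 : inner ℝ (b i1) (b i1) = (1 : ℝ) := by simp [b.orthonormal.1]
  have hb01 : inner ℝ (b i0) (b i1) = (0 : ℝ) := b.orthonormal.2 hne.symm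
  have hb10 : inner ℝ (b i1) (b i0) = (0 : ℝ) := b.orthonormal.2 hne
  set e : E d := c • b i0 + s • b i1 with he
  have he1 : ‖e‖ = 1 := by
    have : ‖e‖ ^ 2 = 1 := by
      rw [← real_inner_self_eq_norm_sq, he]
      simp only [inner_add_left, inner_add_right, real_inner_smul_left, real_inner_smul_right,
        hb00, hb01, hb10, hb11]
      linarith
    nlinarith [norm_nonneg e]
  have hPe : P.mulVec e = (c * l i0) • (b i0 : Fin d → ℝ) + (s * l i1) • (b i1 : Fin d → ℝ) := by
    have h0 : P.mulVec (b i0) = l i0 • (b i0 : Fin d → ℝ) := hH.mulVec_eigenvectorBasis i0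
    have h1 : P.mulVec (b i1) = l i1 • (b i1 : Fin d → ℝ) := hH.mulVec_eigenvectorBasis i1
    rw [he, WithLp.ofLp_add, WithLp.ofLp_smul, WithLp.ofLp_smul, Matrix.mulVec_add,
      Matrix.mulVec_smul, Matrix.mulVec_smul, h0, h1, smul_smul, smul_smul]
  refine ⟨e, he1, fun h hh => ⟨?_, fun c' hc' => ?_⟩⟩
  · refine Matrix.PosDef.of_dotProduct_mulVec_pos
      (hH.add ((isHermitian_tensorSq e).smul (IsSelfAdjoint.all h))) fun x hx => ?_
    rw [star_trivial, Matrix.add_mulVec, Matrix.smul_mulVec, dotProduct_add, dotProduct_smul,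
      dotProduct_tensorSq_mulVec, smul_eq_mul]
    have hxP : 0 < x ⬝ᵥ P.mulVec x := by simpa using hP.dotProduct_mulVec_pos hx
    set y : E d := WithLp.toLp 2 x with hy
    have hsum := dotProduct_mulVec_eq_sum_eigenvalues hH y
    set x0 := inner ℝ y (b i0) with hx0
    set x1 := inner ℝ y (b i1) with hx1
    have hge : l i0 * x0 ^ 2 + l i1 * x1 ^ 2 ≤ x ⬝ᵥ P.mulVec x := by
      have h2 := Finset.sum_le_sum_of_subset_of_nonneg
        (f := fun i => l i * (inner ℝ y (b i)) ^ 2) (Finset.subset_univ {i0, i1})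
        (fun i _ _ => mul_nonneg (hlpos i).le (sq_nonneg _))
      rw [Finset.sum_pair hne.symm] at h2
      exact h2.trans hsum.symm.le
    have hxe : x ⬝ᵥ (e : Fin d → ℝ) = c * x0 + s * x1 := by
      have : inner ℝ y e = x ⬝ᵥ (e : Fin d → ℝ) := by
        simp only [EuclideanSpace.inner_eq_star_dotProduct, star_trivial]
        rw [dotProduct_comm]
      rw [← this, he, inner_add_right, real_inner_smul_right, real_inner_smul_right]
    rw [hxe]
    exact add_mul_sq_pos hgpos hgle (hlpos i0) (hlpos i1) hspos hs1 hs2 hc2 hxP hge hh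
  -- If `P + h • tensorSq e` were scalar, applying it to `e` would make `e` an eigenvector of `P`.
  -- But `e` has nonzero components along eigenvectors with distinct eigenvalues.
  · have hmul := congrArg (fun B : Matrix (Fin d) (Fin d) ℝ => B.mulVec e) hc'
    simp only [Matrix.add_mulVec, Matrix.smul_mulVec, tensorSq_mulVec, Matrix.one_mulVec] at hmul
    have hee : (e : Fin d → ℝ) ⬝ᵥ (e : Fin d → ℝ) = 1 := by
      have : inner ℝ e e = (e : Fin d → ℝ) ⬝ᵥ (e : Fin d → ℝ) := by
        simp only [EuclideanSpace.inner_eq_star_dotProduct, star_trivial]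
      rw [← this, real_inner_self_eq_norm_sq, he1]
      norm_num
    rw [hee, one_smul, hPe] at hmul
    have hE : (c * l i0) • b i0 + (s * l i1) • b i1 + h • e = c' • e := by
      ext i
      simpa using congrFun hmul i
    have k0 := congrArg (fun v : E d => inner ℝ (b i0) v) hE
    have k1 := congrArg (fun v : E d => inner ℝ (b i1) v) hE
    simp only [he, inner_add_right, real_inner_smul_right, hb00, hb01, hb10, hb11] at k0 k1
    have k0' : l i0 + h = c' := by
      have : c * (l i0 + h - c') = 0 := by linarith
      rcases mul_eq_zero.1 this with h' | h'
      · exact absurd h' hcpos.ne'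
      · linarith
    have k1' : l i1 + h = c' := by
      have : s * (l i1 + h - c') = 0 := by linarith
      rcases mul_eq_zero.1 this with h' | h'
      · exact absurd h' hspos.ne'
      · linarith
    exact hi1 (by linarith)

end LinearAlgebra

/-! ### Iterated directional derivatives -/

section DirectionalDerivatives

variable {Y : Type*} [NormedAddCommGroup Y] [NormedSpace ℝ Y]

/-- The derivative of `f` in the direction `u`. -/
def dirDeriv (u : Y) (f : Y → ℝ) : Y → ℝ := fun y => fderiv ℝ f y u

/-- The iterated derivative of `f` in the directions `u i`, for `i` in a list. -/
def dirDerivs {ι : Type*} (u : ι → Y) : List ι → (Y → ℝ) → Y → ℝ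
  | [], f => f
  | i :: is, f => dirDerivs u is (dirDeriv (u i) f)

theorem contDiff_dirDeriv {f : Y → ℝ} (hf : ContDiff ℝ (⊤ : ℕ∞) f) (u : Y) :
    ContDiff ℝ (⊤ : ℕ∞) (dirDeriv u f) :=
  (hf.fderiv_right (by simp)).clm_apply contDiff_const

theorem contDiff_dirDerivs {ι : Type*} (u : ι → Y) (is : List ι) :
    ∀ {f : Y → ℝ}, ContDiff ℝ (⊤ : ℕ∞) f → ContDiff ℝ (⊤ : ℕ∞) (dirDerivs u is f) := by
  induction is with
  | nil => exact fun hf => hf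
  | cons i is ih => exact fun hf => ih (contDiff_dirDeriv hf _)

theorem tsupport_dirDeriv_subset (f : Y → ℝ) (u : Y) : tsupport (dirDeriv u f) ⊆ tsupport f :=
  tsupport_fderiv_apply_subset ℝ u

theorem tsupport_dirDerivs_subset {ι : Type*} (u : ι → Y) (is : List ι) :
    ∀ f : Y → ℝ, tsupport (dirDerivs u is f) ⊆ tsupport f := by
  induction is with
  | nil => exact fun f => Subset.rfl
  | cons i is ih => exact fun f => (ih _).trans (tsupport_dirDeriv_subset f _)

theorem dirDeriv_comm {f : Y → ℝ} (hf : ContDiff ℝ (⊤ : ℕ∞) f) (u v : Y) :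
    dirDeriv u (dirDeriv v f) = dirDeriv v (dirDeriv u f) := by
  have h1 : Differentiable ℝ (fderiv ℝ f) :=
    (hf.fderiv_right (m := (⊤ : ℕ∞)) (by simp)).differentiable (by simp)
  have key : ∀ (a b : Y) (y : Y), dirDeriv a (dirDeriv b f) y = fderiv ℝ (fderiv ℝ f) y a b := by
    intro a b y
    unfold dirDeriv
    rw [fderiv_clm_apply (h1 y) (differentiableAt_const b)]
    simp
  ext y
  rw [key, key]
  have hs : IsSymmSndFDerivAt ℝ f y := hf.contDiffAt.isSymmSndFDerivAt (by
    rw [minSmoothness_of_isRCLikeNormedField]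
    exact WithTop.coe_le_coe.2 (le_top : (2 : ℕ∞) ≤ ⊤))
  exact hs.eq u v

theorem dirDeriv_add {f g : Y → ℝ} (hf : ContDiff ℝ (⊤ : ℕ∞) f) (hg : ContDiff ℝ (⊤ : ℕ∞) g)
    (u : Y) : dirDeriv u (fun y => f y + g y) = fun y => dirDeriv u f y + dirDeriv u g y := by
  ext y
  unfold dirDeriv
  rw [fderiv_fun_add (hf.differentiable (by simp) y) (hg.differentiable (by simp) y)]
  rfl

theorem dirDeriv_const_mul {f : Y → ℝ} (hf : ContDiff ℝ (⊤ : ℕ∞) f) (c : ℝ) (u : Y) :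
    dirDeriv u (fun y => c * f y) = fun y => c * dirDeriv u f y := by
  ext y
  unfold dirDeriv
  rw [fderiv_const_mul (hf.differentiable (by simp) y)]
  rfl

theorem dirDerivs_add {ι : Type*} (u : ι → Y) (is : List ι) :
    ∀ {f g : Y → ℝ}, ContDiff ℝ (⊤ : ℕ∞) f → ContDiff ℝ (⊤ : ℕ∞) g →
      dirDerivs u is (fun y => f y + g y) = fun y => dirDerivs u is f y + dirDerivs u is g y := by
  induction is with
  | nil => intros; rfl
  | cons i is ih =>
    intro f g hf hg
    simp only [dirDerivs]
    rw [dirDeriv_add hf hg, ih (contDiff_dirDeriv hf _) (contDiff_dirDeriv hg _)]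

theorem dirDerivs_const_mul {ι : Type*} (u : ι → Y) (is : List ι) (c : ℝ) :
    ∀ {f : Y → ℝ}, ContDiff ℝ (⊤ : ℕ∞) f →
      dirDerivs u is (fun y => c * f y) = fun y => c * dirDerivs u is f y := by
  induction is with
  | nil => intros; rfl
  | cons i is ih =>
    intro f hf
    simp only [dirDerivs]
    rw [dirDeriv_const_mul hf, ih (contDiff_dirDeriv hf _)]

/-- The head of the list is applied first, so a derivative taken last has to be commuted through all
the others. -/
theorem dirDeriv_dirDerivs {ι : Type*} (u : ι → Y) (i : ι) (is : List ι) :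
    ∀ {f : Y → ℝ}, ContDiff ℝ (⊤ : ℕ∞) f →
      dirDeriv (u i) (dirDerivs u is f) = dirDerivs u (i :: is) f := by
  induction is with
  | nil => intros; rfl
  | cons j is ih =>
    intro f hf
    simp only [dirDerivs] at ih ⊢
    rw [ih (contDiff_dirDeriv hf _), dirDeriv_comm hf]

theorem dirDerivs_perm {ι : Type*} (u : ι → Y) {is js : List ι} (h : is.Perm js) :
    ∀ {f : Y → ℝ}, ContDiff ℝ (⊤ : ℕ∞) f → dirDerivs u is f = dirDerivs u js f := by
  induction h with
  | nil => intros; rfl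
  | cons i _ ih => exact fun hf => ih (contDiff_dirDeriv hf _)
  | swap i j is =>
    intro f hf
    simp only [dirDerivs]
    rw [dirDeriv_comm hf]
  | trans _ _ ih1 ih2 => exact fun hf => (ih1 hf).trans (ih2 hf)

/-! ### Derivatives of modulated oscillations -/

theorem contDiff_mul_cos {η : Y → ℝ} (hη : ContDiff ℝ (⊤ : ℕ∞) η) (l : Y →L[ℝ] ℝ) (N θ : ℝ) :
    ContDiff ℝ (⊤ : ℕ∞) (fun y => η y * Real.cos (N * l y + θ)) :=
  hη.mul (Real.contDiff_cos.comp ((contDiff_const.mul l.contDiff).add contDiff_const))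

theorem dirDeriv_mul_cos {η : Y → ℝ} (hη : ContDiff ℝ (⊤ : ℕ∞) η) (l : Y →L[ℝ] ℝ) (N θ : ℝ)
    (u : Y) :
    dirDeriv u (fun y => η y * Real.cos (N * l y + θ)) = fun y =>
      dirDeriv u η y * Real.cos (N * l y + θ)
        + (N * l u) * (η y * Real.cos (N * l y + (θ + Real.pi / 2))) := by
  ext y
  have h1 : HasFDerivAt η (fderiv ℝ η y) y := (hη.differentiable (by simp) y).hasFDerivAt
  have h2 : HasFDerivAt (fun y => Real.cos (N * l y + θ))
      (-Real.sin (N * l y + θ) • (N • (l : Y →L[ℝ] ℝ))) y :=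
    ((l.hasFDerivAt.const_mul N).add_const θ).cos
  unfold dirDeriv
  rw [(h1.fun_mul h2).fderiv, ← add_assoc, Real.cos_add_pi_div_two]
  simp
  ring

theorem exists_bound_of_hasCompactSupport {Z : Type*} [TopologicalSpace Z] {f : Z → ℝ}
    (hf : Continuous f) (hc : HasCompactSupport f) : ∃ C, 0 ≤ C ∧ ∀ y, |f y| ≤ C := by
  obtain ⟨C, hC⟩ := hf.bounded_above_of_compact_support hc
  exact ⟨max C 0, le_max_right _ _, fun y => (hC y).trans (le_max_left _ _)⟩

/-- A derivative falling on the cosine contributes `N * l (u i)` and advances the phase by π/2; one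
falling on `η` loses a power of `N`. The error is multiplied by `N` on the left so that no exponent
`is.length - 1` appears. Since the first direction is peeled off first, the induction has to run
over all `η` and `θ`. -/
theorem exists_bound_dirDerivs_mul_cos {ι : Type*} (u : ι → Y) (l : Y →L[ℝ] ℝ) (is : List ι) :
    ∀ {η : Y → ℝ}, ContDiff ℝ (⊤ : ℕ∞) η → HasCompactSupport η → ∀ θ : ℝ,
      ∃ C, 0 ≤ C ∧ ∀ N : ℝ, 1 ≤ N → ∀ y,
        |dirDerivs u is (fun y => η y * Real.cos (N * l y + θ)) y
          - N ^ is.length * ((is.map fun i => l (u i)).prod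
            * (η y * Real.cos (N * l y + (θ + is.length * (Real.pi / 2)))))| * N
          ≤ C * N ^ is.length := by
  induction is with
  | nil =>
    intro η _ _ θ
    exact ⟨0, le_rfl, fun N _ y => by simp [dirDerivs]⟩
  | cons i is ih =>
    intro η hη hc θ
    have hη' := contDiff_dirDeriv hη (u i)
    have hc' : HasCompactSupport (dirDeriv (u i) η) :=
      hc.mono' ((subset_tsupport _).trans (tsupport_dirDeriv_subset η (u i)))
    obtain ⟨C1, hC10, hC1⟩ := ih hη' hc' θ
    obtain ⟨C2, hC20, hC2⟩ := ih hη hc (θ + Real.pi / 2)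
    obtain ⟨K, hK0, hK⟩ := exists_bound_of_hasCompactSupport hη'.continuous hc'
    set P := (is.map fun i => l (u i)).prod with hP
    refine ⟨C1 + |P| * K + |l (u i)| * C2, by positivity, fun N hN y => ?_⟩
    have hN0 : 0 < N := by linarith
    set n := is.length with hn
    have e1 : dirDerivs u (i :: is) (fun y => η y * Real.cos (N * l y + θ)) y
        = dirDerivs u is (fun y => dirDeriv (u i) η y * Real.cos (N * l y + θ)) y
          + (N * l (u i))
            * dirDerivs u is (fun y => η y * Real.cos (N * l y + (θ + Real.pi / 2))) y := by
      simp only [dirDerivs]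
      rw [dirDeriv_mul_cos hη, dirDerivs_add u is (contDiff_mul_cos hη' l N θ)
        (contDiff_const.mul (contDiff_mul_cos hη l N _)),
        dirDerivs_const_mul u is _ (contDiff_mul_cos hη l N _)]
    rw [e1]
    simp only [List.map_cons, List.prod_cons, List.length_cons]
    have hang : θ + ((n + 1 : ℕ) : ℝ) * (Real.pi / 2)
        = θ + Real.pi / 2 + n * (Real.pi / 2) := by push_cast; ring
    rw [hang, ← hP]
    have b1 := hC1 N hN y
    have b2 := hC2 N hN y
    set X1 := dirDerivs u is (fun y => dirDeriv (u i) η y * Real.cos (N * l y + θ)) y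
    set X2 := dirDerivs u is (fun y => η y * Real.cos (N * l y + (θ + Real.pi / 2))) y
    set c1 := Real.cos (N * l y + (θ + n * (Real.pi / 2)))
    set c2 := Real.cos (N * l y + (θ + Real.pi / 2 + n * (Real.pi / 2)))
    have hX1 : |X1| ≤ (C1 + |P| * K) * N ^ n := by
      have h1 : |X1 - N ^ n * (P * (dirDeriv (u i) η y * c1))| ≤ C1 * N ^ n :=
        (le_mul_of_one_le_right (abs_nonneg _) hN).trans b1
      have h2 : |N ^ n * (P * (dirDeriv (u i) η y * c1))| ≤ N ^ n * (|P| * (K * 1)) := by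
        rw [abs_mul, abs_mul, abs_mul, abs_of_pos (pow_pos hN0 n)]
        gcongr
        · exact hK y
        · exact Real.abs_cos_le_one _
      have h3 : |X1| ≤ |X1 - N ^ n * (P * (dirDeriv (u i) η y * c1))|
          + |N ^ n * (P * (dirDeriv (u i) η y * c1))| := by
        have := abs_add_le (X1 - N ^ n * (P * (dirDeriv (u i) η y * c1)))
          (N ^ n * (P * (dirDeriv (u i) η y * c1)))
        simpa using this
      linarith
    have hsplit : X1 + N * l (u i) * X2 - N ^ (n + 1) * (l (u i) * P * (η y * c2))
        = X1 + N * l (u i) * (X2 - N ^ n * (P * (η y * c2))) := by ring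
    rw [hsplit]
    have h4 : |X1 + N * l (u i) * (X2 - N ^ n * (P * (η y * c2)))|
        ≤ |X1| + N * |l (u i)| * |X2 - N ^ n * (P * (η y * c2))| := by
      refine (abs_add_le _ _).trans_eq ?_
      rw [abs_mul, abs_mul, abs_of_pos hN0]
    calc _ ≤ (|X1| + N * |l (u i)| * |X2 - N ^ n * (P * (η y * c2))|) * N := by gcongr
      _ = |X1| * N + |l (u i)| * N * (|X2 - N ^ n * (P * (η y * c2))| * N) := by ring
      _ ≤ ((C1 + |P| * K) * N ^ n) * N + |l (u i)| * N * (C2 * N ^ n) := by gcongr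
      _ = _ := by ring

/-! ### Localised plane waves -/

/-- Localised plane waves: the fields `m = c₁ e + c₂ ξ`, `M = a (e ⊗ e - ξ ⊗ ξ) + b (e ⊗ ξ + ξ ⊗ e)`
solve `∂ₜ m + div M = 0`, `div m = 0`, where `u = (∂ₜ, e, ξ)`, they are close to
`cos (N l) η e` and `κ cos (N l) η (e ⊗ ξ + ξ ⊗ e)`. -/
theorem exists_localised_planeWave (u : Fin 3 → Y) (l : Y →L[ℝ] ℝ) (κ : ℝ) (h0 : l (u 0) = -κ)
    (h1 : l (u 1) = 0) (h2 : l (u 2) = 1) {η : Y → ℝ} (hη : ContDiff ℝ (⊤ : ℕ∞) η)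
    (hc : HasCompactSupport η) :
    ∃ C, 0 ≤ C ∧ ∀ N : ℝ, 1 ≤ N → ∃ c₁ c₂ a b : Y → ℝ,
      (∀ f ∈ ({c₁, c₂, a, b} : Set (Y → ℝ)), ContDiff ℝ (⊤ : ℕ∞) f ∧ tsupport f ⊆ tsupport η) ∧
      (∀ y, dirDeriv (u 0) c₁ y + dirDeriv (u 1) a y + dirDeriv (u 2) b y = 0) ∧
      (∀ y, dirDeriv (u 0) c₂ y - dirDeriv (u 2) a y + dirDeriv (u 1) b y = 0) ∧
      (∀ y, dirDeriv (u 1) c₁ y + dirDeriv (u 2) c₂ y = 0) ∧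
      ∀ y, |c₁ y - η y * Real.cos (N * l y)| ≤ C / N ∧ |c₂ y| ≤ C / N ∧ |a y| ≤ C / N ∧
        |b y - κ * (η y * Real.cos (N * l y))| ≤ C / N := by
  -- Four derivatives advance the phase by a full period, so the leading term is again the original
  -- cosine, and the factor `N⁻⁴` normalises it.
  have key : ∀ is : List (Fin 3), is.length = 4 → ∃ C, 0 ≤ C ∧ ∀ N : ℝ, 1 ≤ N → ∀ y,
      |dirDerivs u is (fun y => (N ^ 4)⁻¹ * (η y * Real.cos (N * l y + 0))) y
        - (is.map fun i => l (u i)).prod * (η y * Real.cos (N * l y))| ≤ C / N := by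
    intro is his
    obtain ⟨C, hC0, hC⟩ := exists_bound_dirDerivs_mul_cos u l is hη hc 0
    refine ⟨C, hC0, fun N hN y => ?_⟩
    have hN0 : 0 < N := by linarith
    have h := hC N hN y
    rw [dirDerivs_const_mul u is _ (contDiff_mul_cos hη l N 0)]
    have hcos : Real.cos (N * l y + (0 + ((4 : ℕ) : ℝ) * (Real.pi / 2))) = Real.cos (N * l y) := by
      rw [← Real.cos_add_two_pi (N * l y)]
      congr 1
      push_cast
      ring
    rw [his, hcos] at h
    set P := (is.map fun i => l (u i)).prod * (η y * Real.cos (N * l y))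
    set X := dirDerivs u is (fun y => η y * Real.cos (N * l y + 0)) y
    have e : (N ^ 4)⁻¹ * X - P = (N ^ 4)⁻¹ * (X - N ^ 4 * P) := by
      field_simp
    show |(N ^ 4)⁻¹ * X - P| ≤ C / N
    rw [e, abs_mul, abs_of_pos (by positivity : 0 < (N ^ 4)⁻¹), le_div_iff₀ hN0, mul_assoc,
      inv_mul_le_iff₀ (by positivity)]
    linarith
  obtain ⟨A1, hA10, hA1⟩ := key [2, 2, 1, 1] rfl
  obtain ⟨A2, hA20, hA2⟩ := key [2, 2, 2, 2] rfl
  obtain ⟨A3, hA30, hA3⟩ := key [1, 1, 1, 2] rfl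
  obtain ⟨A4, hA40, hA4⟩ := key [1, 2, 2, 2] rfl
  obtain ⟨A5, hA50, hA5⟩ := key [1, 2, 0, 2] rfl
  obtain ⟨A6, hA60, hA6⟩ := key [1, 1, 0, 2] rfl
  obtain ⟨A7, hA70, hA7⟩ := key [2, 2, 0, 2] rfl
  simp only [List.map_cons, List.map_nil, List.prod_cons, List.prod_nil, h0, h1, h2, mul_zero,
    zero_mul, mul_one, one_mul, sub_zero] at hA1 hA2 hA3 hA4 hA5 hA6 hA7
  refine ⟨A1 + A2 + A3 + A4 + 2 * A5 + A6 + A7, by positivity, fun N hN => ?_⟩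
  have hN0 : 0 < N := by linarith
  set χ : Y → ℝ := fun y => (N ^ 4)⁻¹ * (η y * Real.cos (N * l y + 0)) with hχ
  have hχs : ContDiff ℝ (⊤ : ℕ∞) χ := contDiff_const.mul (contDiff_mul_cos hη l N 0)
  have hχt : tsupport χ ⊆ tsupport η :=
    closure_mono fun y hy => by
      simp only [hχ, Function.mem_support] at hy ⊢
      exact fun h => hy (by simp [h])
  set D := dirDerivs u with hD
  have hs : ∀ is, ContDiff ℝ (⊤ : ℕ∞) (D is χ) := fun is => contDiff_dirDerivs u is hχs
  have ht : ∀ is, tsupport (D is χ) ⊆ tsupport η := fun is =>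
    (tsupport_dirDerivs_subset u is χ).trans hχt
  have hz : ∀ is, ∀ y ∉ tsupport η, D is χ y = 0 := fun is y hy =>
    image_eq_zero_of_notMem_tsupport fun h => hy (ht is h)
  have hd : ∀ i is, dirDeriv (u i) (D is χ) = D (i :: is) χ := fun i is =>
    dirDeriv_dirDerivs u i is hχs
  have hsm : ∀ (c : ℝ) is, ContDiff ℝ (⊤ : ℕ∞) (fun y => c * D is χ y) := fun c is =>
    contDiff_const.mul (hs is)
  have hlin : ∀ (v : Y) (p q : ℝ) is js, dirDeriv v (fun y => p * D is χ y + q * D js χ y)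
      = fun y => p * dirDeriv v (D is χ) y + q * dirDeriv v (D js χ) y := by
    intro v p q is js
    rw [dirDeriv_add (hsm p is) (hsm q js), dirDeriv_const_mul (hs is), dirDeriv_const_mul (hs js)]
  have hcl : ∀ (p q : ℝ) is js, ContDiff ℝ (⊤ : ℕ∞) (fun y => p * D is χ y + q * D js χ y) ∧
      tsupport (fun y => p * D is χ y + q * D js χ y) ⊆ tsupport η := by
    intro p q is js
    refine ⟨(hsm p is).add (hsm q js), ?_⟩
    refine closure_minimal (fun y hy => ?_) (isClosed_tsupport η)
    by_contra hny
    exact hy (by simp [hz is y hny, hz js y hny])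
  have hperm : ∀ {is js : List (Fin 3)}, is.Perm js → D is χ = D js χ := fun h =>
    dirDerivs_perm u h hχs
  -- Writing ∂₀, ∂₁, ∂₂ for the derivatives along `u`, take c₁ = ∂₂²(∂₁² + ∂₂²)χ, c₂ = -∂₁∂₂(∂₁² +
  -- ∂₂²)χ, a = -2∂₀∂₁∂₂²χ and b = ∂₀∂₂(∂₁² - ∂₂²)χ. The three equations then hold identically.
  -- Since `l` vanishes on `u 1`, only ∂₂⁴χ and ∂₀∂₂³χ survive at leading order. The term with
  -- coefficient 0 merely gives `a` the common two-term shape.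
  refine ⟨fun y => 1 * D [2, 2, 1, 1] χ y + 1 * D [2, 2, 2, 2] χ y,
    fun y => (-1) * D [1, 1, 1, 2] χ y + (-1) * D [1, 2, 2, 2] χ y,
    fun y => (-2) * D [1, 2, 0, 2] χ y + 0 * D [] χ y,
    fun y => 1 * D [1, 1, 0, 2] χ y + (-1) * D [2, 2, 0, 2] χ y, ?_, ?_, ?_, ?_, ?_⟩
  · intro f hf
    simp only [mem_insert_iff, mem_singleton_iff] at hf
    rcases hf with rfl | rfl | rfl | rfl <;> exact hcl _ _ _ _
  · intro y
    simp only [hlin, hd]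
    rw [hperm (show List.Perm [0, 2, 2, 1, 1] [2, 1, 1, 0, (2 : Fin 3)] by decide),
      hperm (show List.Perm [1, 1, 2, 0, 2] [2, 1, 1, 0, (2 : Fin 3)] by decide),
      hperm (show List.Perm [0, 2, 2, 2, 2] [2, 2, 2, 0, (2 : Fin 3)] by decide)]
    ring
  · intro y
    simp only [hlin, hd]
    rw [hperm (show List.Perm [0, 1, 1, 1, 2] [1, 1, 1, 0, (2 : Fin 3)] by decide),
      hperm (show List.Perm [0, 1, 2, 2, 2] [1, 2, 2, 0, (2 : Fin 3)] by decide),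
      hperm (show List.Perm [2, 1, 2, 0, 2] [1, 2, 2, 0, (2 : Fin 3)] by decide)]
    ring
  · intro y
    simp only [hlin, hd]
    rw [hperm (show List.Perm [1, 2, 2, 1, 1] [2, 1, 1, 1, (2 : Fin 3)] by decide),
      hperm (show List.Perm [1, 2, 2, 2, 2] [2, 1, 2, 2, (2 : Fin 3)] by decide)]
    ring
  · intro y
    have b1 := hA1 N hN y
    have b2 := hA2 N hN y
    have b3 := hA3 N hN y
    have b4 := hA4 N hN y
    have b5 := hA5 N hN y
    have b6 := hA6 N hN y
    have b7 := hA7 N hN y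
    rw [← hχ] at b1 b2 b3 b4 b5 b6 b7
    have g1 : 0 ≤ A1 / N := by positivity
    have g2 : 0 ≤ A2 / N := by positivity
    have g3 : 0 ≤ A3 / N := by positivity
    have g4 : 0 ≤ A4 / N := by positivity
    have g5 : 0 ≤ A5 / N := by positivity
    have g6 : 0 ≤ A6 / N := by positivity
    have g7 : 0 ≤ A7 / N := by positivity
    have hsum : (A1 + A2 + A3 + A4 + 2 * A5 + A6 + A7) / N
        = A1 / N + A2 / N + A3 / N + A4 / N + 2 * (A5 / N) + A6 / N + A7 / N := by ring
    rw [hsum]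
    rw [abs_le] at b1 b2 b3 b4 b5 b6 b7
    refine ⟨?_, ?_, ?_, ?_⟩ <;> rw [abs_le] <;> constructor <;> linarith [b1.1, b1.2, b2.1, b2.2,
      b3.1, b3.2, b4.1, b4.2, b5.1, b5.2, b6.1, b6.2, b7.1, b7.2]

end DirectionalDerivatives

/-! ### Flat coverings -/

section FlatCovering

set_option linter.unusedSectionVars false

variable {d : ℕ} {𝕏 : Type} [AddCommGroup 𝕏] [TopologicalSpace 𝕏] [MeasureSpace 𝕏]

/-- `π : ℝ^d → 𝕏` is an additive open quotient map that is injective and measure preserving on all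
balls of some radius. -/
structure IsFlatCovering (π : E d → 𝕏) : Prop where
  isOpenQuotientMap : IsOpenQuotientMap π
  map_add : ∀ x y, π (x + y) = π x + π y
  exists_chart : ∃ R > 0, ∀ x, InjOn π (Metric.ball x R) ∧
    MeasurePreserving π (volume.restrict (Metric.ball x R))
      (volume.restrict (π '' Metric.ball x R))

/-- By injectivity on `B`, the preimage of `f '' s` meets `B` exactly in `s`. -/
theorem measurePreserving_restrict_of_injOn {α β : Type*} [MeasurableSpace α] [MeasurableSpace β]
    {μ : Measure α} {ν : Measure β} {f : α → β} {B s : Set α}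
    (hf : MeasurePreserving f (μ.restrict B) ν) (hinj : InjOn f B) (hs : s ⊆ B)
    (him : MeasurableSet (f '' s)) :
    MeasurePreserving f (μ.restrict s) (ν.restrict (f '' s)) := by
  have h := hf.restrict_preimage him
  have hset : f ⁻¹' (f '' s) ∩ B = s := by
    ext x
    constructor
    · rintro ⟨⟨y, hy, hyx⟩, hx⟩
      exact hinj (hs hy) hx hyx ▸ hy
    · exact fun hx => ⟨mem_image_of_mem f hx, hs hx⟩
  have hmeas : MeasurableSet (f ⁻¹' (f '' s)) := hf.measurable him
  rwa [Measure.restrict_restrict hmeas, hset] at h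

theorem IsFlatCovering.measurePreserving_ball [BorelSpace 𝕏] {π : E d → 𝕏}
    (hπ : IsFlatCovering π) {x : E d} {R r : ℝ}
    (h : InjOn π (Metric.ball x R) ∧ MeasurePreserving π (volume.restrict (Metric.ball x R))
      (volume.restrict (π '' Metric.ball x R))) (hr : r ≤ R) :
    MeasurePreserving π (volume.restrict (Metric.ball x r))
      (volume.restrict (π '' Metric.ball x r)) := by
  have him : ∀ s : ℝ, MeasurableSet (π '' Metric.ball x s) := fun s =>
    (hπ.isOpenQuotientMap.isOpenMap _ Metric.isOpen_ball).measurableSet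
  have hsub : Metric.ball x r ⊆ Metric.ball x R := Metric.ball_subset_ball hr
  have h2 := measurePreserving_restrict_of_injOn h.2 h.1 hsub (him r)
  rwa [Measure.restrict_restrict (him r),
    inter_eq_left.2 (image_mono hsub)] at h2

theorem isFlatCovering_spaceProj (d : ℕ) : IsFlatCovering (spaceProj d) := by
  have hid : spaceProj d = id := rfl
  rw [hid]
  refine ⟨IsOpenQuotientMap.id, fun x y => rfl, 1, one_pos, fun x => ⟨injOn_id _, ?_⟩⟩
  rw [image_id]
  exact MeasurePreserving.id _

/-- The half-open unit cube centred at `x` is a fundamental domain on which the projection is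
injective and measure preserving, and it contains the ball of radius 1/2. -/
theorem isFlatCovering_torusProj (d : ℕ) : IsFlatCovering (torusProj d) := by
  have hcomp : torusProj d = Pi.map (fun _ : Fin d => (QuotientAddGroup.mk : ℝ → UnitAddCircle)) ∘
      (MeasurableEquiv.toLp 2 (Fin d → ℝ)).symm := rfl
  have hopen : IsOpenQuotientMap (torusProj d) := by
    rw [hcomp]
    refine (IsOpenQuotientMap.piMap fun _ => QuotientAddGroup.isOpenQuotientMap_mk).comp ?_
    exact (PiLp.homeomorph 2 (fun _ : Fin d => ℝ)).isOpenQuotientMap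
  refine ⟨hopen, fun x y => ?_, 1 / 2, by norm_num, fun x => ?_⟩
  · ext i
    simp [torusProj]
  set B : Set (E d) := (MeasurableEquiv.toLp 2 (Fin d → ℝ)).symm ⁻¹'
    (univ.pi fun i => Ioc (x i - 1 / 2) (x i - 1 / 2 + 1)) with hB
  have hmeas : MeasurableSet (univ.pi fun i => Ioc (x i - 1 / 2) (x i - 1 / 2 + 1)) :=
    MeasurableSet.univ_pi fun i => measurableSet_Ioc
  have h1 : MeasurePreserving (torusProj d) (volume.restrict B) volume := by
    rw [hcomp]
    refine MeasurePreserving.comp (μb := (volume : Measure (Fin d → ℝ)).restrict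
      (univ.pi fun i => Ioc (x i - 1 / 2) (x i - 1 / 2 + 1))) ?_
      ((EuclideanSpace.volume_preserving_symm_measurableEquiv_toLp (Fin d)).restrict_preimage hmeas)
    rw [volume_pi, Measure.restrict_pi_pi]
    exact measurePreserving_pi _ _ fun i => AddCircle.measurePreserving_mk 1 (x i - 1 / 2)
  have hinj : InjOn (torusProj d) B := by
    intro y hy z hz hyz
    ext i
    have hi : ((y i : ℝ) : UnitAddCircle) = ((z i : ℝ) : UnitAddCircle) := congrFun hyz i
    have hyi : y i ∈ Ioc (x i - 1 / 2) (x i - 1 / 2 + 1) := hy i (mem_univ i)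
    have hzi : z i ∈ Ioc (x i - 1 / 2) (x i - 1 / 2 + 1) := hz i (mem_univ i)
    obtain ⟨n, hn⟩ := AddSubgroup.mem_zmultiples_iff.1 (QuotientAddGroup.eq.1 hi)
    simp only [zsmul_eq_mul, mul_one] at hn
    have hn1 : (n : ℝ) < 1 := by linarith [hyi.1, hyi.2, hzi.1, hzi.2]
    have hn2 : (-1 : ℝ) < n := by linarith [hyi.1, hyi.2, hzi.1, hzi.2]
    have hn0 : n = 0 := by
      have a1 : n < 1 := by exact_mod_cast hn1
      have a2 : -1 < n := by exact_mod_cast hn2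
      omega
    rw [hn0] at hn
    simp only [Int.cast_zero] at hn
    linarith
  have hsub : Metric.ball x (1 / 2) ⊆ B := by
    intro y hy i _
    have h : |y i - x i| < 1 / 2 := by
      have h2 : ‖(y - x) i‖ ≤ ‖y - x‖ := PiLp.norm_apply_le (y - x) i
      rw [Metric.mem_ball, dist_eq_norm] at hy
      exact lt_of_le_of_lt (by simpa using h2) hy
    rw [abs_lt] at h
    constructor
    · show x i - 1 / 2 < y i
      linarith [h.1]
    · show y i ≤ x i - 1 / 2 + 1
      linarith [h.2]
  exact ⟨hinj.mono hsub, measurePreserving_restrict_of_injOn h1 hinj hsub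
    (hopen.isOpenMap _ Metric.isOpen_ball).measurableSet⟩

/-! ### Test functions -/

variable {π : E d → 𝕏}

theorem IsFlatCovering.isOpenQuotientMap_prodMap (hπ : IsFlatCovering π) :
    IsOpenQuotientMap (Prod.map (id : ℝ → ℝ) π) :=
  IsOpenQuotientMap.id.prodMap hπ.isOpenQuotientMap

/-- The time direction in space-time. -/
def timeDir (d : ℕ) : ℝ × E d := (1, 0)

/-- A spatial direction in space-time. -/
def spaceDir (v : E d) : ℝ × E d := (0, v)

theorem hasDerivAt_comp_add_smul {Y : Type*} [NormedAddCommGroup Y] [NormedSpace ℝ Y] {f : Y → ℝ}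
    {y : Y} (hf : DifferentiableAt ℝ f y) (u : Y) :
    HasDerivAt (fun s : ℝ => f (y + s • u)) (fderiv ℝ f y u) 0 := by
  have h1 : HasDerivAt (fun s : ℝ => y + s • u) u 0 := by
    simpa using ((hasDerivAt_id (0 : ℝ)).smul_const u).const_add y
  have h2 : HasFDerivAt f (fderiv ℝ f y) (y + (0 : ℝ) • u) := by simpa using hf.hasFDerivAt
  exact h2.comp_hasDerivAt 0 h1

theorem dt_eq_dirDeriv {T : ℝ} {φ : ℝ × 𝕏 → ℝ} (hφ : IsTestFunction π T φ)
    (t : ℝ) (y : E d) :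
    dt φ t (π y) = dirDeriv (timeDir d) (fun y : ℝ × E d => φ (y.1, π y.2)) (t, y) := by
  have h := hasDerivAt_comp_add_smul (hφ.smooth.differentiable (by simp) (t, y)) (timeDir d)
  have h0 : HasDerivAt (fun s : ℝ => φ (s + t, π y)) (dirDeriv (timeDir d)
      (fun y : ℝ × E d => φ (y.1, π y.2)) (t, y)) (t - t) := by
    rw [sub_self]
    refine h.congr_of_eventuallyEq (Eventually.of_forall fun s => ?_)
    simp [timeDir, add_comm]
  have h2 := h0.comp_sub_const t t
  simp only [sub_add_cancel] at h2
  exact h2.deriv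

theorem dx_eq_dirDeriv (hπ : IsFlatCovering π) {T : ℝ} {φ : ℝ × 𝕏 → ℝ}
    (hφ : IsTestFunction π T φ) (j : Fin d) (t : ℝ) (y : E d) :
    dx π j φ t (π y) = dirDeriv (spaceDir (EuclideanSpace.single j (1 : ℝ)))
      (fun y : ℝ × E d => φ (y.1, π y.2)) (t, y) := by
  have h := hasDerivAt_comp_add_smul (hφ.smooth.differentiable (by simp) (t, y))
    (spaceDir (EuclideanSpace.single j (1 : ℝ)))
  refine HasDerivAt.deriv (h.congr_of_eventuallyEq (Eventually.of_forall fun s => ?_))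
  simp [spaceDir, hπ.map_add]

theorem IsTestFunction.contDiff_dirDeriv {T : ℝ} {φ : ℝ × 𝕏 → ℝ} (hφ : IsTestFunction π T φ)
    (u : ℝ × E d) :
    ContDiff ℝ (⊤ : ℕ∞) (dirDeriv u (fun y : ℝ × E d => φ (y.1, π y.2))) :=
  IsentropicEuler.contDiff_dirDeriv hφ.smooth u

theorem dirDeriv_eq_zero_of_notMem_tsupport (hπ : IsFlatCovering π) {φ : ℝ × 𝕏 → ℝ} (u : ℝ × E d)
    {t : ℝ} {y : E d} (h : (t, π y) ∉ tsupport φ) :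
    dirDeriv u (fun y : ℝ × E d => φ (y.1, π y.2)) (t, y) = 0 := by
  have h1 : φ =ᶠ[𝓝 (t, π y)] 0 := notMem_tsupport_iff_eventuallyEq.1 h
  have h2 : Tendsto (fun y : ℝ × E d => (y.1, π y.2)) (𝓝 (t, y)) (𝓝 (t, π y)) :=
    hπ.isOpenQuotientMap_prodMap.continuous.tendsto (t, y)
  have h3 : (fun y : ℝ × E d => φ (y.1, π y.2)) =ᶠ[𝓝 (t, y)] fun _ => 0 := h2.eventually h1
  unfold dirDeriv
  rw [h3.fderiv_eq]
  simp

/-- A function on `ℝ × 𝕏` whose lift to `ℝ × ℝ^d` is a directional derivative of the lift of a test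
function. -/
def IsLiftedDeriv (π : E d → 𝕏) (φ : ℝ × 𝕏 → ℝ) (f : ℝ → 𝕏 → ℝ) : Prop :=
  ∃ u : ℝ × E d, ∀ t y, f t (π y) = dirDeriv u (fun y : ℝ × E d => φ (y.1, π y.2)) (t, y)

theorem isLiftedDeriv_dt {T : ℝ} {φ : ℝ × 𝕏 → ℝ} (hφ : IsTestFunction π T φ) :
    IsLiftedDeriv π φ (dt φ) := ⟨_, dt_eq_dirDeriv hφ⟩

theorem isLiftedDeriv_dx (hπ : IsFlatCovering π) {T : ℝ} {φ : ℝ × 𝕏 → ℝ}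
    (hφ : IsTestFunction π T φ) (j : Fin d) : IsLiftedDeriv π φ (dx π j φ) :=
  ⟨_, dx_eq_dirDeriv hπ hφ j⟩

theorem IsLiftedDeriv.continuous (hπ : IsFlatCovering π) {T : ℝ} {φ : ℝ × 𝕏 → ℝ}
    (hφ : IsTestFunction π T φ) {f : ℝ → 𝕏 → ℝ} (hf : IsLiftedDeriv π φ f) :
    Continuous fun y : ℝ × 𝕏 => f y.1 y.2 := by
  obtain ⟨u, hu⟩ := hf
  rw [← hπ.isOpenQuotientMap_prodMap.continuous_comp_iff]
  have : (fun y : ℝ × 𝕏 => f y.1 y.2) ∘ Prod.map id π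
      = dirDeriv u (fun y : ℝ × E d => φ (y.1, π y.2)) := by
    ext ⟨t, y⟩
    exact hu t y
  rw [this]
  exact (hφ.contDiff_dirDeriv u).continuous

theorem IsLiftedDeriv.eq_zero (hπ : IsFlatCovering π) {φ : ℝ × 𝕏 → ℝ} {f : ℝ → 𝕏 → ℝ}
    (hf : IsLiftedDeriv π φ f) {t : ℝ} {x : 𝕏} (h : (t, x) ∉ tsupport φ) : f t x = 0 := by
  obtain ⟨u, hu⟩ := hf
  obtain ⟨y, rfl⟩ := hπ.isOpenQuotientMap.surjective x
  rw [hu]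
  exact dirDeriv_eq_zero_of_notMem_tsupport hπ u h

theorem IsLiftedDeriv.exists_bound [T2Space 𝕏] (hπ : IsFlatCovering π) {T : ℝ} {φ : ℝ × 𝕏 → ℝ}
    (hφ : IsTestFunction π T φ) {f : ℝ → 𝕏 → ℝ} (hf : IsLiftedDeriv π φ f) :
    ∃ C, 0 ≤ C ∧ ∀ t x, |f t x| ≤ C := by
  obtain ⟨C, hC0, hC⟩ := exists_bound_of_hasCompactSupport (hf.continuous hπ hφ)
    (HasCompactSupport.intro hφ.compact fun y hy => hf.eq_zero hπ hy)
  exact ⟨C, hC0, fun t x => hC (t, x)⟩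

/-- The compact spatial projection of the support of a test function. -/
def spatialSupport (φ : ℝ × 𝕏 → ℝ) : Set 𝕏 := Prod.snd '' tsupport φ

theorem IsTestFunction.isCompact_spatialSupport {T : ℝ} {φ : ℝ × 𝕏 → ℝ}
    (hφ : IsTestFunction π T φ) : IsCompact (spatialSupport φ) :=
  hφ.compact.isCompact.image continuous_snd

theorem IsLiftedDeriv.eq_zero_of_notMem_spatialSupport (hπ : IsFlatCovering π) {φ : ℝ × 𝕏 → ℝ}
    {f : ℝ → 𝕏 → ℝ} (hf : IsLiftedDeriv π φ f) {t : ℝ} {x : 𝕏} (h : x ∉ spatialSupport φ) :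
    f t x = 0 :=
  hf.eq_zero hπ fun h' => h ⟨_, h', rfl⟩

/-! ### Transport of functions from a ball to the base -/

/-- The function on `𝕏` that is `f` on `s`, regarded as a subset of `𝕏`, and zero elsewhere. -/
def extendBall (π : E d → 𝕏) (s : Set (E d)) {F : Type*} [Zero F] (f : E d → F) (x : 𝕏) : F :=
  open Classical in if h : ∃ y ∈ s, π y = x then f h.choose else 0

theorem extendBall_apply {s : Set (E d)} (hs : InjOn π s) {F : Type*} [Zero F] (f : E d → F)
    {y : E d} (hy : y ∈ s) : extendBall π s f (π y) = f y := by
  have h : ∃ z ∈ s, π z = π y := ⟨y, hy, rfl⟩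
  rw [extendBall, dif_pos h, hs h.choose_spec.1 hy h.choose_spec.2]

theorem extendBall_eq_zero {s : Set (E d)} {F : Type*} [Zero F] (f : E d → F) {x : 𝕏}
    (hx : x ∉ π '' s) : extendBall π s f x = 0 :=
  dif_neg fun ⟨y, hy, hyx⟩ => hx ⟨y, hy, hyx⟩

theorem extendBall_eq_zero_of_support {s K : Set (E d)} (hs : InjOn π s)
    {F : Type*} [Zero F] {f : E d → F} (hf : ∀ y ∉ K, f y = 0) {x : 𝕏}
    (hx : x ∉ π '' K) : extendBall π s f x = 0 := by
  by_cases h : x ∈ π '' s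
  · obtain ⟨y, hy, rfl⟩ := h
    rw [extendBall_apply hs f hy]
    exact hf y fun hyK => hx ⟨y, hyK, rfl⟩
  · exact extendBall_eq_zero f h

/-- Over the image of `s`, continuity descends through the open quotient map. At any other point the
function vanishes nearby, because the image of the compact set `K` is closed. -/
theorem continuous_extendBall [T2Space 𝕏] (hπ : IsFlatCovering π) {s K : Set (E d)}
    (hs : InjOn π s) (hso : IsOpen s) (hK : IsCompact K) (hKs : K ⊆ s) {F : Type*}
    [TopologicalSpace F] [Zero F] {f : ℝ → E d → F}
    (hf : Continuous fun y : ℝ × E d => f y.1 y.2) (hfK : ∀ t, ∀ y ∉ K, f t y = 0) :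
    Continuous fun y : ℝ × 𝕏 => extendBall π s (f y.1) y.2 := by
  rw [continuous_iff_continuousAt]
  rintro ⟨t, x⟩
  by_cases h : x ∈ π '' s
  · obtain ⟨y, hy, rfl⟩ := h
    have hmap : map (Prod.map (id : ℝ → ℝ) π) (𝓝 (t, y)) = 𝓝 (t, π y) :=
      hπ.isOpenQuotientMap_prodMap.map_nhds_eq (t, y)
    rw [ContinuousAt, ← hmap, tendsto_map'_iff, extendBall_apply hs (f t) hy]
    refine (hf.tendsto (t, y)).congr' ?_
    have hmem : ∀ᶠ z : ℝ × E d in 𝓝 (t, y), z.2 ∈ s :=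
      continuous_snd.continuousAt.eventually (hso.mem_nhds hy)
    filter_upwards [hmem] with z hz
    exact (extendBall_apply hs (f z.1) hz).symm
  · have hx : x ∉ π '' K := fun hx => h (image_mono hKs hx)
    have hclosed : IsClosed (π '' K) := (hK.image hπ.isOpenQuotientMap.continuous).isClosed
    have hmem : ∀ᶠ z : ℝ × 𝕏 in 𝓝 (t, x), z.2 ∉ π '' K :=
      continuous_snd.continuousAt.eventually (hclosed.isOpen_compl.mem_nhds (show x ∈ (π '' K)ᶜ from hx))
    have hev : (fun y : ℝ × 𝕏 => extendBall π s (f y.1) y.2) =ᶠ[𝓝 (t, x)] fun _ => 0 := by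
      filter_upwards [hmem] with z hz
      exact extendBall_eq_zero_of_support hs (hfK z.1) hz
    exact continuousAt_const.congr hev.symm

theorem setIntegral_image_ball [BorelSpace 𝕏] (hπ : IsFlatCovering π) {x : E d} {R r : ℝ}
    (h : InjOn π (Metric.ball x R) ∧ MeasurePreserving π (volume.restrict (Metric.ball x R))
      (volume.restrict (π '' Metric.ball x R))) (hr : r ≤ R) {f : 𝕏 → ℝ}
    (hf : AEStronglyMeasurable f (volume.restrict (π '' Metric.ball x r))) :
    ∫ z in π '' Metric.ball x r, f z = ∫ y in Metric.ball x r, f (π y) := by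
  have hmp := hπ.measurePreserving_ball h hr
  rw [← hmp.map_eq] at hf ⊢
  exact integral_map hmp.measurable.aemeasurable hf

theorem integral_eq_setIntegral_ball [BorelSpace 𝕏] (hπ : IsFlatCovering π) {x : E d} {R r : ℝ}
    (h : InjOn π (Metric.ball x R) ∧ MeasurePreserving π (volume.restrict (Metric.ball x R))
      (volume.restrict (π '' Metric.ball x R))) (hr : r ≤ R) {f : 𝕏 → ℝ}
    (hf : AEStronglyMeasurable f (volume.restrict (π '' Metric.ball x r)))
    (h0 : ∀ z ∉ π '' Metric.ball x r, f z = 0) :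
    ∫ z, f z = ∫ y in Metric.ball x r, f (π y) := by
  rw [← setIntegral_image_ball hπ h hr hf, setIntegral_eq_integral_of_forall_compl_eq_zero h0]

end FlatCovering

/-! ### Weakly continuous maps -/

section WeaklyContinuousMaps

set_option linter.unusedSectionVars false

variable {𝕏 : Type} [MeasureSpace 𝕏] {T : ℝ} {F : Type} [NormedAddCommGroup F] [NormedSpace ℝ F]
  {q : ℝ≥0∞} [Fact (1 ≤ q)]

/-- The value in `L^q` of a weakly continuous map. -/
def toLpAt (f : WeaklyContinuous 𝕏 T F q) (t : Icc (0 : ℝ) T) : Lp F q (volume : Measure 𝕏) :=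
  (toWeakSpace ℝ (Lp F q (volume : Measure 𝕏))).symm (f t)

theorem valueAt_eq (f : WeaklyContinuous 𝕏 T F q) {t : ℝ} (ht : t ∈ Icc 0 T) :
    valueAt f t = (toLpAt f ⟨t, ht⟩ : 𝕏 → F) := by
  rw [valueAt, dif_pos ht]
  rfl

theorem toLpAt_add (f g : WeaklyContinuous 𝕏 T F q) (t : Icc (0 : ℝ) T) :
    toLpAt (f + g) t = toLpAt f t + toLpAt g t := rfl

theorem valueAt_add (f g : WeaklyContinuous 𝕏 T F q) {t : ℝ} (ht : t ∈ Icc 0 T) :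
    valueAt (f + g) t =ᵐ[volume] fun x => valueAt f t x + valueAt g t x := by
  rw [valueAt_eq _ ht, valueAt_eq _ ht, valueAt_eq _ ht, toLpAt_add]
  exact Lp.coeFn_add _ _

/-- The scalar function obtained by applying a functional at every time. -/
def pairing (l : StrongDual ℝ (Lp F q (volume : Measure 𝕏))) (f : WeaklyContinuous 𝕏 T F q) :
    C(Icc (0 : ℝ) T, ℝ) where
  toFun t := l (toLpAt f t)
  continuous_toFun := (WeakBilin.eval_continuous (topDualPairing ℝ _).flip l).comp f.continuous

theorem pairing_apply (l : StrongDual ℝ (Lp F q (volume : Measure 𝕏)))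
    (f : WeaklyContinuous 𝕏 T F q) (t : Icc (0 : ℝ) T) : pairing l f t = l (toLpAt f t) := rfl

theorem continuous_pairing (l : StrongDual ℝ (Lp F q (volume : Measure 𝕏))) :
    Continuous (pairing l : WeaklyContinuous 𝕏 T F q → C(Icc (0 : ℝ) T, ℝ)) :=
  ContinuousMap.continuous_postcomp (X := Icc (0 : ℝ) T)
    (⟨_, WeakBilin.eval_continuous (topDualPairing ℝ _).flip l⟩ :
      C(WeakSpace ℝ (Lp F q (volume : Measure 𝕏)), ℝ))

/-- The weak topology is induced by the evaluation map into a product of lines, and inducing maps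
remain inducing for compact-open topologies. Uniform convergence into a product is uniform
convergence of each coordinate. -/
theorem tendsto_weaklyContinuous {ι : Type*} {p : Filter ι} {G : ι → WeaklyContinuous 𝕏 T F q}
    {f : WeaklyContinuous 𝕏 T F q}
    (h : ∀ l : StrongDual ℝ (Lp F q (volume : Measure 𝕏)),
      Tendsto (fun i => pairing l (G i)) p (𝓝 (pairing l f))) : Tendsto G p (𝓝 f) := by
  set ev : C(WeakSpace ℝ (Lp F q (volume : Measure 𝕏)),
      StrongDual ℝ (Lp F q (volume : Measure 𝕏)) → ℝ) :=
    ⟨fun x l => (topDualPairing ℝ (Lp F q (volume : Measure 𝕏))).flip x l, continuous_pi fun l =>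
      WeakBilin.eval_continuous (topDualPairing ℝ _).flip l⟩ with hev
  have hind : IsInducing ev := ⟨rfl⟩
  rw [(ContinuousMap.isInducing_postcomp (X := Icc (0 : ℝ) T) ev hind).tendsto_nhds_iff,
    ContinuousMap.tendsto_iff_tendstoUniformly, tendstoUniformly_iff_tendsto, Pi.uniformity,
    tendsto_iInf]
  intro l
  rw [tendsto_comap_iff]
  exact tendstoUniformly_iff_tendsto.1 (ContinuousMap.tendsto_iff_tendstoUniformly.1 (h l))

/-- Mazur's theorem: for convex sets the norm closure and the weak closure coincide. -/
theorem isClosed_toWeakSpace_image {H : Type*} [NormedAddCommGroup H] [NormedSpace ℝ H] {C : Set H}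
    (hc : Convex ℝ C) (hC : IsClosed C) : IsClosed ((toWeakSpace ℝ H).symm ⁻¹' C) := by
  have h := hc.toWeakSpace_closure ℝ
  rw [hC.closure_eq] at h
  have h2 : (toWeakSpace ℝ H).symm ⁻¹' C = toWeakSpace ℝ H '' C :=
    ((toWeakSpace ℝ H).toEquiv.image_eq_preimage_symm C).symm
  rw [h2, h]
  exact isClosed_closure

theorem convex_setOf_ae_mem {S : 𝕏 → Set F} (hS : ∀ x, Convex ℝ (S x)) :
    Convex ℝ {f : Lp F q (volume : Measure 𝕏) | ∀ᵐ x, f x ∈ S x} := by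
  intro f hf g hg a b ha hb hab
  have h1 := Lp.coeFn_add (a • f) (b • g)
  have h2 := Lp.coeFn_smul a f
  have h3 := Lp.coeFn_smul b g
  filter_upwards [hf, hg, h1, h2, h3] with x hfx hgx h1 h2 h3
  rw [h1, Pi.add_apply, h2, h3]
  exact hS x hfx hgx ha hb hab

/-- A norm convergent sequence in `L^q` has an almost everywhere convergent subsequence. -/
theorem isClosed_setOf_ae_mem {S : 𝕏 → Set F} (hS : ∀ x, IsClosed (S x)) :
    IsClosed {f : Lp F q (volume : Measure 𝕏) | ∀ᵐ x, f x ∈ S x} := by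
  refine isClosed_of_closure_subset fun f hf => ?_
  obtain ⟨u, hu, hlim⟩ := mem_closure_iff_seq_limit.1 hf
  obtain ⟨ns, -, hns⟩ := (tendstoInMeasure_of_tendsto_Lp hlim).exists_seq_tendsto_ae
  have hall : ∀ᵐ x, ∀ n, u n x ∈ S x := ae_all_iff.2 hu
  filter_upwards [hns, hall] with x hx hxn
  exact (hS x).mem_of_tendsto hx (Eventually.of_forall fun n => hxn _)

/-- A pointwise closed convex constraint cuts out a weakly closed subset of `L^q`, and evaluation at
a fixed time is continuous. Density, boundary values, exterior values and the energy inequality all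
pass to the closure in this way, with no recourse to sequences. -/
theorem ae_mem_of_mem_closure {𝒮 : Type*} [TopologicalSpace 𝒮] {A : Set 𝒮}
    {π : 𝒮 → WeaklyContinuous 𝕏 T F q} (hπ : Continuous π) {S : 𝕏 → Set F}
    (hc : ∀ x, Convex ℝ (S x)) (hS : ∀ x, IsClosed (S x)) {t : ℝ} (ht : t ∈ Icc 0 T)
    (hA : ∀ w ∈ A, ∀ᵐ x, valueAt (π w) t x ∈ S x) {w : 𝒮} (hw : w ∈ closure A) :
    ∀ᵐ x, valueAt (π w) t x ∈ S x := by
  have hcl := isClosed_toWeakSpace_image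
    (C := {f : Lp F q (volume : Measure 𝕏) | ∀ᵐ x, f x ∈ S x})
    (convex_setOf_ae_mem (q := q) hc) (isClosed_setOf_ae_mem (q := q) hS)
  have hcont : Continuous fun w => π w ⟨t, ht⟩ := (continuous_eval_const _).comp hπ
  have hsub : closure A ⊆ (fun w => π w ⟨t, ht⟩) ⁻¹'
      ((toWeakSpace ℝ (Lp F q (volume : Measure 𝕏))).symm ⁻¹'
        {f : Lp F q (volume : Measure 𝕏) | ∀ᵐ x, f x ∈ S x}) := by
    refine closure_minimal (fun w hw => ?_) (hcl.preimage hcont)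
    have := hA w hw
    rw [valueAt_eq _ ht] at this
    exact this
  have := hsub hw
  rw [valueAt_eq _ ht]
  exact this

/-- A point of the closure need not be a limit of a sequence. For countably many functionals,
however, a sequence taken from neighbourhoods that control the first `k + 1` of them up to `1 / (k +
1)` is enough. -/
theorem exists_seq_pairing_lt {𝒮 : Type*} [TopologicalSpace 𝒮] {A : Set 𝒮}
    {π : 𝒮 → WeaklyContinuous 𝕏 T F q} (hπ : Continuous π)
    (l : ℕ → StrongDual ℝ (Lp F q (volume : Measure 𝕏))) {w : 𝒮} (hw : w ∈ closure A) :
    ∃ v : ℕ → 𝒮, (∀ k, v k ∈ A) ∧ ∀ n t,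
      Tendsto (fun k => l n (toLpAt (π (v k)) t)) atTop (𝓝 (l n (toLpAt (π w) t))) := by
  have hk : ∀ k : ℕ, ∃ v ∈ A, ∀ n ≤ k, dist (pairing (l n) (π v)) (pairing (l n) (π w))
      < 1 / ((k : ℝ) + 1) := by
    intro k
    have hev : ∀ᶠ v in 𝓝 w, ∀ n ∈ Finset.range (k + 1),
        dist (pairing (l n) (π v)) (pairing (l n) (π w)) < 1 / ((k : ℝ) + 1) := by
      rw [Filter.eventually_all_finset]
      intro n _
      exact (Metric.tendsto_nhds.1 (((continuous_pairing (l n)).comp hπ).tendsto w)) _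
        Nat.one_div_pos_of_nat
    obtain ⟨v, hv, hvA⟩ := mem_closure_iff_nhds.1 hw _ hev
    exact ⟨v, hvA, fun n hn => hv n (Finset.mem_range.2 (Nat.lt_succ_of_le hn))⟩
  choose v hvA hv using hk
  refine ⟨v, hvA, fun n t => ?_⟩
  rw [tendsto_iff_dist_tendsto_zero]
  refine squeeze_zero' (Eventually.of_forall fun k => dist_nonneg) ?_
    tendsto_one_div_add_atTop_nhds_zero_nat
  filter_upwards [eventually_ge_atTop n] with k hk
  exact (ContinuousMap.dist_apply_le_dist (f := pairing (l n) (π (v k)))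
    (g := pairing (l n) (π w)) t).trans (hv k n hk).le

end WeaklyContinuousMaps

/-! ### Compactly supported continuous perturbations -/

section Perturbations

set_option linter.unusedSectionVars false

variable {d : ℕ} {𝕏 : Type} [TopologicalSpace 𝕏] [MeasureSpace 𝕏] [T2Space 𝕏] [BorelSpace 𝕏]
  [IsFiniteMeasureOnCompacts (volume : Measure 𝕏)] {T : ℝ}

theorem memLp_of_continuous_of_compact {f : 𝕏 → E d} {K : Set 𝕏} (hf : Continuous f)
    (hK : IsCompact K) (h0 : ∀ x ∉ K, f x = 0) : MemLp f 2 (volume : Measure 𝕏) :=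
  hf.memLp_of_hasCompactSupport (HasCompactSupport.intro hK h0)

variable {V : ℝ → 𝕏 → E d} {K : Set 𝕏}

theorem exists_bound_of_continuous_compact (hV : Continuous fun y : ℝ × 𝕏 => V y.1 y.2)
    (hK : IsCompact K) (h0 : ∀ t, ∀ x ∉ K, V t x = 0) (T : ℝ) :
    ∃ C, 0 ≤ C ∧ ∀ t ∈ Icc 0 T, ∀ x, ‖V t x‖ ≤ C := by
  obtain ⟨C, hC⟩ := (isCompact_Icc.prod hK : IsCompact (Icc 0 T ×ˢ K)).exists_bound_of_continuousOn
    hV.continuousOn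
  refine ⟨max C 0, le_max_right _ _, fun t ht x => ?_⟩
  by_cases hx : x ∈ K
  · exact (hC (t, x) ⟨ht, hx⟩).trans (le_max_left _ _)
  · rw [h0 t x hx, norm_zero]
    exact le_max_right _ _

/-- A continuous compactly supported perturbation, as an element of `C([0,T]; L²_w)`. -/
def perturbation (hV : Continuous fun y : ℝ × 𝕏 => V y.1 y.2) (hK : IsCompact K)
    (h0 : ∀ t, ∀ x ∉ K, V t x = 0) : WeaklyContinuous 𝕏 T (E d) 2 where
  toFun t := toWeakSpace ℝ (Lp (E d) 2 (volume : Measure 𝕏))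
    (memLp_of_continuous_of_compact (hV.comp (Continuous.prodMk_right (t : ℝ))) hK (h0 t)).toLp
  continuous_toFun := by
    refine WeakBilin.continuous_of_continuous_eval _ fun l => ?_
    set ψ : Lp (E d) 2 (volume : Measure 𝕏) := (InnerProductSpace.toDual ℝ _).symm l with hψ
    have hl : ∀ f : Lp (E d) 2 (volume : Measure 𝕏), l f = ∫ x, inner ℝ (ψ x) (f x) := by
      intro f
      rw [← L2.inner_def, hψ, InnerProductSpace.toDual_symm_apply]
    have hrepr : ∀ t : Icc (0 : ℝ) T, l (memLp_of_continuous_of_compact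
        (hV.comp (Continuous.prodMk_right (t : ℝ))) hK (h0 t)).toLp
          = ∫ x, inner ℝ (ψ x) (V t x) := by
      intro t
      rw [hl]
      refine integral_congr_ae ?_
      filter_upwards [(memLp_of_continuous_of_compact
        (hV.comp (Continuous.prodMk_right (t : ℝ))) hK (h0 t)).coeFn_toLp] with x hx
      rw [hx]
      rfl
    show Continuous fun t : Icc (0 : ℝ) T => l (memLp_of_continuous_of_compact
        (hV.comp (Continuous.prodMk_right (t : ℝ))) hK (h0 t)).toLp
    simp_rw [hrepr]
    obtain ⟨C, hC0, hC⟩ := exists_bound_of_continuous_compact hV hK h0 T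
    have hKfin : IsFiniteMeasure ((volume : Measure 𝕏).restrict K) :=
      isFiniteMeasure_restrict.2 hK.measure_lt_top.ne
    -- The representing function is square integrable, hence integrable on the finite measure set
    -- `K`. This provides the dominating function for continuity in time.
    have hψK : Integrable (fun x => ‖ψ x‖) ((volume : Measure 𝕏).restrict K) :=
      MemLp.integrable (q := 2) (by norm_num) ((Lp.memLp ψ).restrict K).norm
    refine continuous_of_dominated (bound := fun x => K.indicator (fun x => ‖ψ x‖ * C) x)
      (fun t => (Lp.aestronglyMeasurable ψ).inner
        (memLp_of_continuous_of_compact (hV.comp (Continuous.prodMk_right (t : ℝ))) hK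
          (h0 t)).aestronglyMeasurable) (fun t => Eventually.of_forall fun x => ?_) ?_
      (Eventually.of_forall fun x => ?_)
    · by_cases hx : x ∈ K
      · rw [indicator_of_mem hx]
        exact (norm_inner_le_norm _ _).trans
          (mul_le_mul_of_nonneg_left (hC t t.2 x) (norm_nonneg _))
      · rw [indicator_of_notMem hx, h0 t x hx]
        simp
    · exact (integrable_indicator_iff hK.measurableSet).2 (hψK.mul_const C)
    · exact continuous_const.inner (hV.comp (continuous_subtype_val.prodMk continuous_const))

theorem toLpAt_perturbation (hV : Continuous fun y : ℝ × 𝕏 => V y.1 y.2) (hK : IsCompact K)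
    (h0 : ∀ t, ∀ x ∉ K, V t x = 0) (t : Icc (0 : ℝ) T) :
    toLpAt (perturbation hV hK h0 : WeaklyContinuous 𝕏 T (E d) 2) t =ᵐ[volume] V t :=
  (memLp_of_continuous_of_compact (hV.comp (Continuous.prodMk_right (t : ℝ))) hK
    (h0 t)).coeFn_toLp

theorem dual_eq_integral_inner (l : StrongDual ℝ (Lp (E d) 2 (volume : Measure 𝕏)))
    (f : Lp (E d) 2 (volume : Measure 𝕏)) :
    l f = ∫ x, inner ℝ (((InnerProductSpace.toDual ℝ _).symm l : Lp (E d) 2 (volume : Measure 𝕏)) x)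
      (f x) := by
  rw [← L2.inner_def, InnerProductSpace.toDual_symm_apply]

end Perturbations

/-! ### Admissible states -/

section Admissible

variable {d : ℕ}

/-- The matrix `q I - (a ⊗ a / r - B)`. -/
def defect (q r : ℝ) (a : E d) (B : Matrix (Fin d) (Fin d) ℝ) : Matrix (Fin d) (Fin d) ℝ :=
  q • (1 : Matrix (Fin d) (Fin d) ℝ) - (r⁻¹ • tensorSq a - B)

/-- Positivity of the quadratic form of `P`, and `P` is not a multiple of the identity. -/
def IsAdmissible (P : Matrix (Fin d) (Fin d) ℝ) : Prop :=
  (∀ x : Fin d → ℝ, x ≠ 0 → 0 < x ⬝ᵥ P.mulVec x) ∧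
    ∀ c : ℝ, P ≠ c • (1 : Matrix (Fin d) (Fin d) ℝ)

theorem isHermitian_stress {r : ℝ} {a : E d} {B : Matrix (Fin d) (Fin d) ℝ} (hB : B.IsSymm) :
    (r⁻¹ • tensorSq a - B).IsHermitian :=
  ((isHermitian_tensorSq a).smul (IsSelfAdjoint.all _)).sub (isHermitian_iff_isSymm.2 hB)

theorem isHermitian_defect {q r : ℝ} {a : E d} {B : Matrix (Fin d) (Fin d) ℝ} (hB : B.IsSymm) :
    (defect q r a B).IsHermitian :=
  isHermitian_smul_one_sub (isHermitian_stress hB) q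

theorem trace_stress {r : ℝ} {a : E d} {B : Matrix (Fin d) (Fin d) ℝ} (hB : B.trace = 0) :
    (r⁻¹ • tensorSq a - B).trace = ‖a‖ ^ 2 / r := by
  rw [Matrix.trace_sub, Matrix.trace_smul, trace_tensorSq, hB, sub_zero, smul_eq_mul]
  ring

theorem trace_defect {q r : ℝ} {a : E d} {B : Matrix (Fin d) (Fin d) ℝ} (hB : B.trace = 0) :
    (defect q r a B).trace = d * q - ‖a‖ ^ 2 / r := by
  rw [defect, trace_smul_one_sub, trace_stress hB]

theorem isAdmissible_iff_posDef {P : Matrix (Fin d) (Fin d) ℝ} (hP : P.IsHermitian) :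
    IsAdmissible P ↔ P.PosDef ∧ ∀ c : ℝ, P ≠ c • (1 : Matrix (Fin d) (Fin d) ℝ) := by
  refine and_congr_left fun _ => ⟨fun h => ?_, fun h x hx => ?_⟩
  · exact Matrix.PosDef.of_dotProduct_mulVec_pos hP fun x hx => by simpa using h x hx
  · simpa using h.dotProduct_mulVec_pos hx

/-- With S = a ⊗ a / r - B, the middle quantity is λ_max(S) and the left one is tr S / d. So the
upper inequality is positive definiteness of q I - S, and the lower one says that S is not a
multiple of the identity. -/
theorem isAdmissible_defect_iff [NeZero d] {q r : ℝ} {a : E d}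
    {B : Matrix (Fin d) (Fin d) ℝ} (hB : B.IsSymm) (htr : B.trace = 0) :
    IsAdmissible (defect q r a B) ↔
      ‖a‖ ^ 2 / (d * r) < 2 / (d : ℝ) * ekin r a B ∧ 2 / (d : ℝ) * ekin r a B < q := by
  have hd : (d : ℝ) ≠ 0 := NeZero.ne _
  have he : 2 / (d : ℝ) * ekin r a B = lambdaMax (r⁻¹ • tensorSq a - B) := by
    rw [ekin]
    field_simp
  have h1 : ‖a‖ ^ 2 / (d * r) = (r⁻¹ • tensorSq a - B).trace / d := by
    rw [trace_stress htr, div_div, mul_comm r]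
  rw [isAdmissible_iff_posDef (isHermitian_defect hB), he, h1, lambdaMax_lt_iff (isHermitian_stress hB),
    trace_div_lt_lambdaMax_iff (isHermitian_stress hB), and_comm]
  refine and_congr ⟨fun h c hc => h (q - c) ?_, fun h c hc => h (q - c) ?_⟩ Iff.rfl
  · rw [defect, hc, sub_smul]
  · rw [sub_smul, ← hc, defect, sub_sub_cancel]

/-- By homogeneity the quadratic form need only be tested on the compact unit sphere, and for `d >
0` the only multiple of the identity that could equal `P` is `(P.trace / d) • 1`. Admissibility does
not mention symmetry, so it is open among all matrices. -/
theorem isOpen_setOf_isAdmissible : IsOpen {P : Matrix (Fin d) (Fin d) ℝ | IsAdmissible P} := by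
  have h1 : IsOpen {P : Matrix (Fin d) (Fin d) ℝ |
      ∀ x ∈ Metric.sphere (0 : Fin d → ℝ) 1, 0 < x ⬝ᵥ P.mulVec x} := by
    rw [isOpen_iff_mem_nhds]
    intro P hP
    refine (isCompact_sphere (0 : Fin d → ℝ) 1).eventually_forall_of_forall_eventually
      (P := fun (P : Matrix (Fin d) (Fin d) ℝ) x => 0 < x ⬝ᵥ P.mulVec x) fun x hx => ?_
    have hcont : Continuous fun z : Matrix (Fin d) (Fin d) ℝ × (Fin d → ℝ) =>
        z.2 ⬝ᵥ z.1.mulVec z.2 :=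
      continuous_snd.dotProduct (continuous_fst.matrix_mulVec continuous_snd)
    exact (hcont.tendsto (P, x)).eventually (lt_mem_nhds (hP x hx))
  have h2 : IsOpen {P : Matrix (Fin d) (Fin d) ℝ |
      P ≠ (P.trace / d) • (1 : Matrix (Fin d) (Fin d) ℝ)} := by
    refine isOpen_ne_fun continuous_id ?_
    exact (continuous_id.matrix_trace.div_const _).smul continuous_const
  convert! h1.inter h2 using 1
  ext P
  refine and_congr ⟨fun h x hx => h x ?_, fun h x hx => ?_⟩ ⟨fun h => h _, fun h c hc => ?_⟩
  · rintro rfl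
    simp at hx
  · have hn : 0 < ‖x‖ := norm_pos_iff.2 hx
    have h3 := h (‖x‖⁻¹ • x) (by simp [norm_smul, hn.ne'])
    rw [Matrix.mulVec_smul, dotProduct_smul, smul_dotProduct, smul_smul, smul_eq_mul] at h3
    exact (mul_pos_iff_of_pos_left (by positivity)).1 h3
  · rcases Nat.eq_zero_or_pos d with rfl | hd
    · exact h (Subsingleton.elim _ _)
    · have hd' : (d : ℝ) ≠ 0 := by positivity
      refine h ?_
      have : P.trace / d = c := by
        rw [hc, Matrix.trace_smul, Matrix.trace_one, Fintype.card_fin, smul_eq_mul]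
        field_simp
      rw [this]
      exact hc

theorem abs_mul_le_norm_sq (a : E d) (i j : Fin d) : |a i * a j| ≤ ‖a‖ ^ 2 := by
  rw [abs_mul, sq]
  exact mul_le_mul (PiLp.norm_apply_le a i) (PiLp.norm_apply_le a j) (abs_nonneg _) (norm_nonneg _)

/-- The flux is bounded by the pressure for states with positive semidefinite defect. -/
theorem abs_flux_le {q r : ℝ} (hr : 0 < r) {a : E d} {B : Matrix (Fin d) (Fin d) ℝ}
    (htr : B.trace = 0) (h : (defect q r a B).PosSemidef) (hq : 0 ≤ q) (i j : Fin d) :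
    |B i j| ≤ (2 * d + 1) * q := by
  have h1 := abs_entry_le_trace h i j
  have h2 := h.trace_nonneg
  rw [trace_defect htr] at h1 h2
  have h3 : |r⁻¹ * (a i * a j)| ≤ ‖a‖ ^ 2 / r := by
    rw [abs_mul, abs_of_pos (inv_pos.2 hr), div_eq_inv_mul]
    exact mul_le_mul_of_nonneg_left (abs_mul_le_norm_sq a i j) (inv_pos.2 hr).le
  have h4 : |q * (1 : Matrix (Fin d) (Fin d) ℝ) i j| ≤ q := by
    rw [abs_mul, abs_of_nonneg hq]
    refine mul_le_of_le_one_right hq ?_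
    rw [Matrix.one_apply]
    split_ifs <;> simp
  -- The defect entry is at most `d * q - ‖a‖ ^ 2 / r`, so the two contributions of `‖a‖ ^ 2 / r`
  -- compensate each other.
  have h5 : B i j = defect q r a B i j - q * (1 : Matrix (Fin d) (Fin d) ℝ) i j
      + r⁻¹ * (a i * a j) := by
    simp [defect, tensorSq]
  rw [h5]
  have h6 := abs_add_le (defect q r a B i j - q * (1 : Matrix (Fin d) (Fin d) ℝ) i j)
    (r⁻¹ * (a i * a j))
  have h7 := abs_sub (defect q r a B i j) (q * (1 : Matrix (Fin d) (Fin d) ℝ) i j)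
  have h8 : 0 ≤ d * q := by positivity
  linarith

end Admissible

/-! ### Subsolutions with fixed density -/

section FixedDensity

set_option linter.unusedSectionVars false

variable {d : ℕ} {𝕏 : Type} [AddCommGroup 𝕏] [TopologicalSpace 𝕏] [MeasureSpace 𝕏]

/-- The fields of a strict subsolution with density `ρ₀` and generalised pressure `Q₀`. -/
structure IsFixedSubsolution (π : E d → 𝕏) (γ T : ℝ) [Fact (1 < γ)] (Ω : Set 𝕏)
    (z₀ : Quadruple d 𝕏) (w : StateSpace d 𝕏 γ T) (m : ℝ → 𝕏 → E d)
    (M : ℝ → 𝕏 → Matrix (Fin d) (Fin d) ℝ) : Prop where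
  density : ∀ t ∈ Icc 0 T, valueAt w.1 t =ᵐ[volume] z₀.ρ t
  momentum : ∀ t ∈ Icc 0 T, valueAt w.2 t =ᵐ[volume] m t
  symm : ∀ t ∈ Icc 0 T, ∀ x, (M t x).IsSymm
  traceFree : ∀ t ∈ Icc 0 T, ∀ x, (M t x).trace = 0
  integrable : ∀ i j, IntegrableOn (fun y : ℝ × 𝕏 => M y.1 y.2 i j) (Ioo 0 T ×ˢ Ω)
  relaxed : SolvesRelaxedSystem π T ⟨z₀.ρ, m, M, z₀.Q⟩
  continuous_momentum : ContinuousOn (fun y : ℝ × 𝕏 => m y.1 y.2) (Icc 0 T ×ˢ Ω)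
  continuous_flux : ContinuousOn (fun y : ℝ × 𝕏 => M y.1 y.2) (Icc 0 T ×ˢ Ω)
  outside : ∀ t ∈ Icc 0 T, ∀ x ∉ Ω, m t x = z₀.m t x ∧ M t x = z₀.M t x
  endpoints : ∀ t ∈ ({0, T} : Set ℝ), ∀ᵐ x, m t x = z₀.m t x
  compact : ∀ t ∈ Icc 0 T, ∃ C : Set 𝕏, IsCompact C ∧ C ⊆ Ω ∧ ∀ x ∉ C, m t x = z₀.m t x
  strict : ∀ t ∈ Ioo 0 T, ∀ x ∈ Ω,
    ‖m t x‖ ^ 2 / (d * z₀.ρ t x) < 2 / (d : ℝ) * ekin (z₀.ρ t x) (m t x) (M t x) ∧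
    2 / (d : ℝ) * ekin (z₀.ρ t x) (m t x) (M t x) < z₀.Q t x - pressure γ (z₀.ρ t x)

/-- The elements of `X₀` with density `ρ₀`. -/
def fixedApproximatingSpace (π : E d → 𝕏) (γ T : ℝ) [Fact (1 < γ)] (Ω : Set 𝕏)
    (z₀ : Quadruple d 𝕏) : Set (StateSpace d 𝕏 γ T) :=
  {w | w ∈ approximatingSpace π γ T Ω z₀ ∧
    ∀ t ∈ Icc 0 T, valueAt w.1 t =ᵐ[volume] z₀.ρ t}

variable {π : E d → 𝕏} {γ T : ℝ} [Fact (1 < γ)] {Ω : Set 𝕏} {z₀ : Quadruple d 𝕏}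

theorem solvesRelaxedSystem_congr {z z' : Quadruple d 𝕏} (h : SolvesRelaxedSystem π T z)
    (hρ : ∀ t ∈ Ioo 0 T, ∀ x, z.ρ t x = z'.ρ t x) (hm : z.m = z'.m) (hM : z.M = z'.M)
    (hQ : z.Q = z'.Q) : SolvesRelaxedSystem π T z' := by
  intro φ hφ
  obtain ⟨h1, h2⟩ := h φ hφ
  rw [← hm, ← hM, ← hQ]
  refine ⟨h1, ?_⟩
  refine Eq.trans (Eq.symm ?_) h2
  refine setIntegral_congr_fun (s := Ioo 0 T) measurableSet_Ioo fun t ht => ?_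
  simp only [hρ t ht]

/-- The density of `w` equals `ρ₀` only almost everywhere. On Ω both representatives are continuous
at each time and the measure charges open sets, so they agree at every point, and `z₀.ρ` can replace
`z.ρ` everywhere. -/
theorem exists_isFixedSubsolution [BorelSpace 𝕏] [T2Space 𝕏]
    [(volume : Measure 𝕏).IsOpenPosMeasure] (hΩ : IsOpen Ω)
    (hz : IsStrictSubsolution π γ T Ω z₀) {w : StateSpace d 𝕏 γ T}
    (hw : w ∈ fixedApproximatingSpace π γ T Ω z₀) :
    ∃ m M, IsFixedSubsolution π γ T Ω z₀ w m M := by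
  obtain ⟨⟨z, hQ, hsub, hcρ, hcm, hcM, hout, hend, hcomp, hstrict⟩, hdens⟩ := hw
  have hslice : ∀ t ∈ Icc 0 T, ∀ U : Set 𝕏, MapsTo (fun x => (t, x)) U (Icc 0 T ×ˢ U) :=
    fun t ht U x hx => ⟨ht, hx⟩
  have hρ : ∀ t ∈ Icc 0 T, ∀ x, z.ρ t x = z₀.ρ t x := by
    intro t ht x
    by_cases hx : x ∈ Ω
    · refine Measure.eqOn_open_of_ae_eq (μ := volume) (ae_restrict_of_ae
        ((hsub.density t ht).symm.trans (hdens t ht))) hΩ ?_ ?_ hx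
      · exact hcρ.comp (by fun_prop) (hslice t ht Ω)
      · exact (hz.continuous_density.comp (by fun_prop) (hslice t ht univ)).mono (subset_univ _)
    · exact (hout t ht x hx).1
  refine ⟨z.m, z.M, hdens, hsub.momentum, hsub.symm, hsub.traceFree, hsub.integrable,
    solvesRelaxedSystem_congr hsub.relaxed (fun t (ht : t ∈ Ioo 0 T) x => hρ t (Ioo_subset_Icc_self ht) x) rfl rfl
      hQ, hcm, hcM, fun t ht x hx => (hout t ht x hx).2, fun t ht => ?_, hcomp,
    fun t ht x hx => ?_⟩
  · filter_upwards [hend t ht] with x hx using hx.2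
  · have h := hstrict t ht x hx
    rw [hρ t (Ioo_subset_Icc_self ht) x, hQ] at h
    exact ⟨by linarith [h.1], by linarith [h.2]⟩

theorem IsFixedSubsolution.mem (hz : IsStrictSubsolution π γ T Ω z₀) {w : StateSpace d 𝕏 γ T}
    {m : ℝ → 𝕏 → E d} {M : ℝ → 𝕏 → Matrix (Fin d) (Fin d) ℝ}
    (h : IsFixedSubsolution π γ T Ω z₀ w m M) :
    w ∈ fixedApproximatingSpace π γ T Ω z₀ := by
  refine ⟨⟨⟨z₀.ρ, m, M, z₀.Q⟩, rfl, ⟨h.density, h.momentum, hz.pos, h.symm, h.traceFree,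
    h.integrable, h.relaxed, fun t ht x hx => ?_⟩,
    hz.continuous_density.mono (prod_mono_right (subset_univ _)), h.continuous_momentum,
    h.continuous_flux, fun t ht x hx => ⟨rfl, h.outside t ht x hx⟩, fun t ht => ?_, h.compact,
    fun t ht x hx => ?_⟩, h.density⟩
  · have := (h.strict t ht x hx).2
    show pressure γ (z₀.ρ t x) + _ ≤ z₀.Q t x
    linarith
  · filter_upwards [h.endpoints t ht] with x hx using ⟨rfl, hx⟩
  · have := h.strict t ht x hx
    exact ⟨by linarith [this.1], by linarith [this.2]⟩

/-- For `d = 0` the conventions on division by zero turn the strict inequality into `0 < 0`. -/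
theorem IsFixedSubsolution.neZero {w : StateSpace d 𝕏 γ T}
    {m : ℝ → 𝕏 → E d} {M : ℝ → 𝕏 → Matrix (Fin d) (Fin d) ℝ}
    (h : IsFixedSubsolution π γ T Ω z₀ w m M) {t : ℝ} (ht : t ∈ Ioo 0 T) {x : 𝕏} (hx : x ∈ Ω) :
    NeZero d := by
  constructor
  rintro rfl
  have := (h.strict t ht x hx).1
  simp at this

theorem IsFixedSubsolution.isAdmissible {w : StateSpace d 𝕏 γ T}
    {m : ℝ → 𝕏 → E d} {M : ℝ → 𝕏 → Matrix (Fin d) (Fin d) ℝ}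
    (h : IsFixedSubsolution π γ T Ω z₀ w m M) {t : ℝ} (ht : t ∈ Ioo 0 T) {x : 𝕏} (hx : x ∈ Ω) :
    IsAdmissible (defect (z₀.Q t x - pressure γ (z₀.ρ t x)) (z₀.ρ t x) (m t x) (M t x)) := by
  have := h.neZero ht hx
  exact (isAdmissible_defect_iff (h.symm t (Ioo_subset_Icc_self ht) x)
    (h.traceFree t (Ioo_subset_Icc_self ht) x)).2 (h.strict t ht x hx)

theorem IsFixedSubsolution.posDef {w : StateSpace d 𝕏 γ T}
    {m : ℝ → 𝕏 → E d} {M : ℝ → 𝕏 → Matrix (Fin d) (Fin d) ℝ}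
    (h : IsFixedSubsolution π γ T Ω z₀ w m M) {t : ℝ} (ht : t ∈ Ioo 0 T) {x : 𝕏} (hx : x ∈ Ω) :
    (defect (z₀.Q t x - pressure γ (z₀.ρ t x)) (z₀.ρ t x) (m t x) (M t x)).PosDef :=
  ((isAdmissible_iff_posDef
    (isHermitian_defect (h.symm t (Ioo_subset_Icc_self ht) x))).1 (h.isAdmissible ht hx)).1

theorem IsFixedSubsolution.norm_sq_lt (hz : IsStrictSubsolution π γ T Ω z₀)
    {w : StateSpace d 𝕏 γ T}
    {m : ℝ → 𝕏 → E d} {M : ℝ → 𝕏 → Matrix (Fin d) (Fin d) ℝ}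
    (h : IsFixedSubsolution π γ T Ω z₀ w m M) {t : ℝ} (ht : t ∈ Ioo 0 T) {x : 𝕏} (hx : x ∈ Ω) :
    ‖m t x‖ ^ 2 / z₀.ρ t x < d * (z₀.Q t x - pressure γ (z₀.ρ t x)) := by
  have := h.neZero ht hx
  have hd : (0 : ℝ) < d := Nat.cast_pos.2 (NeZero.pos d)
  have hρ := hz.pos t (Ioo_subset_Icc_self ht) x
  have h1 := (h.strict t ht x hx).1.trans (h.strict t ht x hx).2
  rw [div_lt_iff₀ (by positivity)] at h1
  rw [div_lt_iff₀ hρ]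
  linarith

theorem continuousOn_pressure (hz : IsStrictSubsolution π γ T Ω z₀) :
    ContinuousOn (fun y : ℝ × 𝕏 => pressure γ (z₀.ρ y.1 y.2)) (Icc 0 T ×ˢ univ) :=
  hz.continuous_density.rpow_const fun y hy => Or.inl (hz.pos y.1 hy.1 y.2).ne'

/-- Bounds for all subsolutions on `(0,T) × C`, for a compact set `C`. -/
theorem exists_uniform_bound (hz : IsStrictSubsolution π γ T Ω z₀) {C : Set 𝕏} (hC : IsCompact C) :
    ∃ K, 0 ≤ K ∧ (∀ t ∈ Icc 0 T, ∀ x ∈ C, z₀.ρ t x ≤ K ∧ (z₀.ρ t x)⁻¹ ≤ K ∧ ‖z₀.m t x‖ ≤ K ∧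
        |z₀.Q t x| ≤ K ∧ pressure γ (z₀.ρ t x) ≤ K) ∧
      ∀ w m M, IsFixedSubsolution π γ T Ω z₀ w m M → ∀ t ∈ Ioo 0 T, ∀ x ∈ C,
        ‖m t x‖ ≤ K ∧ ∀ i j, |M t x i j| ≤ K := by
  have hcomp : IsCompact (Icc 0 T ×ˢ C) := isCompact_Icc.prod hC
  have hsub : Icc 0 T ×ˢ C ⊆ Icc 0 T ×ˢ univ := prod_mono_right (subset_univ _)
  obtain ⟨K1, hK1⟩ := hcomp.exists_bound_of_continuousOn (hz.continuous_density.mono hsub)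
  obtain ⟨K2, hK2⟩ := hcomp.exists_bound_of_continuousOn (hz.continuous_momentum.mono hsub)
  obtain ⟨K3, hK3⟩ := hcomp.exists_bound_of_continuousOn (hz.continuous_pressure.mono hsub)
  obtain ⟨K4, hK4⟩ := hcomp.exists_bound_of_continuousOn ((continuousOn_pressure hz).mono hsub)
  obtain ⟨K5, hK5⟩ := hcomp.exists_bound_of_continuousOn
    ((hz.continuous_density.inv₀ fun y hy => (hz.pos y.1 hy.1 y.2).ne').mono hsub)
  have hM : ∀ i j, ∃ K6, ∀ y ∈ Icc 0 T ×ˢ C, ‖z₀.M y.1 y.2 i j‖ ≤ K6 := fun i j =>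
    hcomp.exists_bound_of_continuousOn
      (((continuous_apply_apply i j).comp_continuousOn hz.continuous_flux).mono hsub)
  choose K6 hK6 using hM
  set A := |K1| + |K2| + |K3| + |K4| + |K5| + ∑ i, ∑ j, |K6 i j| with hA
  have hs0 : 0 ≤ ∑ i, ∑ j, |K6 i j| :=
    Finset.sum_nonneg fun i _ => Finset.sum_nonneg fun j _ => abs_nonneg _
  have hA0 : 0 ≤ A := by positivity
  have hA1 : |K1| ≤ A := by linarith [abs_nonneg K1, abs_nonneg K2, abs_nonneg K3, abs_nonneg K4, abs_nonneg K5]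
  have hA2 : |K2| ≤ A := by linarith [abs_nonneg K1, abs_nonneg K2, abs_nonneg K3, abs_nonneg K4, abs_nonneg K5]
  have hA3 : |K3| ≤ A := by linarith [abs_nonneg K1, abs_nonneg K2, abs_nonneg K3, abs_nonneg K4, abs_nonneg K5]
  have hA4 : |K4| ≤ A := by linarith [abs_nonneg K1, abs_nonneg K2, abs_nonneg K3, abs_nonneg K4, abs_nonneg K5]
  have hA5 : |K5| ≤ A := by linarith [abs_nonneg K1, abs_nonneg K2, abs_nonneg K3, abs_nonneg K4, abs_nonneg K5]
  have hA6 : ∀ i j, |K6 i j| ≤ A := by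
    intro i j
    have h1 : |K6 i j| ≤ ∑ j, |K6 i j| :=
      Finset.single_le_sum (f := fun j => |K6 i j|) (fun j _ => abs_nonneg _) (Finset.mem_univ j)
    have h2 : ∑ j, |K6 i j| ≤ ∑ i, ∑ j, |K6 i j| :=
      Finset.single_le_sum (f := fun i => ∑ j, |K6 i j|)
        (fun i _ => Finset.sum_nonneg fun j _ => abs_nonneg _) (Finset.mem_univ i)
    linarith [abs_nonneg K1, abs_nonneg K2, abs_nonneg K3, abs_nonneg K4, abs_nonneg K5]
  have hq : ∀ t ∈ Icc 0 T, ∀ x ∈ C, z₀.Q t x - pressure γ (z₀.ρ t x) ≤ A := by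
    intro t ht x hx
    have h1 := (le_abs_self _).trans ((hK3 (t, x) ⟨ht, hx⟩).trans (le_abs_self K3))
    have h2 : 0 ≤ pressure γ (z₀.ρ t x) := Real.rpow_nonneg (hz.pos t ht x).le _
    simp only at h1
    linarith
  have hAle : A ≤ 1 + A + d * (A * A) + (2 * d + 1) * A := by
    have : (0 : ℝ) ≤ d := Nat.cast_nonneg d
    nlinarith [mul_nonneg this (mul_nonneg hA0 hA0), mul_nonneg this hA0]
  -- The term `d * (A * A)` bounds `‖m‖ ^ 2` through the energy inequality, the summand 1 serves to
  -- pass from the square to the norm, and `(2 * d + 1) * A` is the flux bound of `abs_flux_le`.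
  refine ⟨1 + A + d * (A * A) + (2 * d + 1) * A, by positivity, fun t ht x hx => ?_,
    fun w m M h t ht x hx => ?_⟩
  · have h1 := (le_abs_self _).trans ((hK1 (t, x) ⟨ht, hx⟩).trans (le_abs_self K1))
    have h2 := (hK2 (t, x) ⟨ht, hx⟩).trans (le_abs_self K2)
    have h3 := (hK3 (t, x) ⟨ht, hx⟩).trans (le_abs_self K3)
    have h4 := (le_abs_self _).trans ((hK4 (t, x) ⟨ht, hx⟩).trans (le_abs_self K4))
    have h5 : (z₀.ρ t x)⁻¹ ≤ |K5| :=
      (le_abs_self _).trans ((hK5 (t, x) ⟨ht, hx⟩).trans (le_abs_self K5))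
    simp only [Real.norm_eq_abs] at h1 h2 h3 h4 h5
    exact ⟨by linarith, by linarith, by linarith, by linarith, by linarith⟩
  · have htI := Ioo_subset_Icc_self ht
    have hd0 : (0 : ℝ) ≤ d := Nat.cast_nonneg d
    by_cases hxΩ : x ∈ Ω
    · have hρ := hz.pos t htI x
      have h1 := h.norm_sq_lt hz ht hxΩ
      rw [div_lt_iff₀ hρ] at h1
      have hρA := (le_abs_self _).trans ((hK1 (t, x) ⟨htI, hx⟩).trans (le_abs_self K1))
      simp only at hρA
      have hqA := hq t htI x hx
      have hps := (h.posDef ht hxΩ).posSemidef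
      have htr := hps.trace_nonneg
      have hd1 : (0 : ℝ) < d := Nat.cast_pos.2 (h.neZero ht hxΩ).pos
      have hq0 : 0 ≤ z₀.Q t x - pressure γ (z₀.ρ t x) := by
        have : 0 ≤ (d : ℝ) * (z₀.Q t x - pressure γ (z₀.ρ t x)) * z₀.ρ t x :=
          (sq_nonneg _).trans h1.le
        exact nonneg_of_mul_nonneg_right (nonneg_of_mul_nonneg_left this hρ) hd1
      constructor
      · have h2 : ‖m t x‖ ^ 2 ≤ d * (A * A) := by
          refine h1.le.trans ?_
          rw [mul_assoc]
          refine mul_le_mul_of_nonneg_left ?_ hd0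
          exact mul_le_mul hqA (hρA.trans hA1) hρ.le hA0
        have h3 : 0 ≤ (2 * d + 1) * A := by positivity
        nlinarith [norm_nonneg (m t x), sq_nonneg (‖m t x‖ - 1)]
      · intro i j
        have h2 := abs_flux_le hρ (h.traceFree t htI x) hps hq0 i j
        have h3 : (2 * (d : ℝ) + 1) * (z₀.Q t x - pressure γ (z₀.ρ t x)) ≤ (2 * d + 1) * A :=
          mul_le_mul_of_nonneg_left hqA (by positivity)
        have h4 : 0 ≤ d * (A * A) := by positivity
        linarith
    · obtain ⟨e1, e2⟩ := h.outside t htI x hxΩ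
      rw [e1, e2]
      have h2 := (hK2 (t, x) ⟨htI, hx⟩).trans (le_abs_self K2)
      refine ⟨by simp only at h2; linarith, fun i j => ?_⟩
      have h6 := (hK6 i j (t, x) ⟨htI, hx⟩).trans (le_abs_self _)
      have := hA6 i j
      simp only [Real.norm_eq_abs] at h6
      linarith

end FixedDensity

/-! ### Integration by parts -/

section IntegrationByParts

variable {d : ℕ}

instance isAddHaarMeasure_volume_prod : (volume : Measure (ℝ × E d)).IsAddHaarMeasure :=
  Measure.prod.instIsAddHaarMeasure _ _

theorem integrable_mul_of_hasCompactSupport {f g : ℝ × E d → ℝ} (hf : Continuous f)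
    (hc : HasCompactSupport f) (hg : Continuous g) : Integrable (fun y => f y * g y) volume :=
  (hf.mul hg).integrable_of_hasCompactSupport hc.mul_right

theorem integral_mul_dirDeriv {f Φ : ℝ × E d → ℝ} (hf : ContDiff ℝ (⊤ : ℕ∞) f)
    (hc : HasCompactSupport f) (hΦ : ContDiff ℝ (⊤ : ℕ∞) Φ) (u : ℝ × E d) :
    ∫ y, f y * dirDeriv u Φ y = -∫ y, dirDeriv u f y * Φ y := by
  have hc' : HasCompactSupport (dirDeriv u f) :=
    hc.mono' ((subset_tsupport _).trans (tsupport_dirDeriv_subset f u))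
  exact integral_mul_fderiv_eq_neg_fderiv_mul_of_integrable
    (integrable_mul_of_hasCompactSupport (contDiff_dirDeriv hf u).continuous hc' hΦ.continuous)
    (integrable_mul_of_hasCompactSupport hf.continuous hc (contDiff_dirDeriv hΦ u).continuous)
    (integrable_mul_of_hasCompactSupport hf.continuous hc hΦ.continuous)
    (fun y _ => hf.differentiable (by simp) y) (fun y _ => hΦ.differentiable (by simp) y)

theorem integral_add_add {α : Type*} [MeasurableSpace α] {μ : Measure α} {f g h : α → ℝ}
    (hf : Integrable f μ) (hg : Integrable g μ) (hh : Integrable h μ) :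
    ∫ y, (f y + g y + h y) ∂μ = ∫ y, f y ∂μ + ∫ y, g y ∂μ + ∫ y, h y ∂μ := by
  rw [integral_add (f := fun y => f y + g y) (hf.add hg) hh, integral_add hf hg]

/-- This is the weak form of a pointwise conservation law. The compact supports of the fields remove
all boundary terms, so `Φ` may be the lift of a test function from the torus, whose support need not
be compact. -/
theorem integral_sum_mul_dirDeriv_eq_zero {f g h Φ : ℝ × E d → ℝ}
    (hf : ContDiff ℝ (⊤ : ℕ∞) f) (hg : ContDiff ℝ (⊤ : ℕ∞) g) (hh : ContDiff ℝ (⊤ : ℕ∞) h)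
    (hcf : HasCompactSupport f) (hcg : HasCompactSupport g) (hch : HasCompactSupport h)
    (hΦ : ContDiff ℝ (⊤ : ℕ∞) Φ) {u v w : ℝ × E d}
    (h0 : ∀ y, dirDeriv u f y + dirDeriv v g y + dirDeriv w h y = 0) :
    ∫ y, (f y * dirDeriv u Φ y + g y * dirDeriv v Φ y + h y * dirDeriv w Φ y) = 0 := by
  have i1 := fun (f : ℝ × E d → ℝ) (hf : ContDiff ℝ (⊤ : ℕ∞) f) (hc : HasCompactSupport f) u =>
    integrable_mul_of_hasCompactSupport hf.continuous hc (contDiff_dirDeriv hΦ u).continuous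
  have i2 : ∀ (f : ℝ × E d → ℝ), ContDiff ℝ (⊤ : ℕ∞) f → HasCompactSupport f → ∀ u,
      Integrable (fun y => dirDeriv u f y * Φ y) := fun f hf hc u =>
    integrable_mul_of_hasCompactSupport (contDiff_dirDeriv hf u).continuous
      (hc.mono' ((subset_tsupport _).trans (tsupport_dirDeriv_subset f u))) hΦ.continuous
  rw [integral_add_add (i1 f hf hcf u) (i1 g hg hcg v) (i1 h hh hch w),
    integral_mul_dirDeriv hf hcf hΦ, integral_mul_dirDeriv hg hcg hΦ, integral_mul_dirDeriv hh hch hΦ]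
  have hsum : (∫ y, dirDeriv u f y * Φ y) + (∫ y, dirDeriv v g y * Φ y)
      + (∫ y, dirDeriv w h y * Φ y) = 0 := by
    rw [← integral_add_add (i2 f hf hcf u) (i2 g hg hcg v) (i2 h hh hch w)]
    refine integral_eq_zero_of_ae (Eventually.of_forall fun y => ?_)
    simp only [Pi.zero_apply]
    rw [← add_mul, ← add_mul, h0, zero_mul]
  linarith

theorem dirDeriv_spaceDir (v : E d) (f : ℝ × E d → ℝ) (y : ℝ × E d) :
    dirDeriv (spaceDir v) f y
      = ∑ j, v j * dirDeriv (spaceDir (EuclideanSpace.single j (1 : ℝ))) f y := by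
  have hv : spaceDir v = ∑ j, v j • spaceDir (EuclideanSpace.single j (1 : ℝ)) := by
    refine Prod.ext ?_ ?_
    · simp [spaceDir, Prod.fst_sum]
    · ext i
      simp [spaceDir, Prod.snd_sum, Pi.single_apply]
  unfold dirDeriv
  rw [hv, map_sum]
  simp

end IntegrationByParts

/-! ### Localised waves on the base -/

section Waves

set_option linter.unusedSectionVars false

variable {d : ℕ} {𝕏 : Type} [AddCommGroup 𝕏] [TopologicalSpace 𝕏] [MeasureSpace 𝕏] [T2Space 𝕏]
  [SecondCountableTopology 𝕏] [BorelSpace 𝕏] [IsFiniteMeasureOnCompacts (volume : Measure 𝕏)]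
  [SigmaFinite (volume : Measure 𝕏)]

variable {π : E d → 𝕏} {γ T : ℝ} [Fact (1 < γ)] {Ω : Set 𝕏} {z₀ : Quadruple d 𝕏}

theorem prod_volume_eq_restrict : ((volume : Measure ℝ).restrict (Ioo 0 T)).prod
    (volume : Measure 𝕏) = (volume : Measure (ℝ × 𝕏)).restrict (Ioo 0 T ×ˢ univ) := by
  rw [Measure.volume_eq_prod, ← Measure.prod_restrict, Measure.restrict_univ]

/-- The fields of a subsolution may jump across the boundary of Ω. They are continuous on Ω and
coincide with the continuous fields of `z₀` on its complement, which is enough for measurability. -/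
theorem aestronglyMeasurable_of_continuousOn_pieces {F : Type*} [TopologicalSpace F]
    [TopologicalSpace.PseudoMetrizableSpace F] (hΩ : IsOpen Ω) {f g : ℝ × 𝕏 → F}
    (hf : ContinuousOn f (Icc 0 T ×ˢ Ω)) (hg : ContinuousOn g (Icc 0 T ×ˢ univ))
    (hfg : ∀ t ∈ Icc 0 T, ∀ x ∉ Ω, f (t, x) = g (t, x)) :
    AEStronglyMeasurable f (((volume : Measure ℝ).restrict (Ioo 0 T)).prod (volume : Measure 𝕏)) := by
  rw [prod_volume_eq_restrict]
  have hu : Ioo (0 : ℝ) T ×ˢ (univ : Set 𝕏) = Ioo 0 T ×ˢ Ω ∪ Ioo 0 T ×ˢ Ωᶜ := by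
    rw [← prod_union, union_compl_self]
  rw [hu, aestronglyMeasurable_union_iff]
  constructor
  · exact (hf.mono (prod_mono_left Ioo_subset_Icc_self)).aestronglyMeasurable
      (measurableSet_Ioo.prod hΩ.measurableSet)
  · have hm : MeasurableSet (Ioo (0 : ℝ) T ×ˢ Ωᶜ) := measurableSet_Ioo.prod hΩ.measurableSet.compl
    refine ((hg.mono (prod_mono Ioo_subset_Icc_self (subset_univ _))).aestronglyMeasurable
      hm).congr ?_
    filter_upwards [ae_restrict_mem hm] with y hy
    exact (hfg y.1 (Ioo_subset_Icc_self hy.1) y.2 hy.2).symm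

theorem integrable_mul_of_bound {f g : ℝ × 𝕏 → ℝ} {C : Set 𝕏} (hC : IsCompact C) {K L : ℝ}
    (hf : AEStronglyMeasurable f
      (((volume : Measure ℝ).restrict (Ioo 0 T)).prod (volume : Measure 𝕏)))
    (hg : Continuous g) (hfK : ∀ t ∈ Ioo 0 T, ∀ x ∈ C, |f (t, x)| ≤ K)
    (hgL : ∀ y, |g y| ≤ L) (hg0 : ∀ t, ∀ x ∉ C, g (t, x) = 0) :
    Integrable (fun y => f y * g y)
      (((volume : Measure ℝ).restrict (Ioo 0 T)).prod (volume : Measure 𝕏)) := by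
  have hfin : Integrable (fun _ => |K| * |L| : ℝ × 𝕏 → ℝ)
      (((volume : Measure ℝ).restrict (Ioo 0 T)).prod ((volume : Measure 𝕏).restrict C)) := by
    have : IsFiniteMeasure ((volume : Measure 𝕏).restrict C) :=
      isFiniteMeasure_restrict.2 hC.measure_lt_top.ne
    exact integrable_const _
  have hind : Integrable ((univ ×ˢ C).indicator (fun _ => |K| * |L| : ℝ × 𝕏 → ℝ))
      (((volume : Measure ℝ).restrict (Ioo 0 T)).prod (volume : Measure 𝕏)) := by
    rw [integrable_indicator_iff (MeasurableSet.univ.prod hC.measurableSet), IntegrableOn,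
      ← Measure.prod_restrict, Measure.restrict_univ]
    exact hfin
  refine hind.mono' (hf.mul hg.aestronglyMeasurable) ?_
  rw [prod_volume_eq_restrict]
  filter_upwards [ae_restrict_mem (measurableSet_Ioo.prod MeasurableSet.univ)] with y hy
  by_cases hyC : y.2 ∈ C
  · rw [indicator_of_mem (show y ∈ univ ×ˢ C from ⟨mem_univ _, hyC⟩), norm_mul]
    exact mul_le_mul ((hfK y.1 hy.1 y.2 hyC).trans (le_abs_self _)) ((hgL y).trans (le_abs_self _))
      (norm_nonneg _) (abs_nonneg _)
  · have : g y = 0 := hg0 y.1 y.2 hyC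
    rw [indicator_of_notMem (fun h => hyC h.2), this]
    simp

theorem integral_extendBall (hπ : IsFlatCovering π) {xc : E d} {R : ℝ}
    (hch : InjOn π (Metric.ball xc R) ∧ MeasurePreserving π (volume.restrict (Metric.ball xc R))
      (volume.restrict (π '' Metric.ball xc R))) {K : Set (E d)} (hK : IsCompact K)
    (hKs : K ⊆ Metric.ball xc R) {g : E d → ℝ} (hg : Continuous g) (hg0 : ∀ y ∉ K, g y = 0) :
    ∫ x, extendBall π (Metric.ball xc R) g x = ∫ y, g y := by
  have hcont : Continuous (extendBall π (Metric.ball xc R) g) := by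
    have := continuous_extendBall hπ hch.1 Metric.isOpen_ball hK hKs
      (f := fun _ : ℝ => g) (hg.comp continuous_snd) (fun _ => hg0)
    exact this.comp (Continuous.prodMk_right (0 : ℝ))
  rw [integral_eq_setIntegral_ball hπ hch le_rfl hcont.aestronglyMeasurable
    (fun z hz => extendBall_eq_zero g hz)]
  rw [← setIntegral_eq_integral_of_forall_compl_eq_zero (s := Metric.ball xc R)
    (fun y hy => hg0 y fun h => hy (hKs h))]
  exact setIntegral_congr_fun measurableSet_ball fun y hy => extendBall_apply hch.1 g hy

theorem integral_integral_extendBall (hπ : IsFlatCovering π) {xc : E d} {R : ℝ}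
    (hch : InjOn π (Metric.ball xc R) ∧ MeasurePreserving π (volume.restrict (Metric.ball xc R))
      (volume.restrict (π '' Metric.ball xc R))) {I : Set ℝ} {K : Set (E d)} (hI : IsCompact I)
    (hIT : I ⊆ Ioo 0 T) (hK : IsCompact K)
    (hKs : K ⊆ Metric.ball xc R) {G : ℝ × E d → ℝ} (hG : Continuous G)
    (hG0 : ∀ y ∉ I ×ˢ K, G y = 0) :
    ∫ t in Ioo 0 T, ∫ x, extendBall π (Metric.ball xc R) (fun y => G (t, y)) x = ∫ y, G y := by
  have h1 : ∀ t, ∫ x, extendBall π (Metric.ball xc R) (fun y => G (t, y)) x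
      = ∫ y, G (t, y) := fun t =>
    integral_extendBall hπ hch hK hKs (hG.comp (Continuous.prodMk_right t))
      fun y hy => hG0 _ fun h => hy h.2
  simp_rw [h1]
  rw [setIntegral_eq_integral_of_forall_compl_eq_zero, Measure.volume_eq_prod, integral_prod]
  · exact hG.integrable_of_hasCompactSupport (HasCompactSupport.intro (hI.prod hK) hG0)
  · intro t ht
    refine integral_eq_zero_of_ae (Eventually.of_forall fun y => ?_)
    exact hG0 _ fun h => ht (hIT h.1)

/-- `a ⊗ b + b ⊗ a`. -/
def symProd (a b : E d) : Matrix (Fin d) (Fin d) ℝ := Matrix.of fun i j => a i * b j + b i * a j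

/-- The momentum of a wave. -/
def waveMomentum (e ξ : E d) (c₁ c₂ : ℝ × E d → ℝ) (y : ℝ × E d) : E d := c₁ y • e + c₂ y • ξ

/-- The flux of a wave. -/
def waveFlux (e ξ : E d) (a b : ℝ × E d → ℝ) (y : ℝ × E d) : Matrix (Fin d) (Fin d) ℝ :=
  a y • (tensorSq e - tensorSq ξ) + b y • symProd e ξ

theorem isSymm_symProd (a b : E d) : (symProd a b).IsSymm := by
  ext i j
  simp [symProd]
  ring

theorem isSymm_waveFlux (e ξ : E d) (a b : ℝ × E d → ℝ) (y : ℝ × E d) :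
    (waveFlux e ξ a b y).IsSymm := by
  refine Matrix.IsSymm.add (Matrix.IsSymm.smul (Matrix.IsSymm.sub ?_ ?_) _)
    ((isSymm_symProd e ξ).smul _)
  · exact isHermitian_iff_isSymm.1 (isHermitian_tensorSq e)
  · exact isHermitian_iff_isSymm.1 (isHermitian_tensorSq ξ)

theorem inner_eq_sum (a b : E d) : inner ℝ a b = ∑ i, a i * b i := by
  simp [PiLp.inner_apply, mul_comm]

theorem trace_symProd (a b : E d) : (symProd a b).trace = 2 * inner ℝ a b := by
  rw [inner_eq_sum, Finset.mul_sum]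
  simp only [symProd, Matrix.trace, Matrix.diag, Matrix.of_apply]
  exact Finset.sum_congr rfl fun i _ => by ring

theorem trace_waveFlux {e ξ : E d} (he : ‖e‖ = 1) (hξ : ‖ξ‖ = 1) (heξ : inner ℝ e ξ = (0 : ℝ))
    (a b : ℝ × E d → ℝ) (y : ℝ × E d) : (waveFlux e ξ a b y).trace = 0 := by
  rw [waveFlux, Matrix.trace_add, Matrix.trace_smul, Matrix.trace_smul, Matrix.trace_sub,
    trace_tensorSq, trace_tensorSq, trace_symProd, he, hξ, heξ]
  simp

/-- The defining properties of localised waves with values in the plane of `e` and `ξ`. -/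
structure IsWave (e ξ : E d) (I : Set ℝ) (K : Set (E d)) (c₁ c₂ a b : ℝ × E d → ℝ) : Prop where
  smooth₁ : ContDiff ℝ (⊤ : ℕ∞) c₁
  smooth₂ : ContDiff ℝ (⊤ : ℕ∞) c₂
  smooth₃ : ContDiff ℝ (⊤ : ℕ∞) a
  smooth₄ : ContDiff ℝ (⊤ : ℕ∞) b
  zero : ∀ y ∉ I ×ˢ K, c₁ y = 0 ∧ c₂ y = 0 ∧ a y = 0 ∧ b y = 0
  momentum₁ : ∀ y, dirDeriv (timeDir d) c₁ y + dirDeriv (spaceDir e) a y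
    + dirDeriv (spaceDir ξ) b y = 0
  momentum₂ : ∀ y, dirDeriv (timeDir d) c₂ y - dirDeriv (spaceDir ξ) a y
    + dirDeriv (spaceDir e) b y = 0
  mass : ∀ y, dirDeriv (spaceDir e) c₁ y + dirDeriv (spaceDir ξ) c₂ y = 0

variable {e ξ : E d} {I : Set ℝ} {K : Set (E d)} {c₁ c₂ a b : ℝ × E d → ℝ}

theorem IsWave.hasCompactSupport (h : IsWave e ξ I K c₁ c₂ a b) (hI : IsCompact I)
    (hK : IsCompact K) : HasCompactSupport c₁ ∧ HasCompactSupport c₂ ∧ HasCompactSupport a ∧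
      HasCompactSupport b :=
  ⟨HasCompactSupport.intro (hI.prod hK) fun y hy => (h.zero y hy).1,
    HasCompactSupport.intro (hI.prod hK) fun y hy => (h.zero y hy).2.1,
    HasCompactSupport.intro (hI.prod hK) fun y hy => (h.zero y hy).2.2.1,
    HasCompactSupport.intro (hI.prod hK) fun y hy => (h.zero y hy).2.2.2⟩

theorem IsWave.continuous_waveMomentum (h : IsWave e ξ I K c₁ c₂ a b) :
    Continuous (waveMomentum e ξ c₁ c₂) :=
  (h.smooth₁.continuous.smul continuous_const).add (h.smooth₂.continuous.smul continuous_const)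

theorem IsWave.continuous_waveFlux (h : IsWave e ξ I K c₁ c₂ a b) :
    Continuous (waveFlux e ξ a b) :=
  (h.smooth₃.continuous.smul continuous_const).add (h.smooth₄.continuous.smul continuous_const)

theorem IsWave.waveMomentum_eq_zero (h : IsWave e ξ I K c₁ c₂ a b) {y : ℝ × E d}
    (hy : y ∉ I ×ˢ K) : waveMomentum e ξ c₁ c₂ y = 0 := by
  simp [waveMomentum, h.zero y hy]

theorem IsWave.waveFlux_eq_zero (h : IsWave e ξ I K c₁ c₂ a b) {y : ℝ × E d}
    (hy : y ∉ I ×ˢ K) : waveFlux e ξ a b y = 0 := by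
  simp [waveFlux, h.zero y hy]

/-- The wave solves the momentum equation. -/
theorem IsWave.integral_momentum (h : IsWave e ξ I K c₁ c₂ a b) (hI : IsCompact I)
    (hK : IsCompact K) {Φ : ℝ × E d → ℝ} (hΦ : ContDiff ℝ (⊤ : ℕ∞) Φ) (i : Fin d) :
    ∫ y, (waveMomentum e ξ c₁ c₂ y i * dirDeriv (timeDir d) Φ y + ∑ j, waveFlux e ξ a b y i j
      * dirDeriv (spaceDir (EuclideanSpace.single j (1 : ℝ))) Φ y) = 0 := by
  obtain ⟨k1, k2, k3, k4⟩ := h.hasCompactSupport hI hK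
  have z1 := integral_sum_mul_dirDeriv_eq_zero h.smooth₁ h.smooth₃ h.smooth₄ k1 k3 k4 hΦ
    h.momentum₁
  have hneg : ∀ u, dirDeriv u (fun y => (-1) * a y) = fun y => (-1) * dirDeriv u a y :=
    dirDeriv_const_mul h.smooth₃ (-1)
  have z2 := integral_sum_mul_dirDeriv_eq_zero h.smooth₂ (contDiff_const.mul h.smooth₃ (f := fun _ => (-1 : ℝ))) h.smooth₄ k2
    k3.mul_left k4 hΦ (u := timeDir d) (v := spaceDir ξ) (w := spaceDir e) fun y => by
      have h1 := h.momentum₂ y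
      rw [hneg]
      linarith
  have hcont := fun u => (contDiff_dirDeriv hΦ u).continuous
  have int1 : Integrable fun y => c₁ y * dirDeriv (timeDir d) Φ y
      + a y * dirDeriv (spaceDir e) Φ y + b y * dirDeriv (spaceDir ξ) Φ y :=
    ((integrable_mul_of_hasCompactSupport h.smooth₁.continuous k1 (hcont _)).add
      (integrable_mul_of_hasCompactSupport h.smooth₃.continuous k3 (hcont _))).add
      (integrable_mul_of_hasCompactSupport h.smooth₄.continuous k4 (hcont _))
  have int2 : Integrable fun y => c₂ y * dirDeriv (timeDir d) Φ y
      + (-1) * a y * dirDeriv (spaceDir ξ) Φ y + b y * dirDeriv (spaceDir e) Φ y :=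
    ((integrable_mul_of_hasCompactSupport h.smooth₂.continuous k2 (hcont _)).add
      (integrable_mul_of_hasCompactSupport (continuous_const.mul h.smooth₃.continuous)
        k3.mul_left (hcont _))).add
      (integrable_mul_of_hasCompactSupport h.smooth₄.continuous k4 (hcont _))
  have key : ∀ y, waveMomentum e ξ c₁ c₂ y i * dirDeriv (timeDir d) Φ y + ∑ j, waveFlux e ξ a b y i j
      * dirDeriv (spaceDir (EuclideanSpace.single j (1 : ℝ))) Φ y
      = e i * (c₁ y * dirDeriv (timeDir d) Φ y
          + a y * dirDeriv (spaceDir e) Φ y + b y * dirDeriv (spaceDir ξ) Φ y)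
        + ξ i * (c₂ y * dirDeriv (timeDir d) Φ y
          + (-1) * a y * dirDeriv (spaceDir ξ) Φ y + b y * dirDeriv (spaceDir e) Φ y) := by
    intro y
    rw [dirDeriv_spaceDir e, dirDeriv_spaceDir ξ]
    -- Contracting a row of the flux with the gradient of `Φ` leaves only derivatives along `e` and
    -- `ξ`. The coefficients of `e i` and `ξ i` in the total are then the two scalar momentum
    -- equations.
    have hs : ∑ j, waveFlux e ξ a b y i j
        * dirDeriv (spaceDir (EuclideanSpace.single j (1 : ℝ))) Φ y
        = (a y * e i + b y * ξ i) * (∑ j, e j * dirDeriv (spaceDir (EuclideanSpace.single j (1 : ℝ))) Φ y)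
          + (b y * e i - a y * ξ i)
            * (∑ j, ξ j * dirDeriv (spaceDir (EuclideanSpace.single j (1 : ℝ))) Φ y) := by
      rw [Finset.mul_sum, Finset.mul_sum, ← Finset.sum_add_distrib]
      refine Finset.sum_congr rfl fun j _ => ?_
      simp [waveFlux, tensorSq, symProd]
      ring
    rw [hs]
    simp [waveMomentum]
    ring
  simp_rw [key]
  rw [integral_add (int1.const_mul _) (int2.const_mul _), integral_const_mul, integral_const_mul,
    z1, z2]
  simp

/-- The wave solves the continuity equation. -/
theorem IsWave.integral_mass (h : IsWave e ξ I K c₁ c₂ a b) (hI : IsCompact I)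
    (hK : IsCompact K) {Φ : ℝ × E d → ℝ} (hΦ : ContDiff ℝ (⊤ : ℕ∞) Φ) :
    ∫ y, ∑ j, waveMomentum e ξ c₁ c₂ y j
      * dirDeriv (spaceDir (EuclideanSpace.single j (1 : ℝ))) Φ y = 0 := by
  obtain ⟨k1, k2, -, -⟩ := h.hasCompactSupport hI hK
  have z1 := integral_sum_mul_dirDeriv_eq_zero h.smooth₁ h.smooth₂ contDiff_const k1 k2
    (HasCompactSupport.zero) hΦ (u := spaceDir e) (v := spaceDir ξ) (w := spaceDir ξ) (h := 0)
    fun y => by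
      have h1 := h.mass y
      have h2 : dirDeriv (spaceDir ξ) (0 : ℝ × E d → ℝ) y = 0 := by
        unfold dirDeriv
        simp
      rw [h2]
      linarith
  rw [← z1]
  refine integral_congr_ae (Eventually.of_forall fun y => ?_)
  simp only
  rw [dirDeriv_spaceDir e, dirDeriv_spaceDir ξ, Finset.mul_sum, Finset.mul_sum,
    ← Finset.sum_add_distrib]
  simp only [Pi.zero_apply, zero_mul, add_zero]
  refine Finset.sum_congr rfl fun j _ => ?_
  simp [waveMomentum]
  ring

end Waves

/-! ### Adding a localised wave to a subsolution. -/

section AddWave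

set_option linter.unusedSectionVars false

variable {d : ℕ} {𝕏 : Type} [AddCommGroup 𝕏] [TopologicalSpace 𝕏] [MeasureSpace 𝕏] [T2Space 𝕏]
  [SecondCountableTopology 𝕏] [BorelSpace 𝕏] [IsFiniteMeasureOnCompacts (volume : Measure 𝕏)]
  [SigmaFinite (volume : Measure 𝕏)]

variable {π : E d → 𝕏} {γ T : ℝ} [Fact (1 < γ)] {Ω : Set 𝕏} {z₀ : Quadruple d 𝕏}

/-- A space-time function on a ball, regarded as a function on `ℝ × 𝕏`. -/
def baseField (π : E d → 𝕏) (s : Set (E d)) {F : Type*} [Zero F] (f : ℝ × E d → F) (t : ℝ)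
    (x : 𝕏) : F :=
  extendBall π s (fun y => f (t, y)) x

theorem continuous_coord (i : Fin d) : Continuous fun v : E d => v i := by fun_prop

theorem extendBall_induction {s : Set (E d)} {F : Type*} [Zero F] {f : E d → F} {P : F → Prop}
    (h0 : P 0) (hf : ∀ y, P (f y)) (x : 𝕏) : P (extendBall π s f x) := by
  unfold extendBall
  split_ifs
  · exact hf _
  · exact h0

theorem IsFixedSubsolution.aestronglyMeasurable_momentum (hΩ : IsOpen Ω)
    (hz : IsStrictSubsolution π γ T Ω z₀) {w : StateSpace d 𝕏 γ T} {m : ℝ → 𝕏 → E d}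
    {M : ℝ → 𝕏 → Matrix (Fin d) (Fin d) ℝ} (h : IsFixedSubsolution π γ T Ω z₀ w m M) :
    AEStronglyMeasurable (fun y : ℝ × 𝕏 => m y.1 y.2)
      (((volume : Measure ℝ).restrict (Ioo 0 T)).prod (volume : Measure 𝕏)) :=
  aestronglyMeasurable_of_continuousOn_pieces hΩ h.continuous_momentum hz.continuous_momentum
    fun t ht x hx => (h.outside t ht x hx).1

theorem IsFixedSubsolution.aestronglyMeasurable_momentum_apply (hΩ : IsOpen Ω)
    (hz : IsStrictSubsolution π γ T Ω z₀) {w : StateSpace d 𝕏 γ T} {m : ℝ → 𝕏 → E d}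
    {M : ℝ → 𝕏 → Matrix (Fin d) (Fin d) ℝ} (h : IsFixedSubsolution π γ T Ω z₀ w m M) (i : Fin d) :
    AEStronglyMeasurable (fun y : ℝ × 𝕏 => m y.1 y.2 i)
      (((volume : Measure ℝ).restrict (Ioo 0 T)).prod (volume : Measure 𝕏)) :=
  (continuous_coord i).comp_aestronglyMeasurable
    (h.aestronglyMeasurable_momentum hΩ hz)

theorem IsFixedSubsolution.aestronglyMeasurable_flux (hΩ : IsOpen Ω)
    (hz : IsStrictSubsolution π γ T Ω z₀) {w : StateSpace d 𝕏 γ T} {m : ℝ → 𝕏 → E d}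
    {M : ℝ → 𝕏 → Matrix (Fin d) (Fin d) ℝ} (h : IsFixedSubsolution π γ T Ω z₀ w m M) (i j : Fin d) :
    AEStronglyMeasurable (fun y : ℝ × 𝕏 => M y.1 y.2 i j)
      (((volume : Measure ℝ).restrict (Ioo 0 T)).prod (volume : Measure 𝕏)) :=
  aestronglyMeasurable_of_continuousOn_pieces hΩ
    ((continuous_apply_apply i j).comp_continuousOn h.continuous_flux)
    ((continuous_apply_apply i j).comp_continuousOn hz.continuous_flux)
    fun t ht x hx => by
      show M t x i j = z₀.M t x i j
      rw [(h.outside t ht x hx).2]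

theorem aestronglyMeasurable_of_continuousOn {f : ℝ × 𝕏 → ℝ}
    (hf : ContinuousOn f (Icc 0 T ×ˢ univ)) :
    AEStronglyMeasurable f
      (((volume : Measure ℝ).restrict (Ioo 0 T)).prod (volume : Measure 𝕏)) :=
  aestronglyMeasurable_of_continuousOn_pieces isOpen_univ hf hf fun _ _ _ _ => rfl

/-- The total flux `M + Q I`. -/
theorem abs_flux_add_pressure_le {K : ℝ} (hK : 0 ≤ K) {B : Matrix (Fin d) (Fin d) ℝ} {q : ℝ}
    {i j : Fin d} (hB : |B i j| ≤ K) (hq : |q| ≤ K) :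
    |(B + q • (1 : Matrix (Fin d) (Fin d) ℝ)) i j| ≤ 2 * K := by
  rw [Matrix.add_apply, Matrix.smul_apply, smul_eq_mul]
  refine (abs_add_le _ _).trans ?_
  have : |q * (1 : Matrix (Fin d) (Fin d) ℝ) i j| ≤ K := by
    rw [abs_mul, Matrix.one_apply]
    split_ifs
    · simpa using hq
    · simpa using hK
  linarith

theorem IsFixedSubsolution.integrable_momentum_equation (hπ : IsFlatCovering π) (hΩ : IsOpen Ω)
    (hz : IsStrictSubsolution π γ T Ω z₀) {w : StateSpace d 𝕏 γ T} {m : ℝ → 𝕏 → E d}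
    {M : ℝ → 𝕏 → Matrix (Fin d) (Fin d) ℝ} (h : IsFixedSubsolution π γ T Ω z₀ w m M)
    {φ : ℝ × 𝕏 → ℝ} (hφ : IsTestFunction π T φ) (i : Fin d) :
    Integrable (fun y : ℝ × 𝕏 => m y.1 y.2 i * dt φ y.1 y.2
        + ∑ j, (M y.1 y.2 + z₀.Q y.1 y.2 • (1 : Matrix (Fin d) (Fin d) ℝ)) i j * dx π j φ y.1 y.2)
      (((volume : Measure ℝ).restrict (Ioo 0 T)).prod (volume : Measure 𝕏)) := by
  have hC := hφ.isCompact_spatialSupport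
  obtain ⟨K, hK0, hK1, hK2⟩ := exists_uniform_bound hz hC
  have hl : ∀ f, IsLiftedDeriv π φ f → ∃ L, ∀ y : ℝ × 𝕏, |f y.1 y.2| ≤ L := fun f hf => by
    obtain ⟨L, -, hL⟩ := hf.exists_bound hπ hφ
    exact ⟨L, fun y => hL _ _⟩
  refine Integrable.add ?_ (integrable_finsetSum _ fun j _ => ?_)
  · obtain ⟨L, hL⟩ := hl _ (isLiftedDeriv_dt hφ)
    refine integrable_mul_of_bound (K := K) hC (h.aestronglyMeasurable_momentum_apply hΩ hz i)
      ((isLiftedDeriv_dt hφ).continuous hπ hφ) (fun t ht x hx => ?_) hL fun t x hx =>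
        (isLiftedDeriv_dt hφ).eq_zero_of_notMem_spatialSupport hπ hx
    exact (PiLp.norm_apply_le (m t x) i).trans (hK2 w m M h t ht x hx).1
  · have hd := isLiftedDeriv_dx hπ hφ j
    obtain ⟨L, hL⟩ := hl _ hd
    refine integrable_mul_of_bound (K := 2 * K) hC ?_ (hd.continuous hπ hφ)
      (fun t ht x hx => ?_) hL fun t x hx => hd.eq_zero_of_notMem_spatialSupport hπ hx
    · exact (h.aestronglyMeasurable_flux hΩ hz i j).add
        ((aestronglyMeasurable_of_continuousOn hz.continuous_pressure).mul
          aestronglyMeasurable_const)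
    · exact abs_flux_add_pressure_le hK0 ((hK2 w m M h t ht x hx).2 i j)
        (hK1 t (Ioo_subset_Icc_self ht) x hx).2.2.2.1

theorem IsFixedSubsolution.integrable_mass_equation (hπ : IsFlatCovering π) (hΩ : IsOpen Ω)
    (hz : IsStrictSubsolution π γ T Ω z₀) {w : StateSpace d 𝕏 γ T} {m : ℝ → 𝕏 → E d}
    {M : ℝ → 𝕏 → Matrix (Fin d) (Fin d) ℝ} (h : IsFixedSubsolution π γ T Ω z₀ w m M)
    {φ : ℝ × 𝕏 → ℝ} (hφ : IsTestFunction π T φ) :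
    Integrable (fun y : ℝ × 𝕏 => z₀.ρ y.1 y.2 * dt φ y.1 y.2
        + ∑ j, m y.1 y.2 j * dx π j φ y.1 y.2)
      (((volume : Measure ℝ).restrict (Ioo 0 T)).prod (volume : Measure 𝕏)) := by
  have hC := hφ.isCompact_spatialSupport
  obtain ⟨K, hK0, hK1, hK2⟩ := exists_uniform_bound hz hC
  refine Integrable.add ?_ (integrable_finsetSum _ fun j _ => ?_)
  · have hd := isLiftedDeriv_dt hφ
    obtain ⟨L, -, hL⟩ := hd.exists_bound hπ hφ
    refine integrable_mul_of_bound (K := K) hC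
      (aestronglyMeasurable_of_continuousOn hz.continuous_density)
      (hd.continuous hπ hφ) (fun t ht x hx => ?_) (fun y => hL y.1 y.2) fun t x hx =>
        hd.eq_zero_of_notMem_spatialSupport hπ hx
    rw [abs_of_pos (hz.pos t (Ioo_subset_Icc_self ht) x)]
    exact (hK1 t (Ioo_subset_Icc_self ht) x hx).1
  · have hd := isLiftedDeriv_dx hπ hφ j
    obtain ⟨L, -, hL⟩ := hd.exists_bound hπ hφ
    refine integrable_mul_of_bound (K := K) hC (h.aestronglyMeasurable_momentum_apply hΩ hz j)
      (hd.continuous hπ hφ) (fun t ht x hx => ?_) (fun y => hL y.1 y.2) fun t x hx =>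
        hd.eq_zero_of_notMem_spatialSupport hπ hx
    exact (PiLp.norm_apply_le (m t x) j).trans (hK2 w m M h t ht x hx).1

variable {e ξ : E d} {I : Set ℝ} {K : Set (E d)} {c₁ c₂ a b : ℝ × E d → ℝ} {xc : E d} {R : ℝ}

theorem continuous_baseField (hπ : IsFlatCovering π) (hinj : InjOn π (Metric.ball xc R))
    (hK : IsCompact K) (hKs : K ⊆ Metric.ball xc R) {F : Type*} [TopologicalSpace F] [Zero F]
    {f : ℝ × E d → F} (hf : Continuous f) (hf0 : ∀ y ∉ I ×ˢ K, f y = 0) :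
    Continuous fun y : ℝ × 𝕏 => baseField π (Metric.ball xc R) f y.1 y.2 :=
  continuous_extendBall hπ hinj Metric.isOpen_ball hK hKs (f := fun t y => f (t, y)) hf
    fun _ _ hy => hf0 _ fun h => hy h.2

theorem baseField_eq_zero (hinj : InjOn π (Metric.ball xc R)) {F : Type*} [Zero F]
    {f : ℝ × E d → F} (hf0 : ∀ y ∉ I ×ˢ K, f y = 0) {t : ℝ} {x : 𝕏}
    (h : t ∉ I ∨ x ∉ π '' K) : baseField π (Metric.ball xc R) f t x = 0 := by
  rcases h with h | h
  · exact extendBall_induction (P := fun v : F => v = 0) rfl (fun y => hf0 _ fun h' => h h'.1) x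
  · exact extendBall_eq_zero_of_support hinj (fun y hy => hf0 _ fun h' => hy h'.2) h

theorem baseField_apply (hinj : InjOn π (Metric.ball xc R)) {F : Type*} [Zero F]
    (f : ℝ × E d → F) (t : ℝ) {y : E d} (hy : y ∈ Metric.ball xc R) :
    baseField π (Metric.ball xc R) f t (π y) = f (t, y) :=
  extendBall_apply hinj _ hy

theorem integrable_of_continuous_of_compact {g : ℝ × 𝕏 → ℝ} {C : Set 𝕏} (hI : IsCompact I)
    (hC : IsCompact C) (hg : Continuous g) (hg0 : ∀ y ∉ I ×ˢ C, g y = 0) :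
    Integrable g ((volume : Measure ℝ).prod (volume : Measure 𝕏)) :=
  hg.integrable_of_hasCompactSupport (HasCompactSupport.intro (hI.prod hC) hg0)

/-- The state perturbed by a wave. -/
def addWave (hπ : IsFlatCovering π) (hinj : InjOn π (Metric.ball xc R)) (hK : IsCompact K)
    (hKs : K ⊆ Metric.ball xc R) (hw : IsWave e ξ I K c₁ c₂ a b) (w : StateSpace d 𝕏 γ T) :
    StateSpace d 𝕏 γ T :=
  (w.1, w.2 + perturbation (K := π '' K)
    (continuous_baseField hπ hinj hK hKs hw.continuous_waveMomentum
      fun _ hy => hw.waveMomentum_eq_zero hy)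
    (hK.image hπ.isOpenQuotientMap.continuous)
    fun _ _ hx => baseField_eq_zero hinj (fun _ hy => hw.waveMomentum_eq_zero hy) (Or.inr hx))

/-- The wave solves the linear system with zero density and zero pressure, so the equations simply
add. It is supported in `I` times the image of `K`: hence endpoints, exterior values and compact
supports are respected, and the strict inequalities need to be checked only there, which is `hadm`.
-/
theorem IsFixedSubsolution.addWave (hπ : IsFlatCovering π) (hΩ : IsOpen Ω)
    (hz : IsStrictSubsolution π γ T Ω z₀) {w : StateSpace d 𝕏 γ T} {m : ℝ → 𝕏 → E d}
    {M : ℝ → 𝕏 → Matrix (Fin d) (Fin d) ℝ} (h : IsFixedSubsolution π γ T Ω z₀ w m M)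
    (hch : InjOn π (Metric.ball xc R) ∧ MeasurePreserving π (volume.restrict (Metric.ball xc R))
      (volume.restrict (π '' Metric.ball xc R)))
    (hI : IsCompact I) (hIT : I ⊆ Ioo 0 T) (hK : IsCompact K) (hKs : K ⊆ Metric.ball xc R)
    (hKΩ : π '' K ⊆ Ω) (he : ‖e‖ = 1) (hξ : ‖ξ‖ = 1) (heξ : inner ℝ e ξ = (0 : ℝ))
    (hw : IsWave e ξ I K c₁ c₂ a b)
    (hadm : ∀ t ∈ I, ∀ y ∈ K, IsAdmissible (defect (z₀.Q t (π y) - pressure γ (z₀.ρ t (π y)))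
      (z₀.ρ t (π y)) (m t (π y) + waveMomentum e ξ c₁ c₂ (t, y))
      (M t (π y) + waveFlux e ξ a b (t, y)))) :
    IsFixedSubsolution π γ T Ω z₀ (addWave hπ hch.1 hK hKs hw w)
      (fun t x => m t x + baseField π (Metric.ball xc R) (waveMomentum e ξ c₁ c₂) t x)
      (fun t x => M t x + baseField π (Metric.ball xc R) (waveFlux e ξ a b) t x) := by
  set s := Metric.ball xc R with hs
  set V := baseField π s (waveMomentum e ξ c₁ c₂) with hV
  set W := baseField π s (waveFlux e ξ a b) with hW
  have hV0 : ∀ y ∉ I ×ˢ K, waveMomentum e ξ c₁ c₂ y = 0 := fun _ hy => hw.waveMomentum_eq_zero hy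
  have hW0 : ∀ y ∉ I ×ˢ K, waveFlux e ξ a b y = 0 := fun _ hy => hw.waveFlux_eq_zero hy
  have hVc : Continuous fun y : ℝ × 𝕏 => V y.1 y.2 :=
    continuous_baseField hπ hch.1 hK hKs hw.continuous_waveMomentum hV0
  have hWc : Continuous fun y : ℝ × 𝕏 => W y.1 y.2 :=
    continuous_baseField hπ hch.1 hK hKs hw.continuous_waveFlux hW0
  have hKc : IsCompact (π '' K) := hK.image hπ.isOpenQuotientMap.continuous
  have hVz : ∀ t x, (t ∉ I ∨ x ∉ π '' K) → V t x = 0 := fun t x hx =>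
    baseField_eq_zero hch.1 hV0 hx
  have hWz : ∀ t x, (t ∉ I ∨ x ∉ π '' K) → W t x = 0 := fun t x hx =>
    baseField_eq_zero hch.1 hW0 hx
  have hWs : ∀ t x, (W t x).IsSymm := fun t x =>
    extendBall_induction (P := fun B : Matrix (Fin d) (Fin d) ℝ => B.IsSymm) (by simp)
      (fun y => isSymm_waveFlux e ξ a b _) x
  have hWt : ∀ t x, (W t x).trace = 0 := fun t x =>
    extendBall_induction (P := fun B : Matrix (Fin d) (Fin d) ℝ => B.trace = 0) (by simp)
      (fun y => trace_waveFlux he hξ heξ a b _) x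
  have hsymm : ∀ t ∈ Icc 0 T, ∀ x, (M t x + W t x).IsSymm := fun t ht x =>
    (h.symm t ht x).add (hWs t x)
  have htr : ∀ t ∈ Icc 0 T, ∀ x, (M t x + W t x).trace = 0 := fun t ht x => by
    rw [Matrix.trace_add, h.traceFree t ht x, hWt t x, add_zero]
  refine ⟨h.density, fun t ht => ?_, hsymm, htr, fun i j => ?_, fun φ hφ => ⟨fun i => ?_, ?_⟩,
    h.continuous_momentum.add hVc.continuousOn, h.continuous_flux.add hWc.continuousOn,
    fun t ht x hx => ?_, fun t ht => ?_, fun t ht => ?_, fun t ht x hx => ?_⟩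
  · refine (valueAt_add _ _ ht).trans ?_
    have h1 := toLpAt_perturbation (T := T) hVc hKc (fun t x hx => hVz t x (Or.inr hx)) ⟨t, ht⟩
    rw [← valueAt_eq _ ht] at h1
    filter_upwards [h1, h.momentum t ht] with x hx1 hx2
    rw [hx1, hx2]
  · refine (h.integrable i j).add ?_
    refine Integrable.integrableOn (integrable_of_continuous_of_compact hI hKc
      ((continuous_apply_apply i j).comp hWc) fun y hy => ?_)
    have : W y.1 y.2 = 0 := hWz _ _ (not_and_or.1 hy)
    simp [this]
  · set Φ : ℝ × E d → ℝ := fun y => φ (y.1, π y.2) with hΦ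
    set G : ℝ × E d → ℝ := fun y => waveMomentum e ξ c₁ c₂ y i * dirDeriv (timeDir d) Φ y
      + ∑ j, waveFlux e ξ a b y i j * dirDeriv (spaceDir (EuclideanSpace.single j (1 : ℝ))) Φ y
      with hG
    have hcd := fun u => (hφ.contDiff_dirDeriv u).continuous
    have hGc : Continuous G := by
      refine Continuous.add (Continuous.mul ?_ (hcd _)) (continuous_finsetSum _ fun j _ =>
        Continuous.mul ?_ (hcd _))
      · exact (continuous_coord i).comp
          hw.continuous_waveMomentum
      · exact (continuous_apply_apply i j).comp hw.continuous_waveFlux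
    have hG0 : ∀ y ∉ I ×ˢ K, G y = 0 := fun y hy => by
      simp [hG, hV0 y hy, hW0 y hy]
    have hpt : ∀ t x, V t x i * dt φ t x + ∑ j, W t x i j * dx π j φ t x
        = extendBall π s (fun y => G (t, y)) x := by
      intro t x
      by_cases hx : x ∈ π '' s
      · obtain ⟨y, hy, rfl⟩ := hx
        rw [extendBall_apply hch.1 _ hy, hV, hW, baseField_apply hch.1 _ _ hy,
          baseField_apply hch.1 _ _ hy, dt_eq_dirDeriv hφ]
        simp only [dx_eq_dirDeriv hπ hφ, hG, hΦ]
      · rw [extendBall_eq_zero _ hx, hV, hW, baseField, baseField, extendBall_eq_zero _ hx,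
          extendBall_eq_zero _ hx]
        simp
    have hzero : ∫ t in Ioo 0 T, ∫ x, (V t x i * dt φ t x + ∑ j, W t x i j * dx π j φ t x) = 0 := by
      simp_rw [hpt]
      rw [integral_integral_extendBall hπ hch hI hIT hK hKs hGc hG0]
      exact hw.integral_momentum hI hK hφ.smooth i
    have hint : Integrable (fun y : ℝ × 𝕏 => V y.1 y.2 i * dt φ y.1 y.2
        + ∑ j, W y.1 y.2 i j * dx π j φ y.1 y.2)
        (((volume : Measure ℝ).restrict (Ioo 0 T)).prod (volume : Measure 𝕏)) := by
      have hc2 : Continuous fun y : ℝ × 𝕏 => V y.1 y.2 i * dt φ y.1 y.2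
          + ∑ j, W y.1 y.2 i j * dx π j φ y.1 y.2 := by
        refine Continuous.add (Continuous.mul ?_ ((isLiftedDeriv_dt hφ).continuous hπ hφ))
          (continuous_finsetSum _ fun j _ => Continuous.mul ?_
            ((isLiftedDeriv_dx hπ hφ j).continuous hπ hφ))
        · exact (continuous_coord i).comp hVc
        · exact (continuous_apply_apply i j).comp hWc
      have hi := integrable_of_continuous_of_compact hI hKc hc2 fun y hy => by
        simp [hVz _ _ (not_and_or.1 hy), hWz _ _ (not_and_or.1 hy)]
      rw [prod_volume_eq_restrict]
      exact hi.restrict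
    have hsum := integral_integral_add (h.integrable_momentum_equation hπ hΩ hz hφ i) hint
    rw [hzero, (h.relaxed φ hφ).1 i, add_zero] at hsum
    refine Eq.trans ?_ hsum
    refine integral_congr_ae (Eventually.of_forall fun t => integral_congr_ae
      (Eventually.of_forall fun x => ?_))
    simp only [PiLp.add_apply, Matrix.add_apply, add_mul, Finset.sum_add_distrib]
    ring
  · set Φ : ℝ × E d → ℝ := fun y => φ (y.1, π y.2) with hΦ
    set G : ℝ × E d → ℝ := fun y => ∑ j, waveMomentum e ξ c₁ c₂ y j
      * dirDeriv (spaceDir (EuclideanSpace.single j (1 : ℝ))) Φ y with hG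
    have hcd := fun u => (hφ.contDiff_dirDeriv u).continuous
    have hGc : Continuous G := continuous_finsetSum _ fun j _ => Continuous.mul
      ((continuous_coord j).comp
          hw.continuous_waveMomentum) (hcd _)
    have hG0 : ∀ y ∉ I ×ˢ K, G y = 0 := fun y hy => by
      simp [hG, hV0 y hy]
    have hpt : ∀ t x, ∑ j, V t x j * dx π j φ t x = extendBall π s (fun y => G (t, y)) x := by
      intro t x
      by_cases hx : x ∈ π '' s
      · obtain ⟨y, hy, rfl⟩ := hx
        rw [extendBall_apply hch.1 _ hy, hV, baseField_apply hch.1 _ _ hy]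
        simp only [dx_eq_dirDeriv hπ hφ, hG, hΦ]
      · rw [extendBall_eq_zero _ hx, hV, baseField, extendBall_eq_zero _ hx]
        simp
    have hzero : ∫ t in Ioo 0 T, ∫ x, ∑ j, V t x j * dx π j φ t x = 0 := by
      simp_rw [hpt]
      rw [integral_integral_extendBall hπ hch hI hIT hK hKs hGc hG0]
      exact hw.integral_mass hI hK hφ.smooth
    have hint : Integrable (fun y : ℝ × 𝕏 => ∑ j, V y.1 y.2 j * dx π j φ y.1 y.2)
        (((volume : Measure ℝ).restrict (Ioo 0 T)).prod (volume : Measure 𝕏)) := by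
      have hc2 : Continuous fun y : ℝ × 𝕏 => ∑ j, V y.1 y.2 j * dx π j φ y.1 y.2 :=
        continuous_finsetSum _ fun j _ => Continuous.mul
          ((continuous_coord j).comp hVc)
            ((isLiftedDeriv_dx hπ hφ j).continuous hπ hφ)
      have hi := integrable_of_continuous_of_compact hI hKc hc2 fun y hy => by
        simp [hVz _ _ (not_and_or.1 hy)]
      rw [prod_volume_eq_restrict]
      exact hi.restrict
    have hsum := integral_integral_add (h.integrable_mass_equation hπ hΩ hz hφ) hint
    rw [hzero, (h.relaxed φ hφ).2, add_zero] at hsum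
    refine Eq.trans ?_ hsum
    refine integral_congr_ae (Eventually.of_forall fun t => integral_congr_ae
      (Eventually.of_forall fun x => ?_))
    simp only [PiLp.add_apply, add_mul, Finset.sum_add_distrib]
    ring
  · have hx' : x ∉ π '' K := fun hxK => hx (hKΩ hxK)
    simp only [hVz t x (Or.inr hx'), hWz t x (Or.inr hx'), add_zero]
    exact h.outside t ht x hx
  · have htI : t ∉ I := by
      intro htI
      have := hIT htI
      rcases ht with rfl | ht
      · exact this.1.false
      · rw [mem_singleton_iff.1 ht] at this
        exact this.2.false
    filter_upwards [h.endpoints t ht] with x hx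
    rw [hVz t x (Or.inl htI), add_zero, hx]
  · obtain ⟨C, hC, hCΩ, hC0⟩ := h.compact t ht
    refine ⟨C ∪ π '' K, hC.union hKc, union_subset hCΩ hKΩ, fun x hx => ?_⟩
    rw [hVz t x (Or.inr fun hx' => hx (Or.inr hx')), add_zero]
    exact hC0 x fun hx' => hx (Or.inl hx')
  · by_cases hmem : t ∈ I ∧ x ∈ π '' K
    · obtain ⟨htI, y, hy, rfl⟩ := hmem
      have := h.neZero ht hx
      have htc := Ioo_subset_Icc_self ht
      rw [← isAdmissible_defect_iff (hsymm t htc _) (htr t htc _), hV, hW,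
        baseField_apply hch.1 _ _ (hKs hy), baseField_apply hch.1 _ _ (hKs hy)]
      exact hadm t htI y hy
    · rw [not_and_or] at hmem
      rw [hVz t x hmem, hWz t x hmem, add_zero, add_zero]
      exact h.strict t ht x hx

end AddWave

/-! ### Oscillatory integrals -/

section RiemannLebesgue

variable {Y : Type*} [NormedAddCommGroup Y] [NormedSpace ℝ Y] [FiniteDimensional ℝ Y]
  [MeasurableSpace Y] [BorelSpace Y] {μ : Measure Y} [μ.IsAddHaarMeasure]

/-- The Riemann–Lebesgue lemma along the ray of frequencies `-(N / 2π) • l`; sign and factor match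
the normalisation of the Fourier character. -/
theorem tendsto_integral_cexp_mul {l : Y →L[ℝ] ℝ} (hl : l ≠ 0) (f : Y → ℝ) :
    Tendsto (fun N : ℕ => ∫ y, Complex.exp (((N : ℝ) * l y : ℝ) * Complex.I) * (f y : ℂ) ∂μ)
      atTop (𝓝 0) := by
  have h := tendsto_integral_exp_smul_cocompact (fun y => (f y : ℂ)) μ
  have hw : Tendsto (fun N : ℕ => (-((N : ℝ) / (2 * Real.pi))) • l) atTop
      (cocompact (StrongDual ℝ Y)) := by
    rw [← Metric.cobounded_eq_cocompact, ← tendsto_norm_atTop_iff_cobounded]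
    have hn : ∀ N : ℕ, ‖(-((N : ℝ) / (2 * Real.pi))) • l‖ = (N : ℝ) * (‖l‖ / (2 * Real.pi)) := by
      intro N
      rw [norm_smul, norm_neg, Real.norm_of_nonneg (by positivity)]
      ring
    simp_rw [hn]
    exact tendsto_natCast_atTop_atTop.atTop_mul_const
      (div_pos (norm_pos_iff.2 hl) (by positivity))
  refine (h.comp hw).congr fun N => ?_
  refine integral_congr_ae (Eventually.of_forall fun y => ?_)
  simp only [Circle.smul_def, Real.fourierChar_apply, smul_eq_mul]
  congr 3
  have : (2 : ℝ) * Real.pi ≠ 0 := by positivity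
  simp only [smul_apply, smul_eq_mul]
  congr 1
  field_simp

theorem tendsto_integral_cos_mul {l : Y →L[ℝ] ℝ} (hl : l ≠ 0) {f : Y → ℝ} (hf : Integrable f μ) :
    Tendsto (fun N : ℕ => ∫ y, Real.cos (N * l y) * f y ∂μ) atTop (𝓝 0) ∧
      Tendsto (fun N : ℕ => ∫ y, Real.sin (N * l y) * f y ∂μ) atTop (𝓝 0) := by
  have h := tendsto_integral_cexp_mul (μ := μ) hl f
  have hint : ∀ N : ℕ, Integrable
      (fun y => Complex.exp (((N : ℝ) * l y : ℝ) * Complex.I) * (f y : ℂ)) μ := by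
    intro N
    refine hf.ofReal.bdd_mul (c := 1) ?_ (Eventually.of_forall fun y => ?_)
    · refine Continuous.aestronglyMeasurable ?_
      fun_prop
    · rw [Complex.norm_exp_ofReal_mul_I]
  have hre : ∀ N : ℕ, (∫ y, Complex.exp (((N : ℝ) * l y : ℝ) * Complex.I) * (f y : ℂ) ∂μ).re
      = ∫ y, Real.cos (N * l y) * f y ∂μ := by
    intro N
    rw [← RCLike.re_eq_complex_re, ← integral_re (hint N)]
    refine integral_congr_ae (Eventually.of_forall fun y => ?_)
    simp only [RCLike.re_eq_complex_re, Complex.re_mul_ofReal, Complex.exp_ofReal_mul_I_re]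
  have him : ∀ N : ℕ, (∫ y, Complex.exp (((N : ℝ) * l y : ℝ) * Complex.I) * (f y : ℂ) ∂μ).im
      = ∫ y, Real.sin (N * l y) * f y ∂μ := by
    intro N
    rw [← RCLike.im_eq_complex_im, ← integral_im (hint N)]
    refine integral_congr_ae (Eventually.of_forall fun y => ?_)
    simp only [RCLike.im_eq_complex_im, Complex.im_mul_ofReal, Complex.exp_ofReal_mul_I_im]
  constructor
  · simpa using (((Complex.continuous_re.tendsto _).comp h).congr hre)
  · simpa using (((Complex.continuous_im.tendsto _).comp h).congr him)

end RiemannLebesgue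

/-! ### Sequences of waves -/

section WaveSequences

set_option linter.unusedSectionVars false

variable {d : ℕ}

/-- The phase `ξ · x - κ t`. -/
def phase (ξ : E d) (κ : ℝ) : (ℝ × E d) →L[ℝ] ℝ :=
  (innerSL ℝ ξ).comp (ContinuousLinearMap.snd ℝ ℝ (E d)) - κ • ContinuousLinearMap.fst ℝ ℝ (E d)

theorem phase_apply (ξ : E d) (κ : ℝ) (y : ℝ × E d) :
    phase ξ κ y = inner ℝ ξ y.2 - κ * y.1 := by
  simp [phase]

theorem phase_ne_zero {ξ : E d} (hξ : ‖ξ‖ = 1) (κ : ℝ) : phase ξ κ ≠ 0 := by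
  intro h
  have h1 := phase_apply ξ κ (0, ξ)
  rw [h] at h1
  simp [hξ] at h1

/-- `c₁ ≈ η cos (N (ξ · x - κ t))`, with `η = θ(t) ζ(x)`, and `c₂` is small. -/
structure IsWaveSequence (e ξ : E d) (κ : ℝ) (I : Set ℝ) (K : Set (E d)) (θ : ℝ → ℝ)
    (ζ : E d → ℝ) (C : ℝ) (c₁ c₂ a b : ℕ → ℝ × E d → ℝ) : Prop where
  isWave : ∀ N, IsWave e ξ I K (c₁ N) (c₂ N) (a N) (b N)
  bound : ∀ N, ∀ y : ℝ × E d,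
    |c₁ N y - θ y.1 * ζ y.2 * Real.cos ((N + 1 : ℕ) * phase ξ κ y)| ≤ C / (N + 1 : ℕ) ∧
    |c₂ N y| ≤ C / (N + 1 : ℕ) ∧ |a N y| ≤ C / (N + 1 : ℕ) ∧
    |b N y - κ * (θ y.1 * ζ y.2 * Real.cos ((N + 1 : ℕ) * phase ξ κ y))| ≤ C / (N + 1 : ℕ)

theorem exists_isWaveSequence {e ξ : E d} (hξ : ‖ξ‖ = 1) (heξ : inner ℝ e ξ = (0 : ℝ)) (κ : ℝ)
    {I : Set ℝ} {K : Set (E d)} (hI : IsCompact I) (hK : IsCompact K) {θ : ℝ → ℝ} {ζ : E d → ℝ}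
    (hθ : ContDiff ℝ (⊤ : ℕ∞) θ) (hζ : ContDiff ℝ (⊤ : ℕ∞) ζ) (hθ0 : ∀ t ∉ I, θ t = 0)
    (hζ0 : ∀ y ∉ K, ζ y = 0) :
    ∃ C, 0 ≤ C ∧ ∃ c₁ c₂ a b, IsWaveSequence e ξ κ I K θ ζ C c₁ c₂ a b := by
  set η : ℝ × E d → ℝ := fun y => θ y.1 * ζ y.2 with hη
  have hηs : ContDiff ℝ (⊤ : ℕ∞) η := (hθ.comp contDiff_fst).mul (hζ.comp contDiff_snd)
  have hη0 : ∀ y ∉ I ×ˢ K, η y = 0 := by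
    intro y hy
    rcases not_and_or.1 hy with h | h
    · simp [hη, hθ0 _ h]
    · simp [hη, hζ0 _ h]
  have hηt : tsupport η ⊆ I ×ˢ K := closure_minimal
    (fun y hy => by_contra fun h => hy (hη0 y h)) (hI.prod hK).isClosed
  obtain ⟨C, hC0, hC⟩ := exists_localised_planeWave ![timeDir d, spaceDir e, spaceDir ξ]
    (phase ξ κ) κ (by simp [phase_apply, timeDir])
    (by simp [phase_apply, spaceDir, real_inner_comm, heξ])
    (by simp [phase_apply, spaceDir, hξ]) hηs
    (HasCompactSupport.intro (hI.prod hK) hη0)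
  -- The plane wave lemma requires frequency at least one, hence the shift to `N + 1`.
  choose c₁ c₂ a b h1 h2 h3 h4 h5 using fun N : ℕ => hC ((N + 1 : ℕ) : ℝ) (by simp)
  refine ⟨C, hC0, c₁, c₂, a, b, ⟨fun N => ?_, h5⟩⟩
  have hz : ∀ f ∈ ({c₁ N, c₂ N, a N, b N} : Set (ℝ × E d → ℝ)), ∀ y ∉ I ×ˢ K, f y = 0 :=
    fun f hf y hy => image_eq_zero_of_notMem_tsupport fun h => hy (hηt ((h1 N f hf).2 h))
  exact ⟨(h1 N _ (by simp)).1, (h1 N _ (by simp)).1, (h1 N _ (by simp)).1, (h1 N _ (by simp)).1,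
    fun y hy => ⟨hz _ (by simp) y hy, hz _ (by simp) y hy, hz _ (by simp) y hy,
      hz _ (by simp) y hy⟩, h2 N, h3 N, h4 N⟩

variable {𝕏 : Type} [AddCommGroup 𝕏] [TopologicalSpace 𝕏] [MeasureSpace 𝕏] [T2Space 𝕏]
  [SecondCountableTopology 𝕏] [BorelSpace 𝕏] [IsFiniteMeasureOnCompacts (volume : Measure 𝕏)]
  [SigmaFinite (volume : Measure 𝕏)]

variable {π : E d → 𝕏} {γ T : ℝ} [Fact (1 < γ)] {Ω : Set 𝕏} {z₀ : Quadruple d 𝕏}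
variable {e ξ : E d} {κ : ℝ} {I : Set ℝ} {K : Set (E d)} {θ : ℝ → ℝ} {ζ : E d → ℝ} {C : ℝ}
  {c₁ c₂ a b : ℕ → ℝ × E d → ℝ} {xc : E d} {R : ℝ}

theorem IsWaveSequence.norm_waveMomentum_sub_le (he : ‖e‖ = 1) (hξ : ‖ξ‖ = 1)
    (hW : IsWaveSequence e ξ κ I K θ ζ C c₁ c₂ a b) (N : ℕ) (y : ℝ × E d) :
    ‖waveMomentum e ξ (c₁ N) (c₂ N) y
      - (θ y.1 * ζ y.2 * Real.cos ((N + 1 : ℕ) * phase ξ κ y)) • e‖ ≤ 2 * C / (N + 1 : ℕ) := by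
  obtain ⟨h1, h2, -, -⟩ := hW.bound N y
  have : waveMomentum e ξ (c₁ N) (c₂ N) y
      - (θ y.1 * ζ y.2 * Real.cos ((N + 1 : ℕ) * phase ξ κ y)) • e
      = (c₁ N y - θ y.1 * ζ y.2 * Real.cos ((N + 1 : ℕ) * phase ξ κ y)) • e + c₂ N y • ξ := by
    rw [waveMomentum, sub_smul]
    abel
  rw [this]
  refine (norm_add_le _ _).trans ?_
  rw [norm_smul, norm_smul, he, hξ, mul_one, mul_one, Real.norm_eq_abs, Real.norm_eq_abs, mul_div_assoc]
  linarith

theorem tendsto_const_div_succ (C : ℝ) :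
    Tendsto (fun N : ℕ => C / ((N + 1 : ℕ) : ℝ)) atTop (𝓝 0) :=
  (tendsto_const_div_atTop_nhds_zero_nat C).comp (tendsto_add_atTop_nat 1)

theorem integrable_comp_ball {xc : E d} {R : ℝ}
    (hch : InjOn π (Metric.ball xc R) ∧ MeasurePreserving π (volume.restrict (Metric.ball xc R))
      (volume.restrict (π '' Metric.ball xc R))) {F : Type} [NormedAddCommGroup F]
    {ψ : 𝕏 → F} (hψ : MemLp ψ 2 (volume : Measure 𝕏)) :
    Integrable (fun y => ψ (π y)) (volume.restrict (Metric.ball xc R)) := by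
  have hfin : IsFiniteMeasure ((volume : Measure 𝕏).restrict (π '' Metric.ball xc R)) := by
    have h1 : IsFiniteMeasure ((volume : Measure (E d)).restrict (Metric.ball xc R)) :=
      isFiniteMeasure_restrict.2 measure_ball_lt_top.ne
    rw [← hch.2.map_eq]
    infer_instance
  have h2 : Integrable ψ ((volume : Measure 𝕏).restrict (π '' Metric.ball xc R)) :=
    MemLp.integrable (q := 2) (by norm_num) (hψ.restrict _)
  exact hch.2.integrable_comp_of_integrable h2

/-- The bound `u N` does not depend on `t`, which is what uniform convergence in time demands of
each pairing. -/
theorem tendsto_perturbation_zero {V : ℕ → ℝ → 𝕏 → E d} {K : Set 𝕏}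
    (hV : ∀ N, Continuous fun y : ℝ × 𝕏 => V N y.1 y.2) (hK : IsCompact K)
    (h0 : ∀ N t, ∀ x ∉ K, V N t x = 0)
    (h : ∀ ψ : Lp (E d) 2 (volume : Measure 𝕏), ∃ u : ℕ → ℝ, Tendsto u atTop (𝓝 0) ∧
      ∀ N t, |∫ x, inner ℝ (ψ x) (V N t x)| ≤ u N) :
    Tendsto (fun N => (perturbation (hV N) hK (h0 N) : WeaklyContinuous 𝕏 T (E d) 2)) atTop
      (𝓝 0) := by
  refine tendsto_weaklyContinuous fun l => ?_
  obtain ⟨u, hu, hb⟩ := h ((InnerProductSpace.toDual ℝ _).symm l)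
  rw [tendsto_iff_dist_tendsto_zero]
  refine squeeze_zero (fun _ => dist_nonneg) (fun N => ?_) hu
  rw [ContinuousMap.dist_le ((abs_nonneg _).trans (hb N 0))]
  intro t
  have hz : pairing l (0 : WeaklyContinuous 𝕏 T (E d) 2) t = 0 := l.map_zero
  rw [hz, Real.dist_0_eq_abs, pairing_apply, dual_eq_integral_inner]
  refine le_of_eq_of_le (congrArg abs (integral_congr_ae ?_)) (hb N t)
  filter_upwards [toLpAt_perturbation (T := T) (hV N) hK (h0 N) t] with x hx
  rw [hx]

/-- Fast oscillating waves converge weakly to zero, uniformly in time. -/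
theorem IsWaveSequence.tendsto_addWave (hπ : IsFlatCovering π)
    (hch : InjOn π (Metric.ball xc R) ∧ MeasurePreserving π (volume.restrict (Metric.ball xc R))
      (volume.restrict (π '' Metric.ball xc R))) (hK : IsCompact K) (hKs : K ⊆ Metric.ball xc R)
    (he : ‖e‖ = 1) (hξ : ‖ξ‖ = 1)
    (hW : IsWaveSequence e ξ κ I K θ ζ C c₁ c₂ a b) (hζ : Continuous ζ) {L : ℝ}
    (hL : ∀ t, |θ t| ≤ L) (hζ1 : ∀ y, |ζ y| ≤ 1)
    (w : StateSpace d 𝕏 γ T) :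
    Tendsto (fun N => addWave hπ hch.1 hK hKs (hW.isWave N) w) atTop (𝓝 w) := by
  have hL0 : 0 ≤ L := (abs_nonneg _).trans (hL 0)
  refine Tendsto.prodMk_nhds tendsto_const_nhds ?_
  rw [show 𝓝 w.2 = 𝓝 (w.2 + 0) by rw [add_zero]]
  refine tendsto_const_nhds.add (tendsto_perturbation_zero _ _ _ fun ψ => ?_)
  set B := Metric.ball xc R with hB
  have hg : Integrable (fun y => ψ (π y)) (volume.restrict B) :=
    integrable_comp_ball hch (Lp.memLp ψ)
  -- This spatial profile is independent of time, so a single application of Riemann–Lebesgue in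
  -- space serves all times at once.
  set F : E d → ℝ := B.indicator fun y => ζ y * inner ℝ (ψ (π y)) e with hF
  have hFi : Integrable F := by
    rw [hF, integrable_indicator_iff measurableSet_ball, IntegrableOn]
    refine (hg.inner_const e).bdd_mul (c := 1) hζ.aestronglyMeasurable
      (Eventually.of_forall fun y => hζ1 y)
  have hlin : innerSL ℝ ξ ≠ 0 := by
    intro h0
    have : innerSL ℝ ξ ξ = 0 := by rw [h0]; rfl
    simp [hξ] at this
  obtain ⟨hA, hS⟩ := tendsto_integral_cos_mul (μ := volume) hlin hFi
  replace hA := hA.comp (tendsto_add_atTop_nat 1)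
  replace hS := hS.comp (tendsto_add_atTop_nat 1)
  set P := ∫ y in B, ‖ψ (π y)‖ with hP
  have hlim : Tendsto (fun N : ℕ => L * (|∫ y, Real.cos ((N + 1 : ℕ) * innerSL ℝ ξ y) * F y|
      + |∫ y, Real.sin ((N + 1 : ℕ) * innerSL ℝ ξ y) * F y|) + 2 * C / (N + 1 : ℕ) * P) atTop
      (𝓝 0) := by
    have h1 := ((hA.abs.add hS.abs).const_mul L).add ((tendsto_const_div_succ (2 * C)).mul_const P)
    simpa using h1
  refine ⟨_, hlim, fun N t => ?_⟩
  have hV0 : ∀ y ∉ I ×ˢ K, waveMomentum e ξ (c₁ N) (c₂ N) y = 0 :=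
    fun _ hy => (hW.isWave N).waveMomentum_eq_zero hy
  set V := baseField π B (waveMomentum e ξ (c₁ N) (c₂ N)) with hV
  have hVc : Continuous fun y : ℝ × 𝕏 => V y.1 y.2 :=
    continuous_baseField hπ hch.1 hK hKs (hW.isWave N).continuous_waveMomentum hV0
  have e2 : ∫ x, inner ℝ (ψ x) (V t x)
      = ∫ y in B, inner ℝ (ψ (π y)) (waveMomentum e ξ (c₁ N) (c₂ N) (t, y)) := by
    rw [integral_eq_setIntegral_ball hπ hch le_rfl]
    · refine setIntegral_congr_fun measurableSet_ball fun y hy => ?_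
      exact congrArg (inner ℝ (ψ (π y))) (baseField_apply hch.1 _ t hy)
    · exact (Lp.aestronglyMeasurable ψ).restrict.inner
        (hVc.comp (Continuous.prodMk_right (t : ℝ))).aestronglyMeasurable
    · intro x hx
      rw [hV, baseField, extendBall_eq_zero _ hx, inner_zero_right]
  refine (congrArg abs e2).trans_le ?_
  set n : ℝ := ((N + 1 : ℕ) : ℝ) with hn
  set W := fun y => waveMomentum e ξ (c₁ N) (c₂ N) ((t : ℝ), y) with hWd
  have hWc : Continuous W := (hW.isWave N).continuous_waveMomentum.comp (Continuous.prodMk_right _)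
  set η := fun y => θ t * ζ y * Real.cos (n * phase ξ κ ((t : ℝ), y)) with hη
  have hdiff : ∀ y, ‖W y - η y • e‖ ≤ 2 * C / n := fun y =>
    hW.norm_waveMomentum_sub_le he hξ N (t, y)
  have hηc : Continuous η :=
    (continuous_const.mul hζ).mul (Real.continuous_cos.comp (continuous_const.mul
      ((phase ξ κ).continuous.comp (Continuous.prodMk_right (t : ℝ)))))
  have hηb : ∀ y, |η y| ≤ L := by
    intro y
    rw [hη, abs_mul, abs_mul]
    calc |θ t| * |ζ y| * |Real.cos (n * phase ξ κ ((t : ℝ), y))| ≤ L * 1 * 1 := by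
          gcongr
          · exact hL t
          · exact hζ1 y
          · exact Real.abs_cos_le_one _
      _ = L := by ring
  have i1 : Integrable (fun y => inner ℝ (ψ (π y)) (W y - η y • e)) (volume.restrict B) := by
    refine (hg.norm.mul_const (2 * C / n)).mono'
      (hg.aestronglyMeasurable.inner (hWc.sub (hηc.smul continuous_const)).aestronglyMeasurable)
      (Eventually.of_forall fun y => ?_)
    exact (norm_inner_le_norm _ _).trans (mul_le_mul_of_nonneg_left (hdiff y) (norm_nonneg _))
  have i2 : Integrable (fun y => η y * inner ℝ (ψ (π y)) e) (volume.restrict B) :=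
    (hg.inner_const e).bdd_mul (c := L) hηc.aestronglyMeasurable (Eventually.of_forall hηb)
  have e3 : ∫ y in B, inner ℝ (ψ (π y)) (W y) = (∫ y in B, inner ℝ (ψ (π y)) (W y - η y • e))
      + ∫ y in B, η y * inner ℝ (ψ (π y)) e := by
    rw [← integral_add i1 i2]
    refine integral_congr_ae (Eventually.of_forall fun y => ?_)
    simp only [inner_sub_right, real_inner_smul_right]
    ring
  have b1 : |∫ y in B, inner ℝ (ψ (π y)) (W y - η y • e)| ≤ 2 * C / n * P := by
    rw [← Real.norm_eq_abs]
    refine (norm_integral_le_of_norm_le (hg.norm.mul_const (2 * C / n))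
      (Eventually.of_forall fun y => ?_)).trans_eq ?_
    · exact (norm_inner_le_norm _ _).trans (mul_le_mul_of_nonneg_left (hdiff y) (norm_nonneg _))
    · rw [integral_mul_const, mul_comm]
  have j1 : Integrable fun y => Real.cos (n * innerSL ℝ ξ y) * F y :=
    hFi.bdd_mul (c := 1) (Continuous.aestronglyMeasurable (by fun_prop))
      (Eventually.of_forall fun y => Real.abs_cos_le_one _)
  have j2 : Integrable fun y => Real.sin (n * innerSL ℝ ξ y) * F y :=
    hFi.bdd_mul (c := 1) (Continuous.aestronglyMeasurable (by fun_prop))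
      (Eventually.of_forall fun y => Real.abs_sin_le_one _)
  -- The addition formula for the cosine of N(ξ·y - κt) moves the time dependence into the bounded
  -- factors cos(Nκt) and sin(Nκt). Only oscillatory integrals in space remain.
  have e4 : ∫ y in B, η y * inner ℝ (ψ (π y)) e
      = θ t * (Real.cos (n * (κ * t)) * ∫ y, Real.cos (n * innerSL ℝ ξ y) * F y)
        + θ t * (Real.sin (n * (κ * t)) * ∫ y, Real.sin (n * innerSL ℝ ξ y) * F y) := by
    rw [← integral_const_mul, ← integral_const_mul, ← integral_const_mul, ← integral_const_mul,
      ← integral_add ((j1.const_mul _).const_mul _) ((j2.const_mul _).const_mul _),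
      ← integral_indicator measurableSet_ball]
    refine integral_congr_ae (Eventually.of_forall fun y => ?_)
    simp only [hF]
    by_cases hy : y ∈ B
    · rw [indicator_of_mem hy, indicator_of_mem hy]
      simp only [hη, phase_apply]
      rw [mul_sub, Real.cos_sub]
      simp only [innerSL_apply_apply]
      ring
    · rw [indicator_of_notMem hy, indicator_of_notMem hy]
      ring
  have b2 : |∫ y in B, η y * inner ℝ (ψ (π y)) e|
      ≤ L * (|∫ y, Real.cos (n * innerSL ℝ ξ y) * F y|
        + |∫ y, Real.sin (n * innerSL ℝ ξ y) * F y|) := by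
    rw [e4, mul_add]
    refine (abs_add_le _ _).trans (add_le_add ?_ ?_)
    · rw [abs_mul, abs_mul]
      refine mul_le_mul (hL t) ?_ (by positivity) hL0
      exact mul_le_of_le_one_left (abs_nonneg _) (Real.abs_cos_le_one _)
    · rw [abs_mul, abs_mul]
      refine mul_le_mul (hL t) ?_ (by positivity) hL0
      exact mul_le_of_le_one_left (abs_nonneg _) (Real.abs_sin_le_one _)
  show |∫ y in B, inner ℝ (ψ (π y)) (W y)| ≤ _
  rw [e3]
  refine (abs_add_le _ _).trans ?_
  linarith

/-- The energy gained by adding fast oscillating waves. -/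
theorem IsWaveSequence.tendsto_energy (he : ‖e‖ = 1) (hξ : ‖ξ‖ = 1)
    (hW : IsWaveSequence e ξ κ I K θ ζ C c₁ c₂ a b) (hθ : Continuous θ) (hζ : Continuous ζ) {L : ℝ}
    (hL : ∀ t, |θ t| ≤ L) (hζ1 : ∀ y, |ζ y| ≤ 1) {D : Set (ℝ × E d)} (hD : MeasurableSet D)
    (hDfin : volume D ≠ ∞) {r : ℝ × E d → ℝ} {p : ℝ × E d → E d} {B : ℝ}
    (hr : AEStronglyMeasurable r (volume.restrict D))
    (hp : AEStronglyMeasurable p (volume.restrict D)) (hrB : ∀ y ∈ D, |r y| ≤ B)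
    (hpB : ∀ y ∈ D, ‖p y‖ ≤ B) :
    Tendsto (fun N => ∫ y in D, r y * (2 * inner ℝ (p y) (waveMomentum e ξ (c₁ N) (c₂ N) y)
      + ‖waveMomentum e ξ (c₁ N) (c₂ N) y‖ ^ 2)) atTop
      (𝓝 (∫ y in D, r y * (θ y.1 * ζ y.2) ^ 2 / 2)) := by
  rcases D.eq_empty_or_nonempty with rfl | ⟨y0, hy0⟩
  · simp
  have hB0 : 0 ≤ B := (abs_nonneg _).trans (hrB y0 hy0)
  have hL0 : 0 ≤ L := (abs_nonneg _).trans (hL 0)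
  have hC0 : 0 ≤ C := by
    have := (abs_nonneg _).trans (hW.bound 0 0).2.1
    simpa using this
  have : IsFiniteMeasure (volume.restrict D) := isFiniteMeasure_restrict.2 hDfin
  set η : ℝ × E d → ℝ := fun y => θ y.1 * ζ y.2 with hη
  have hηc : Continuous η := (hθ.comp continuous_fst).mul (hζ.comp continuous_snd)
  have hηL : ∀ y, |η y| ≤ L := fun y => by
    rw [hη, abs_mul]
    exact (mul_le_mul (hL _) (hζ1 _) (abs_nonneg _) hL0).trans_eq (mul_one L)
  have hbdd : ∀ {f : ℝ × E d → ℝ} (A : ℝ), AEStronglyMeasurable f (volume.restrict D) →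
      (∀ y ∈ D, |f y| ≤ A) → Integrable f (volume.restrict D) := fun A hf hA =>
    Integrable.of_bound hf A ((ae_restrict_mem hD).mono fun y hy => hA y hy)
  set F1 : ℝ × E d → ℝ := fun y => r y * (2 * η y * inner ℝ (p y) e) with hF1
  set F2 : ℝ × E d → ℝ := fun y => r y * η y ^ 2 / 2 with hF2
  have hpe : ∀ y ∈ D, |inner ℝ (p y) e| ≤ B := fun y hy => by
    refine (abs_real_inner_le_norm _ _).trans ?_
    rw [he, mul_one]
    exact hpB y hy
  have i1 : Integrable F1 (volume.restrict D) := by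
    refine hbdd (B * (2 * L * B)) (hr.mul ((continuous_const.mul hηc).aestronglyMeasurable.mul
      (hp.inner aestronglyMeasurable_const))) fun y hy => ?_
    rw [hF1, abs_mul, abs_mul, abs_mul, abs_two]
    gcongr
    · exact hrB y hy
    · exact hηL y
    · exact hpe y hy
  have i2 : Integrable F2 (volume.restrict D) := by
    refine hbdd (B * L ^ 2 / 2) (((hr.mul (hηc.pow 2).aestronglyMeasurable).mul_const (2⁻¹)).congr
      (Eventually.of_forall fun y => (div_eq_mul_inv _ _).symm))
      fun y hy => ?_
    rw [hF2, abs_div, abs_mul, abs_two, abs_pow]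
    gcongr
    · exact hrB y hy
    · exact hηL y
  have hosc : ∀ F : ℝ × E d → ℝ, Integrable F (volume.restrict D) →
      Tendsto (fun N : ℕ => ∫ y in D, Real.cos (N * phase ξ κ y) * F y) atTop (𝓝 0) := by
    intro F hF
    refine ((tendsto_integral_cos_mul (μ := volume) (phase_ne_zero hξ κ)
      ((integrable_indicator_iff hD).2 hF)).1).congr fun N => ?_
    rw [← integral_indicator hD]
    refine integral_congr_ae (Eventually.of_forall fun y => ?_)
    simp only [indicator]
    split_ifs <;> simp
  have o1 := (hosc F1 i1).comp (tendsto_add_atTop_nat 1)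
  have o2 : Tendsto (fun N : ℕ => ∫ y in D, Real.cos (((2 * (N + 1) : ℕ) : ℝ) * phase ξ κ y) * F2 y)
      atTop (𝓝 0) := (hosc F2 i2).comp
        (tendsto_atTop_mono (fun N => by show N ≤ 2 * (N + 1); omega) tendsto_id : Tendsto (fun N => 2 * (N + 1)) atTop atTop)
  set A := B * (2 * C) * (2 * B + 2 * C + 2 * L) with hA
  have o3 := (tendsto_const_div_succ A).mul_const (volume.real D)
  have hmain : Tendsto (fun N : ℕ => (∫ y in D, Real.cos ((N + 1 : ℕ) * phase ξ κ y) * F1 y)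
      + (∫ y in D, Real.cos (((2 * (N + 1) : ℕ) : ℝ) * phase ξ κ y) * F2 y) + ∫ y in D, F2 y) atTop
      (𝓝 (∫ y in D, F2 y)) := by
    simpa using (o1.add o2).add_const (∫ y in D, F2 y)
  refine tendsto_of_tendsto_of_dist hmain ?_
  rw [zero_mul] at o3
  refine squeeze_zero (fun _ => dist_nonneg) (fun N => ?_) o3
  set n : ℝ := ((N + 1 : ℕ) : ℝ) with hn
  have hn1 : 1 ≤ n := by simp [hn]
  set W := waveMomentum e ξ (c₁ N) (c₂ N) with hWd
  have hWc : Continuous W := (hW.isWave N).continuous_waveMomentum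
  set v : ℝ × E d → E d := fun y => (η y * Real.cos (n * phase ξ κ y)) • e with hv
  have hcosc : Continuous fun y => Real.cos (n * phase ξ κ y) :=
    Real.continuous_cos.comp (continuous_const.mul (phase ξ κ).continuous)
  have hvc : Continuous v := (hηc.mul hcosc).smul continuous_const
  have hdiff : ∀ y, ‖W y - v y‖ ≤ 2 * C / n := fun y => hW.norm_waveMomentum_sub_le he hξ N y
  have hvL : ∀ y, ‖v y‖ ≤ L := fun y => by
    rw [hv, norm_smul, he, mul_one, Real.norm_eq_abs, abs_mul]
    exact (mul_le_mul (hηL _) (Real.abs_cos_le_one _) (abs_nonneg _) hL0).trans_eq (mul_one L)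
  have hWL : ∀ y, ‖W y‖ ≤ 2 * C + L := fun y => by
    have h1 : ‖W y‖ ≤ ‖W y - v y‖ + ‖v y‖ := by
      simpa using norm_add_le (W y - v y) (v y)
    have h2 : 2 * C / n ≤ 2 * C := div_le_self (by positivity) hn1
    linarith [hdiff y, hvL y]
  have k1 : Integrable (fun y => r y * (2 * inner ℝ (p y) (W y) + ‖W y‖ ^ 2))
      (volume.restrict D) := by
    refine hbdd (B * (2 * (B * (2 * C + L)) + (2 * C + L) ^ 2)) (hr.mul
      ((aestronglyMeasurable_const.mul (hp.inner hWc.aestronglyMeasurable)).add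
        (hWc.norm.pow 2).aestronglyMeasurable)) fun y hy => ?_
    rw [abs_mul]
    refine mul_le_mul (hrB y hy) ((abs_add_le _ _).trans (add_le_add ?_ ?_)) (abs_nonneg _) hB0
    · rw [abs_mul, abs_two]
      have := (abs_real_inner_le_norm (p y) (W y)).trans
        (mul_le_mul (hpB y hy) (hWL y) (norm_nonneg _) hB0)
      linarith
    · rw [abs_pow, abs_norm]
      exact pow_le_pow_left₀ (norm_nonneg _) (hWL y) 2
  have k2 : Integrable (fun y => r y * (2 * inner ℝ (p y) (v y) + ‖v y‖ ^ 2))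
      (volume.restrict D) := by
    refine hbdd (B * (2 * (B * L) + L ^ 2)) (hr.mul
      ((aestronglyMeasurable_const.mul (hp.inner hvc.aestronglyMeasurable)).add
        (hvc.norm.pow 2).aestronglyMeasurable)) fun y hy => ?_
    rw [abs_mul]
    refine mul_le_mul (hrB y hy) ((abs_add_le _ _).trans (add_le_add ?_ ?_)) (abs_nonneg _) hB0
    · rw [abs_mul, abs_two]
      have := (abs_real_inner_le_norm (p y) (v y)).trans
        (mul_le_mul (hpB y hy) (hvL y) (norm_nonneg _) hB0)
      linarith
    · rw [abs_pow, abs_norm]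
      exact pow_le_pow_left₀ (norm_nonneg _) (hvL y) 2
  have hcb : ∀ s : ℝ, AEStronglyMeasurable (fun y => Real.cos (s * phase ξ κ y))
      (volume.restrict D) := fun s =>
    (Real.continuous_cos.comp (continuous_const.mul (phase ξ κ).continuous)).aestronglyMeasurable
  have m1 : Integrable (fun y => Real.cos (n * phase ξ κ y) * F1 y) (volume.restrict D) :=
    i1.bdd_mul (c := 1) (hcb n) (Eventually.of_forall fun y => Real.abs_cos_le_one _)
  have m2 : Integrable (fun y => Real.cos (((2 * (N + 1) : ℕ) : ℝ) * phase ξ κ y) * F2 y)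
      (volume.restrict D) :=
    i2.bdd_mul (c := 1) (hcb _) (Eventually.of_forall fun y => Real.abs_cos_le_one _)
  have e2 : (∫ y in D, Real.cos (n * phase ξ κ y) * F1 y)
      + (∫ y in D, Real.cos (((2 * (N + 1) : ℕ) : ℝ) * phase ξ κ y) * F2 y) + ∫ y in D, F2 y
      = ∫ y in D, r y * (2 * inner ℝ (p y) (v y) + ‖v y‖ ^ 2) := by
    rw [← integral_add_add m1 m2 i2]
    refine integral_congr_ae (Eventually.of_forall fun y => ?_)
    -- Since cos² = (1 + cos 2·)/2, the quadratic term contributes its mean `F2` together with an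
    -- oscillation of doubled frequency.
    have hc2 : Real.cos (((2 * (N + 1) : ℕ) : ℝ) * phase ξ κ y)
        = 2 * Real.cos (n * phase ξ κ y) ^ 2 - 1 := by
      rw [← Real.cos_two_mul, hn]
      congr 1
      push_cast
      ring
    simp only [hc2, hF1, hF2, hv, norm_smul, he, real_inner_smul_right, mul_one,
      Real.norm_eq_abs, sq_abs]
    ring
  rw [e2, dist_eq_norm, ← integral_sub k2 k1]
  refine (norm_setIntegral_le_of_norm_le_const hDfin.lt_top fun y hy => ?_)
  -- The difference of two values of the quadratic map x ↦ 2⟨p, x⟩ + |x|² factors through `W - v`,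
  -- which is of order 1/N.
  have e3 : r y * (2 * inner ℝ (p y) (v y) + ‖v y‖ ^ 2)
      - r y * (2 * inner ℝ (p y) (W y) + ‖W y‖ ^ 2)
      = -(r y * inner ℝ (2 • p y + W y + v y) (W y - v y)) := by
    rw [← real_inner_self_eq_norm_sq, ← real_inner_self_eq_norm_sq]
    simp only [inner_add_left, inner_sub_right, two_smul]
    rw [real_inner_comm (W y) (v y)]
    ring
  rw [e3, norm_neg, norm_mul]
  have h4 : ‖2 • p y + W y + v y‖ ≤ 2 * B + 2 * C + 2 * L := by
    refine (norm_add₃_le).trans ?_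
    have : ‖2 • p y‖ ≤ 2 * B := by
      rw [two_smul, two_mul]
      exact (norm_add_le _ _).trans (add_le_add (hpB y hy) (hpB y hy))
    linarith [hWL y, hvL y]
  calc ‖r y‖ * ‖inner ℝ (2 • p y + W y + v y) (W y - v y)‖
      ≤ B * ((2 * B + 2 * C + 2 * L) * (2 * C / n)) := by
        refine mul_le_mul (hrB y hy) ((norm_inner_le_norm _ _).trans
          (mul_le_mul h4 (hdiff y) (norm_nonneg _) (by positivity))) (norm_nonneg _) hB0
    _ = A / n := by rw [hA]; ring

end WaveSequences

/-! ### Directions of oscillation -/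

section Directions

variable {d : ℕ}

/-- If `v` is not parallel to `e`, normalise its component orthogonal to `e`. Otherwise `κ = 0` and
any unit vector orthogonal to `e` will do; one exists because `d ≥ 2`. -/
theorem exists_unit_orthogonal (hd : 2 ≤ d) {e : E d} (he : ‖e‖ = 1) (v : E d) :
    ∃ (ξ : E d) (κ : ℝ), ‖ξ‖ = 1 ∧ inner ℝ e ξ = (0 : ℝ) ∧
      v = (inner ℝ e v : ℝ) • e + κ • ξ := by
  by_cases hv : v - (inner ℝ e v : ℝ) • e = 0
  · have hne : (Submodule.span ℝ {e})ᗮ ≠ ⊥ := by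
      intro h
      have h1 := Submodule.orthogonal_eq_bot_iff.1 h
      have h2 : Module.finrank ℝ (Submodule.span ℝ {e}) = 1 :=
        finrank_span_singleton (norm_ne_zero_iff.1 (by rw [he]; exact one_ne_zero))
      rw [h1, finrank_top, finrank_euclideanSpace_fin] at h2
      omega
    obtain ⟨u, hu, hu0⟩ := Submodule.exists_mem_ne_zero_of_ne_bot hne
    refine ⟨‖u‖⁻¹ • u, 0, norm_smul_inv_norm hu0, ?_, ?_⟩
    · rw [real_inner_smul_right, Submodule.mem_orthogonal_singleton_iff_inner_right.1 hu, mul_zero]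
    · rw [zero_smul, add_zero]
      exact sub_eq_zero.1 hv
  · refine ⟨‖v - (inner ℝ e v : ℝ) • e‖⁻¹ • (v - (inner ℝ e v : ℝ) • e),
      ‖v - (inner ℝ e v : ℝ) • e‖, norm_smul_inv_norm hv, ?_, ?_⟩
    · rw [real_inner_smul_right, inner_sub_right, real_inner_smul_right,
        real_inner_self_eq_norm_sq, he]
      ring
    · rw [smul_inv_smul₀ (norm_ne_zero_iff.2 hv)]
      abel

/-- The cross terms (a ⊗ e + e ⊗ a)/r consist of a multiple of e ⊗ e and of κ (e ⊗ ξ + ξ ⊗ e). The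
change of the flux is chosen to cancel the second part. -/
theorem defect_add_wave {q r κ : ℝ} (hr : r ≠ 0) {a e ξ : E d} {B : Matrix (Fin d) (Fin d) ℝ}
    (ha : a = (inner ℝ e a : ℝ) • e + (r * κ) • ξ) (σ : ℝ) :
    defect q r (a + σ • e) (B + (κ * σ) • symProd e ξ) =
      defect q r a B + (-(2 * σ * inner ℝ e a + σ ^ 2) / r) • tensorSq e := by
  set μ : ℝ := inner ℝ e a with hμ
  have hc : ∀ i, a i = μ * e i + r * κ * ξ i := fun i => by
    have := congrArg (fun v : E d => v i) ha
    simpa using this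
  ext i j
  have hi := hc i
  have hj := hc j
  simp only [defect, tensorSq, symProd, Matrix.sub_apply, Matrix.add_apply, Matrix.smul_apply,
    Matrix.of_apply, smul_eq_mul, PiLp.add_apply, PiLp.smul_apply]
  rw [hi, hj]
  field_simp
  ring

/-- Every 1 × 1 matrix is a multiple of the identity, so there are no strict subsolutions to perturb
in dimension one. -/
theorem two_le_of_isAdmissible [NeZero d] {P : Matrix (Fin d) (Fin d) ℝ} (h : IsAdmissible P) :
    2 ≤ d := by
  have h0 := NeZero.pos d
  by_contra hd
  obtain rfl : d = 1 := by omega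
  refine h.2 (P 0 0) ?_
  ext i j
  rw [Subsingleton.elim i 0, Subsingleton.elim j 0]
  simp

/-- The admissible amplitude is proportional to the gap `g`, the trace of the defect divided by `d`,
with a factor depending only on `K`. This proportionality turns into an energy gain quadratic in the
gap. -/
theorem exists_wave_direction [NeZero d] {q r K : ℝ} {a : E d} {B : Matrix (Fin d) (Fin d) ℝ}
    (hr : 0 < r) (hrK : r⁻¹ ≤ K) (haK : ‖a‖ ≤ K) (hqK : q ≤ K) (hB : B.IsSymm)
    (htr : B.trace = 0) (hadm : IsAdmissible (defect q r a B)) :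
    0 < q - ‖a‖ ^ 2 / (d * r) ∧ ∃ (e ξ : E d) (κ : ℝ), ‖e‖ = 1 ∧ ‖ξ‖ = 1 ∧
      inner ℝ e ξ = (0 : ℝ) ∧ ∀ σ : ℝ,
        |σ| ≤ 1 / (8 * (K + 1) ^ 2) * (q - ‖a‖ ^ 2 / (d * r)) →
        IsAdmissible (defect q r (a + σ • e) (B + (κ * σ) • symProd e ξ)) := by
  have hd : (0 : ℝ) < d := Nat.cast_pos.2 (NeZero.pos d)
  set g := q - ‖a‖ ^ 2 / (d * r) with hg
  obtain ⟨hP, hns⟩ := (isAdmissible_iff_posDef (isHermitian_defect hB)).1 hadm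
  have htrace : (defect q r a B).trace = d * g := by
    rw [trace_defect htr, hg]
    field_simp
  have hK : 0 < K := (inv_pos.2 hr).trans_le hrK
  have hgpos : 0 < g := by
    have : Nonempty (Fin d) := ⟨0⟩
    have h := hP.trace_pos
    rw [htrace] at h
    exact pos_of_mul_pos_right h hd.le
  have hgK : g ≤ K := by
    have : 0 ≤ ‖a‖ ^ 2 / (d * r) := by positivity
    linarith
  refine ⟨hgpos, ?_⟩
  obtain ⟨e, he, hadd⟩ := exists_unit_posDef_add_smul_tensorSq hP hns htrace
  obtain ⟨ξ, κ', hξ, heξ, hdec⟩ := exists_unit_orthogonal (two_le_of_isAdmissible hadm) he a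
  refine ⟨e, ξ, κ' / r, he, hξ, heξ, fun σ hσ => ?_⟩
  have hdec' : a = (inner ℝ e a : ℝ) • e + (r * (κ' / r)) • ξ := by
    rw [mul_div_cancel₀ _ hr.ne']
    exact hdec
  have hsym : (B + (κ' / r * σ) • symProd e ξ).IsSymm := hB.add ((isSymm_symProd e ξ).smul _)
  rw [isAdmissible_iff_posDef (isHermitian_defect hsym), defect_add_wave hr.ne' hdec']
  refine hadd _ ?_
  set c := 1 / (8 * (K + 1) ^ 2) with hc
  have hc0 : 0 < c := by positivity
  have hcK : c * (8 * (K + 1) ^ 2) = 1 := by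
    rw [hc]
    field_simp
  have hμ : |inner ℝ e a| ≤ K := by
    refine (abs_real_inner_le_norm e a).trans ?_
    rw [he, one_mul]
    exact haK
  have h1 : 2 * σ * inner ℝ e a + σ ^ 2 ≤ 2 * (c * g) * K + (c * g) ^ 2 := by
    refine add_le_add ?_ ?_
    · refine (le_abs_self _).trans ?_
      rw [abs_mul, abs_mul, abs_two]
      exact mul_le_mul (mul_le_mul_of_nonneg_left hσ zero_le_two) hμ (abs_nonneg _) (by positivity)
    · rw [← sq_abs]
      exact pow_le_pow_left₀ (abs_nonneg _) hσ 2
  -- This fixes the constant in `c`: using `c * g ≤ K`, the left side is at most `3 * K ^ 2 * c *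
  -- g`, which is at most `3 / 8 * g`.
  have h2 : (2 * (c * g) * K + (c * g) ^ 2) * K ≤ g / 2 := by
    have hc1 : c ≤ 1 := by nlinarith
    have h3 : c * g ≤ K := by nlinarith
    have h4 : (2 * (c * g) * K + (c * g) ^ 2) * K ≤ (c * g) * (3 * K ^ 2) := by
      have : (c * g) ^ 2 ≤ c * g * K := by nlinarith [mul_pos hc0 hgpos]
      nlinarith
    nlinarith [mul_pos hc0 hgpos]
  rw [neg_div, neg_le_neg_iff, div_eq_mul_inv]
  refine le_trans ?_ h2
  exact mul_le_mul h1 hrK (inv_pos.2 hr).le (by positivity)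

theorem continuous_tensorSq : Continuous (tensorSq : E d → Matrix (Fin d) (Fin d) ℝ) :=
  continuous_matrix fun i j => (continuous_coord i).mul (continuous_coord j)

/-- Admissibility is open and the set of amplitudes is compact, so `δ` and the neighbourhood can be
chosen uniformly in `σ`. The parameters `p₁, …, p₄` leave room for the O(1/N) errors of the
localised waves, and nearness of `y` to `y₀` for the variation of the coefficients. -/
theorem exists_eventually_isAdmissible {Y : Type*} [TopologicalSpace Y] {q r : Y → ℝ} {a : Y → E d}
    {B : Y → Matrix (Fin d) (Fin d) ℝ} {y₀ : Y} (hq : ContinuousAt q y₀) (hr : ContinuousAt r y₀)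
    (hr0 : r y₀ ≠ 0) (ha : ContinuousAt a y₀) (hB : ContinuousAt B y₀) {e ξ : E d} {κ : ℝ}
    {S : Set ℝ} (hS : IsCompact S)
    (hadm : ∀ σ ∈ S, IsAdmissible (defect (q y₀) (r y₀) (a y₀ + σ • e)
      (B y₀ + (κ * σ) • symProd e ξ))) :
    ∃ δ > 0, ∀ᶠ y in 𝓝 y₀, ∀ σ ∈ S, ∀ p₁ p₂ p₃ p₄ : ℝ, |p₁ - σ| < δ → |p₂| < δ → |p₃| < δ →
      |p₄ - κ * σ| < δ → IsAdmissible (defect (q y) (r y) (a y + (p₁ • e + p₂ • ξ))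
        (B y + (p₃ • (tensorSq e - tensorSq ξ) + p₄ • symProd e ξ))) := by
  have h := hS.eventually_forall_of_forall_eventually (x₀ := (y₀, ((0, 0, 0, 0) : ℝ × ℝ × ℝ × ℝ)))
    (P := fun (z : Y × ℝ × ℝ × ℝ × ℝ) σ => IsAdmissible (defect (q z.1) (r z.1)
      (a z.1 + ((σ + z.2.1) • e + z.2.2.1 • ξ))
      (B z.1 + (z.2.2.2.1 • (tensorSq e - tensorSq ξ)
        + (κ * σ + z.2.2.2.2) • symProd e ξ)))) fun σ hσ => by
    have h1 : Tendsto (fun z : (Y × ℝ × ℝ × ℝ × ℝ) × ℝ => z.1.1)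
        (𝓝 ((y₀, ((0, 0, 0, 0) : ℝ × ℝ × ℝ × ℝ)), σ)) (𝓝 y₀) :=
      (continuous_fst.comp continuous_fst).tendsto' _ _ rfl
    refine ContinuousAt.eventually_mem (f := fun z : (Y × ℝ × ℝ × ℝ × ℝ) × ℝ =>
      defect (q z.1.1) (r z.1.1) (a z.1.1 + ((z.2 + z.1.2.1) • e + z.1.2.2.1 • ξ))
      (B z.1.1 + (z.1.2.2.2.1 • (tensorSq e - tensorSq ξ)
        + (κ * z.2 + z.1.2.2.2.2) • symProd e ξ))) (s := {P | IsAdmissible P}) ?_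
      (isOpen_setOf_isAdmissible.mem_nhds ?_)
    · have hm : ContinuousAt (fun z : (Y × ℝ × ℝ × ℝ × ℝ) × ℝ =>
          a z.1.1 + ((z.2 + z.1.2.1) • e + z.1.2.2.1 • ξ))
          ((y₀, ((0, 0, 0, 0) : ℝ × ℝ × ℝ × ℝ)), σ) :=
        (ha.tendsto.comp h1).add (Continuous.continuousAt (by fun_prop))
      refine ContinuousAt.sub ((hq.tendsto.comp h1).smul continuousAt_const) (ContinuousAt.sub ?_ ?_)
      · exact ((hr.inv₀ hr0).tendsto.comp h1).smul (continuous_tensorSq.continuousAt.comp hm)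
      · exact (hB.tendsto.comp h1).add (Continuous.continuousAt (by fun_prop))
    · simpa using hadm σ hσ
  rw [nhds_prod_eq, eventually_prod_iff] at h
  obtain ⟨pa, hpa, pb, hpb, hab⟩ := h
  obtain ⟨δ, hδ, hball⟩ := Metric.eventually_nhds_iff.1 hpb
  refine ⟨δ, hδ, hpa.mono fun y hy σ hσ p₁ p₂ p₃ p₄ h1 h2 h3 h4 => ?_⟩
  have := hab hy (hball (y := (p₁ - σ, p₂, p₃, p₄ - κ * σ)) ?_) σ hσ
  · simpa using this
  · simp only [Prod.dist_eq, Real.dist_eq, sup_lt_iff, sub_zero]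
    exact ⟨h1, h2, by simpa using h3, by simpa using h4⟩

end Directions

/-! ### Perturbation in a small ball -/

section Charts

set_option linter.unusedSectionVars false

variable {d : ℕ} {𝕏 : Type} [AddCommGroup 𝕏] [TopologicalSpace 𝕏] [MeasureSpace 𝕏] [T2Space 𝕏]
  [SecondCountableTopology 𝕏] [BorelSpace 𝕏] [IsFiniteMeasureOnCompacts (volume : Measure 𝕏)]
  [SigmaFinite (volume : Measure 𝕏)]

variable {π : E d → 𝕏} {γ T : ℝ} [Fact (1 < γ)] {Ω : Set 𝕏} {z₀ : Quadruple d 𝕏}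
variable {xc : E d} {R r₀ : ℝ}

/-- The pull-back of a field to `ℝ × ℝ^d`. -/
def pull (π : E d → 𝕏) {F : Type*} (f : ℝ → 𝕏 → F) (y : ℝ × E d) : F := f y.1 (π y.2)

/-- `π` is an isometric chart on the ball of radius `R`, and maps the closed ball of the smaller
radius `r₀` into `Ω`. -/
structure IsInteriorChart (π : E d → 𝕏) (Ω : Set 𝕏) (xc : E d) (R r₀ : ℝ) : Prop where
  chart : InjOn π (Metric.ball xc R) ∧ MeasurePreserving π (volume.restrict (Metric.ball xc R))
    (volume.restrict (π '' Metric.ball xc R))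
  lt : r₀ < R
  image_subset : π '' Metric.closedBall xc r₀ ⊆ Ω

/-- The space-time cylinder over a ball. -/
def cylinder (T : ℝ) (xc : E d) (r : ℝ) : Set (ℝ × E d) := Ioo 0 T ×ˢ Metric.ball xc r

theorem isOpen_cylinder (T : ℝ) (xc : E d) (r : ℝ) : IsOpen (cylinder T xc r) :=
  isOpen_Ioo.prod Metric.isOpen_ball

theorem measurableSet_cylinder (T : ℝ) (xc : E d) (r : ℝ) : MeasurableSet (cylinder T xc r) :=
  (isOpen_cylinder T xc r).measurableSet

theorem volume_cylinder_lt_top (T : ℝ) (xc : E d) (r : ℝ) : volume (cylinder T xc r) < ∞ :=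
  (Bornology.IsBounded.prod (Metric.isBounded_Ioo 0 T) Metric.isBounded_ball).measure_lt_top

/-- The pointwise energy defect. -/
def gap (π : E d → 𝕏) (γ : ℝ) (z₀ : Quadruple d 𝕏) (m : ℝ → 𝕏 → E d) (y : ℝ × E d) : ℝ :=
  pull π z₀.Q y - pressure γ (pull π z₀.ρ y) - ‖pull π m y‖ ^ 2 / (d * pull π z₀.ρ y)

/-- Twice the kinetic energy on a set. -/
def kinetic (π : E d → 𝕏) (z₀ : Quadruple d 𝕏) (s : Set (ℝ × E d)) (m : ℝ → 𝕏 → E d) : ℝ :=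
  ∫ y in s, (pull π z₀.ρ y)⁻¹ * ‖pull π m y‖ ^ 2

theorem continuousOn_pull (hπ : Continuous π) (hc : IsInteriorChart π Ω xc R r₀) {F : Type*}
    [TopologicalSpace F] {f : ℝ → 𝕏 → F}
    (hf : ContinuousOn (fun y : ℝ × 𝕏 => f y.1 y.2) (Icc 0 T ×ˢ Ω)) :
    ContinuousOn (pull π f) (Icc 0 T ×ˢ Metric.closedBall xc r₀) :=
  hf.comp (f := Prod.map id π) (continuous_id.prodMap hπ).continuousOn
    fun y hy => ⟨hy.1, hc.image_subset ⟨y.2, hy.2, rfl⟩⟩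

theorem cylinder_subset_compact (T : ℝ) (xc : E d) (r : ℝ) :
    cylinder T xc r ⊆ Icc 0 T ×ˢ Metric.closedBall xc r :=
  prod_mono Ioo_subset_Icc_self Metric.ball_subset_closedBall

theorem continuousOn_pull_density (hπ : Continuous π) (hc : IsInteriorChart π Ω xc R r₀)
    (hz : IsStrictSubsolution π γ T Ω z₀) :
    ContinuousOn (pull π z₀.ρ) (Icc 0 T ×ˢ Metric.closedBall xc r₀) :=
  continuousOn_pull hπ hc (hz.continuous_density.mono (prod_mono_right (subset_univ _)))

theorem continuousOn_pull_inv_density (hπ : Continuous π) (hc : IsInteriorChart π Ω xc R r₀)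
    (hz : IsStrictSubsolution π γ T Ω z₀) :
    ContinuousOn (fun y => (pull π z₀.ρ y)⁻¹) (Icc 0 T ×ˢ Metric.closedBall xc r₀) :=
  (continuousOn_pull_density hπ hc hz).inv₀ fun y hy => (hz.pos y.1 hy.1 (π y.2)).ne'

theorem continuousOn_pull_pressure (hπ : Continuous π) (hc : IsInteriorChart π Ω xc R r₀)
    (hz : IsStrictSubsolution π γ T Ω z₀) :
    ContinuousOn (fun y => pull π z₀.Q y - pressure γ (pull π z₀.ρ y))
      (Icc 0 T ×ˢ Metric.closedBall xc r₀) :=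
  (continuousOn_pull hπ hc (hz.continuous_pressure.mono (prod_mono_right (subset_univ _)))).sub
    (continuousOn_pull (f := fun t x => pressure γ (z₀.ρ t x)) hπ hc
      ((continuousOn_pressure hz).mono (prod_mono_right (subset_univ _))))

theorem IsFixedSubsolution.continuousOn_kinetic (hπ : Continuous π)
    (hc : IsInteriorChart π Ω xc R r₀) (hz : IsStrictSubsolution π γ T Ω z₀)
    {w : StateSpace d 𝕏 γ T} {m : ℝ → 𝕏 → E d} {M : ℝ → 𝕏 → Matrix (Fin d) (Fin d) ℝ}
    (h : IsFixedSubsolution π γ T Ω z₀ w m M) :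
    ContinuousOn (fun y => (pull π z₀.ρ y)⁻¹ * ‖pull π m y‖ ^ 2)
      (Icc 0 T ×ˢ Metric.closedBall xc r₀) :=
  (continuousOn_pull_inv_density hπ hc hz).mul
    ((continuousOn_pull hπ hc h.continuous_momentum).norm.pow 2)

theorem integrableOn_cylinder {f : ℝ × E d → ℝ}
    (hf : ContinuousOn f (Icc 0 T ×ˢ Metric.closedBall xc r₀)) :
    IntegrableOn f (cylinder T xc r₀) :=
  (hf.integrableOn_compact (isCompact_Icc.prod (isCompact_closedBall xc r₀))).mono_set
    (cylinder_subset_compact T xc r₀)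

/-- The envelope is `α` times a product of bump functions equal to 1 on the ball of half the radius.
A large frequency achieves three things at once: the new state lies in `V`, the wave errors are
below `δ`, and the gain exceeds `τ`, since its limit is at least the stated integral over the
smaller ball. -/
theorem IsFixedSubsolution.exists_wave_perturbation (hπ : IsFlatCovering π) (hΩ : IsOpen Ω)
    (hz : IsStrictSubsolution π γ T Ω z₀) (hc : IsInteriorChart π Ω xc R r₀)
    {w : StateSpace d 𝕏 γ T} {m : ℝ → 𝕏 → E d} {M : ℝ → 𝕏 → Matrix (Fin d) (Fin d) ℝ}
    (h : IsFixedSubsolution π γ T Ω z₀ w m M) {y₀ : ℝ × E d} {r : ℝ} (hr : 0 < r)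
    (hsub : Metric.closedBall y₀ r ⊆ cylinder T xc r₀) {e ξ : E d} {κ α δ : ℝ} (he : ‖e‖ = 1)
    (hξ : ‖ξ‖ = 1) (heξ : inner ℝ e ξ = (0 : ℝ)) (hα : 0 ≤ α) (hδ : 0 < δ)
    (hadm : ∀ y ∈ Metric.closedBall y₀ r, ∀ σ ∈ Icc (-α) α, ∀ p₁ p₂ p₃ p₄ : ℝ, |p₁ - σ| < δ →
      |p₂| < δ → |p₃| < δ → |p₄ - κ * σ| < δ → IsAdmissible (defect
        (pull π z₀.Q y - pressure γ (pull π z₀.ρ y)) (pull π z₀.ρ y)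
        (pull π m y + (p₁ • e + p₂ • ξ))
        (pull π M y + (p₃ • (tensorSq e - tensorSq ξ) + p₄ • symProd e ξ))))
    {V : Set (StateSpace d 𝕏 γ T)} (hV : V ∈ 𝓝 w) {τ : ℝ}
    (hτ : τ < ∫ y in Metric.closedBall y₀ (r / 2), (pull π z₀.ρ y)⁻¹ * α ^ 2 / 2) :
    ∃ w' m' M', IsFixedSubsolution π γ T Ω z₀ w' m' M' ∧ w' ∈ V ∧
      (∀ y ∈ cylinder T xc r₀ \ Metric.closedBall y₀ r,
        pull π m' y = pull π m y ∧ pull π M' y = pull π M y) ∧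
      kinetic π z₀ (cylinder T xc r₀) m + τ ≤ kinetic π z₀ (cylinder T xc r₀) m' := by
  obtain ⟨t₀, x₀⟩ := y₀
  set D := Metric.closedBall (t₀, x₀) r with hD
  set I := Metric.closedBall t₀ r with hI
  set K := Metric.closedBall x₀ r with hK
  have hDprod : D = I ×ˢ K := (closedBall_prod_same t₀ x₀ r).symm
  have hIT : I ⊆ Ioo 0 T := fun t ht =>
    (hsub (show (t, x₀) ∈ D from hDprod ▸ ⟨ht, Metric.mem_closedBall_self hr.le⟩)).1
  have hKb : K ⊆ Metric.ball xc r₀ := fun x hx =>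
    (hsub (show (t₀, x) ∈ D from hDprod ▸ ⟨Metric.mem_closedBall_self hr.le, hx⟩)).2
  have hbR : Metric.ball xc r₀ ⊆ Metric.ball xc R := Metric.ball_subset_ball hc.lt.le
  have hKs : K ⊆ Metric.ball xc R := hKb.trans hbR
  have hKΩ : π '' K ⊆ Ω :=
    (image_mono (hKb.trans Metric.ball_subset_closedBall)).trans hc.image_subset
  have hIc : IsCompact I := isCompact_closedBall _ _
  have hKc : IsCompact K := isCompact_closedBall _ _
  have hDc : IsCompact D := isCompact_closedBall _ _
  have hDs : D ⊆ Icc 0 T ×ˢ Metric.closedBall xc r₀ :=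
    hsub.trans (cylinder_subset_compact T xc r₀)
  let θb : ContDiffBump t₀ := ⟨r / 2, r, half_pos hr, half_lt_self hr⟩
  let ζb : ContDiffBump x₀ := ⟨r / 2, r, half_pos hr, half_lt_self hr⟩
  set θ : ℝ → ℝ := fun t => α * θb t with hθ
  set ζ : E d → ℝ := fun x => ζb x with hζ
  have hθs : ContDiff ℝ (⊤ : ℕ∞) θ := contDiff_const.mul θb.contDiff
  have hζs : ContDiff ℝ (⊤ : ℕ∞) ζ := ζb.contDiff
  have hθ0 : ∀ t ∉ I, θ t = 0 := fun t ht => by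
    have : θb t = 0 := θb.zero_of_le_dist (not_le.1 ht).le
    simp only [hθ, this, mul_zero]
  have hζ0 : ∀ x ∉ K, ζ x = 0 := fun x hx => ζb.zero_of_le_dist (not_le.1 hx).le
  have hθL : ∀ t, |θ t| ≤ α := fun t => by
    rw [hθ, abs_mul, abs_of_nonneg hα, abs_of_nonneg θb.nonneg]
    exact mul_le_of_le_one_right hα θb.le_one
  have hζ1 : ∀ x, |ζ x| ≤ 1 := fun x => by
    rw [hζ, abs_of_nonneg ζb.nonneg]
    exact ζb.le_one
  obtain ⟨C, hC0, c₁, c₂, a, b, hW⟩ :=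
    exists_isWaveSequence hξ heξ κ hIc hKc hθs hζs hθ0 hζ0
  have hcont_m := continuousOn_pull hπ.isOpenQuotientMap.continuous hc h.continuous_momentum
  have hcont_r := continuousOn_pull_inv_density hπ.isOpenQuotientMap.continuous hc hz
  obtain ⟨B₁, hB₁⟩ := hDc.exists_bound_of_continuousOn (hcont_m.mono hDs)
  obtain ⟨B₂, hB₂⟩ := hDc.exists_bound_of_continuousOn (hcont_r.mono hDs)
  have hgain := hW.tendsto_energy he hξ hθs.continuous hζs.continuous hθL hζ1 hDc.measurableSet
    hDc.measure_lt_top.ne (r := fun y => (pull π z₀.ρ y)⁻¹) (p := pull π m) (B := max B₁ B₂)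
    ((hcont_r.mono hDs).aestronglyMeasurable hDc.measurableSet)
    ((hcont_m.mono hDs).aestronglyMeasurable hDc.measurableSet)
    (fun y hy => (hB₂ y hy).trans (le_max_right _ _))
    (fun y hy => (hB₁ y hy).trans (le_max_left _ _))
  have hlim : τ < ∫ y in D, (pull π z₀.ρ y)⁻¹ * (θ y.1 * ζ y.2) ^ 2 / 2 := by
    refine hτ.trans_le ?_
    have hsmall : Metric.closedBall (t₀, x₀) (r / 2) ⊆ D :=
      Metric.closedBall_subset_closedBall (half_le_self hr.le)
    have heq : ∫ y in Metric.closedBall (t₀, x₀) (r / 2), (pull π z₀.ρ y)⁻¹ * α ^ 2 / 2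
        = ∫ y in Metric.closedBall (t₀, x₀) (r / 2),
          (pull π z₀.ρ y)⁻¹ * (θ y.1 * ζ y.2) ^ 2 / 2 := by
      refine setIntegral_congr_fun Metric.isClosed_closedBall.measurableSet fun y hy => ?_
      rw [← closedBall_prod_same] at hy
      have h1 : θb y.1 = 1 := θb.one_of_mem_closedBall hy.1
      have h2 : ζb y.2 = 1 := ζb.one_of_mem_closedBall hy.2
      simp only [hθ, hζ, h1, h2, mul_one]
    rw [heq]
    refine setIntegral_mono_set ?_ ?_ hsmall.eventuallyLE
    · refine ContinuousOn.integrableOn_compact hDc (((hcont_r.mono hDs).mul ?_).div_const 2)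
      exact (((hθs.continuous.comp continuous_fst).mul
        (hζs.continuous.comp continuous_snd)).pow 2).continuousOn
    · refine (ae_restrict_mem hDc.measurableSet).mono fun y hy => ?_
      have := hz.pos y.1 (hDs hy).1 (π y.2)
      simp only [pull, Pi.zero_apply]
      positivity
  have hevV := (hW.tendsto_addWave hπ hc.chart hKc hKs he hξ hζs.continuous hθL hζ1 w).eventually
    hV
  have hevδ := (tendsto_const_div_succ C).eventually (gt_mem_nhds hδ)
  obtain ⟨N, hNV, hNδ, hNτ⟩ := (hevV.and (hevδ.and (hgain.eventually (lt_mem_nhds hlim)))).exists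
  have hfix := h.addWave hπ hΩ hz hc.chart hIc hIT hKc hKs hKΩ he hξ heξ (hW.isWave N)
    fun t ht y hy => by
      obtain ⟨b1, b2, b3, b4⟩ := hW.bound N (t, y)
      refine hadm (t, y) (hDprod ▸ ⟨ht, hy⟩)
        (θ t * ζ y * Real.cos ((N + 1 : ℕ) * phase ξ κ (t, y))) (abs_le.1 ?_) _ _ _ _
        (b1.trans_lt hNδ) (b2.trans_lt hNδ) (b3.trans_lt hNδ) (b4.trans_lt hNδ)
      rw [abs_mul, abs_mul]
      calc |θ t| * |ζ y| * |Real.cos ((N + 1 : ℕ) * phase ξ κ (t, y))| ≤ α * 1 * 1 :=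
            mul_le_mul (mul_le_mul (hθL t) (hζ1 y) (abs_nonneg _) hα) (Real.abs_cos_le_one _)
              (abs_nonneg _) (by linarith)
        _ = α := by ring
  refine ⟨_, _, _, hfix, hNV, fun y hy => ?_, ?_⟩
  · have hy2 : y.2 ∈ Metric.ball xc R := hbR hy.1.2
    have hy0 : y ∉ I ×ˢ K := fun h' => hy.2 (hDprod ▸ h')
    simp only [pull]
    rw [baseField_apply hc.chart.1 _ _ hy2, baseField_apply hc.chart.1 _ _ hy2,
      (hW.isWave N).waveMomentum_eq_zero hy0, (hW.isWave N).waveFlux_eq_zero hy0, add_zero,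
      add_zero]
    exact ⟨rfl, rfl⟩
  · set W := waveMomentum e ξ (c₁ N) (c₂ N) with hWd
    have hWc : Continuous W := (hW.isWave N).continuous_waveMomentum
    set G := fun y => (pull π z₀.ρ y)⁻¹ * (2 * inner ℝ (pull π m y) (W y) + ‖W y‖ ^ 2) with hG
    have hGc : ContinuousOn G (Icc 0 T ×ˢ Metric.closedBall xc r₀) := hcont_r.mul
      ((continuousOn_const.mul (hcont_m.inner hWc.continuousOn)).add
        (hWc.norm.pow 2).continuousOn)
    have e1 : kinetic π z₀ (cylinder T xc r₀) (fun t x => m t x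
        + baseField π (Metric.ball xc R) W t x)
        = ∫ y in cylinder T xc r₀, ((pull π z₀.ρ y)⁻¹ * ‖pull π m y‖ ^ 2 + G y) := by
      refine setIntegral_congr_fun (measurableSet_cylinder T xc r₀) fun y hy => ?_
      have : pull π (fun t x => m t x + baseField π (Metric.ball xc R) W t x) y
          = pull π m y + W y := by
        simp only [pull]
        rw [baseField_apply hc.chart.1 _ _ (hbR hy.2)]
      simp only [this, hG, norm_add_sq_real]
      ring
    have e2 : ∫ y in cylinder T xc r₀, G y = ∫ y in D, G y := by
      refine setIntegral_eq_of_subset_of_forall_sdiff_eq_zero (measurableSet_cylinder T xc r₀)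
        hsub fun y hy => ?_
      have hy0 : y ∉ I ×ˢ K := fun h' => hy.2 (hDprod ▸ h')
      simp only [hG, hWd, (hW.isWave N).waveMomentum_eq_zero hy0, inner_zero_right, norm_zero]
      ring
    rw [e1, integral_add (integrableOn_cylinder
      (h.continuousOn_kinetic hπ.isOpenQuotientMap.continuous hc hz)) (integrableOn_cylinder hGc),
      e2]
    exact add_le_add_right hNτ.le _

end Charts

/-! ### Raising the energy by weakly small perturbations. -/

section Density

set_option linter.unusedSectionVars false

variable {d : ℕ} {𝕏 : Type} [AddCommGroup 𝕏] [TopologicalSpace 𝕏] [MeasureSpace 𝕏] [T2Space 𝕏]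
  [SecondCountableTopology 𝕏] [BorelSpace 𝕏] [IsFiniteMeasureOnCompacts (volume : Measure 𝕏)]
  [SigmaFinite (volume : Measure 𝕏)]

variable {π : E d → 𝕏} {γ T : ℝ} [Fact (1 < γ)] {Ω : Set 𝕏} {z₀ : Quadruple d 𝕏}
variable {xc : E d} {R r₀ : ℝ} {w : StateSpace d 𝕏 γ T} {m : ℝ → 𝕏 → E d}
  {M : ℝ → 𝕏 → Matrix (Fin d) (Fin d) ℝ}

theorem IsInteriorChart.mem (hc : IsInteriorChart π Ω xc R r₀) {y : ℝ × E d}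
    (hy : y ∈ cylinder T xc r₀) : π y.2 ∈ Ω :=
  hc.image_subset ⟨y.2, Metric.ball_subset_closedBall hy.2, rfl⟩

theorem IsFixedSubsolution.gap_pos (hz : IsStrictSubsolution π γ T Ω z₀)
    (hc : IsInteriorChart π Ω xc R r₀) (h : IsFixedSubsolution π γ T Ω z₀ w m M) {y : ℝ × E d}
    (hy : y ∈ cylinder T xc r₀) : 0 < gap π γ z₀ m y := by
  have := h.neZero hy.1 (hc.mem hy)
  have hd : (0 : ℝ) < d := Nat.cast_pos.2 (NeZero.pos d)
  have h1 := h.norm_sq_lt hz hy.1 (hc.mem hy)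
  rw [gap, sub_pos, mul_comm, ← div_div, div_lt_iff₀ hd, mul_comm]
  exact h1

theorem IsFixedSubsolution.continuousOn_gap (hπ : Continuous π)
    (hc : IsInteriorChart π Ω xc R r₀) (hz : IsStrictSubsolution π γ T Ω z₀)
    (h : IsFixedSubsolution π γ T Ω z₀ w m M) :
    ContinuousOn (gap π γ z₀ m) (Icc 0 T ×ˢ Metric.closedBall xc r₀) := by
  have h1 := (continuousOn_pull_pressure hπ hc hz).sub
    ((h.continuousOn_kinetic hπ hc hz).const_mul ((d : ℝ)⁻¹))
  refine h1.congr fun y _ => ?_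
  simp only [gap, Pi.sub_apply]
  rw [div_eq_inv_mul, mul_inv]
  ring

/-- Since `z₀.Q` and `z₀.ρ` are fixed, raising the kinetic energy is the same as lowering the
integrated gap, and positivity of the gap bounds the kinetic energy from above. -/
theorem IsFixedSubsolution.kinetic_eq (hπ : Continuous π)
    (hc : IsInteriorChart π Ω xc R r₀) (hz : IsStrictSubsolution π γ T Ω z₀)
    (h : IsFixedSubsolution π γ T Ω z₀ w m M) :
    kinetic π z₀ (cylinder T xc r₀) m
      = d * (∫ y in cylinder T xc r₀, (pull π z₀.Q y - pressure γ (pull π z₀.ρ y)))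
        - d * ∫ y in cylinder T xc r₀, gap π γ z₀ m y := by
  rw [← integral_const_mul, ← integral_const_mul, ← integral_sub
    ((integrableOn_cylinder (continuousOn_pull_pressure hπ hc hz)).const_mul _)
    ((integrableOn_cylinder (h.continuousOn_gap hπ hc hz)).const_mul _)]
  refine setIntegral_congr_fun (measurableSet_cylinder T xc r₀) fun y hy => ?_
  have := h.neZero hy.1 (hc.mem hy)
  have hd : (d : ℝ) ≠ 0 := NeZero.ne _
  have hρ : pull π z₀.ρ y ≠ 0 := (hz.pos y.1 (Ioo_subset_Icc_self hy.1) (π y.2)).ne'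
  simp only [gap]
  field_simp
  ring

/-- The order of quantifiers matters: `c` is the same for all subsolutions, the radius `r₁` depends
only on the original one, and the perturbation may be applied to any `w'` with the same fields on
the ball. Hence disjoint balls can be treated one after another. -/
theorem exists_ball_perturbation (hπ : IsFlatCovering π) (hΩ : IsOpen Ω)
    (hz : IsStrictSubsolution π γ T Ω z₀) (hc : IsInteriorChart π Ω xc R r₀) :
    ∃ c > 0, ∀ w m M, IsFixedSubsolution π γ T Ω z₀ w m M → ∀ y₀ ∈ cylinder T xc r₀,
      ∃ r₁ > 0, ∀ r, 0 < r → r < r₁ → Metric.closedBall y₀ r ⊆ cylinder T xc r₀ ∧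
        ∀ w' m' M', IsFixedSubsolution π γ T Ω z₀ w' m' M' →
          (∀ y ∈ Metric.closedBall y₀ r, pull π m' y = pull π m y ∧ pull π M' y = pull π M y) →
          ∀ V ∈ 𝓝 w', ∃ w'' m'' M'', IsFixedSubsolution π γ T Ω z₀ w'' m'' M'' ∧ w'' ∈ V ∧
            (∀ y ∈ cylinder T xc r₀ \ Metric.closedBall y₀ r,
              pull π m'' y = pull π m' y ∧ pull π M'' y = pull π M' y) ∧
            kinetic π z₀ (cylinder T xc r₀) m'
              + c * ∫ y in Metric.closedBall y₀ r, gap π γ z₀ m y ^ 2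
              ≤ kinetic π z₀ (cylinder T xc r₀) m'' := by
  have hπc := hπ.isOpenQuotientMap.continuous
  obtain ⟨K, hK0, hK1, hK2⟩ := exists_uniform_bound hz
    ((isCompact_closedBall xc r₀).image hπc)
  set c₁ : ℝ := 1 / (8 * (K + 1) ^ 2) with hc₁
  have hc₁0 : 0 < c₁ := by positivity
  set n := Module.finrank ℝ (ℝ × E d) with hn
  -- The gain is measured on the half ball but compared with the gap on the whole ball: `2 ^ n` is
  -- the ratio of volumes, `2 * g` bounds the gap on a small ball, and `(K + 1)⁻¹` bounds the
  -- inverse density from below. The number 16 then leaves half of the available gain, so the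
  -- inequality required of `τ` is strict.
  refine ⟨c₁ ^ 2 / (16 * (K + 1) * 2 ^ n), by positivity, fun w m M h y₀ hy₀ => ?_⟩
  have hbd : ∀ y ∈ Icc 0 T ×ˢ Metric.closedBall xc r₀, _ := fun y hy =>
    hK1 y.1 hy.1 (π y.2) ⟨y.2, hy.2, rfl⟩
  have hT0 := Ioo_subset_Icc_self hy₀.1
  have hx0 := hc.mem hy₀
  have hd := h.neZero hy₀.1 hx0
  have hy0' := cylinder_subset_compact T xc r₀ hy₀
  have hm0 := (hK2 w m M h y₀.1 hy₀.1 (π y₀.2) ⟨y₀.2, hy0'.2, rfl⟩).1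
  have hpos := hz.pos y₀.1 hT0 (π y₀.2)
  obtain ⟨hg0, e, ξ, κ, he, hξ, heξ, hadm⟩ := exists_wave_direction hpos (hbd y₀ hy0').2.1 hm0
    (q := z₀.Q y₀.1 (π y₀.2) - pressure γ (z₀.ρ y₀.1 (π y₀.2)))
    (by
      have h1 := (abs_le.1 (hbd y₀ hy0').2.2.2.1).2
      have h2 : 0 ≤ pressure γ (z₀.ρ y₀.1 (π y₀.2)) := Real.rpow_nonneg hpos.le _
      linarith)
    (h.symm y₀.1 hT0 _) (h.traceFree y₀.1 hT0 _) (h.isAdmissible hy₀.1 hx0)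
  change 0 < gap π γ z₀ m y₀ at hg0
  set g := gap π γ z₀ m y₀ with hg
  have hnhds : Icc 0 T ×ˢ Metric.closedBall xc r₀ ∈ 𝓝 y₀ :=
    mem_of_superset ((isOpen_cylinder T xc r₀).mem_nhds hy₀) (cylinder_subset_compact T xc r₀)
  obtain ⟨δ, hδ, hev⟩ := exists_eventually_isAdmissible
    ((continuousOn_pull_pressure hπc hc hz).continuousAt hnhds)
    ((continuousOn_pull_density hπc hc hz).continuousAt hnhds) hpos.ne'
    ((continuousOn_pull hπc hc h.continuous_momentum).continuousAt hnhds)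
    ((continuousOn_pull hπc hc h.continuous_flux).continuousAt hnhds)
    (isCompact_Icc (a := -(c₁ * g)) (b := c₁ * g)) (e := e) (ξ := ξ) (κ := κ)
    fun σ hσ => hadm σ (abs_le.2 hσ)
  have hevg := ((h.continuousOn_gap hπc hc hz).continuousAt hnhds).eventually
    (gt_mem_nhds (show g < 2 * g by linarith))
  obtain ⟨r₁, hr₁, hball⟩ := Metric.eventually_nhds_iff_ball.1
    (hev.and (hevg.and ((isOpen_cylinder T xc r₀).eventually_mem hy₀)))
  refine ⟨r₁, hr₁, fun r hr hrr => ?_⟩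
  have hin : ∀ y ∈ Metric.closedBall y₀ r, y ∈ Metric.ball y₀ r₁ := fun y hy =>
    Metric.closedBall_subset_ball hrr hy
  have hsub : Metric.closedBall y₀ r ⊆ cylinder T xc r₀ := fun y hy => (hball y (hin y hy)).2.2
  refine ⟨hsub, fun w' m' M' h' hag V hV => ?_⟩
  refine h'.exists_wave_perturbation hπ hΩ hz hc hr hsub he hξ heξ (κ := κ) (α := c₁ * g)
    (by positivity) hδ (fun y hy σ hσ p₁ p₂ p₃ p₄ a1 a2 a3 a4 => ?_) hV ?_
  · rw [(hag y hy).1, (hag y hy).2]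
    exact (hball y (hin y hy)).1 σ hσ p₁ p₂ p₃ p₄ a1 a2 a3 a4
  · have hhalf : Metric.closedBall y₀ (r / 2) ⊆ Metric.closedBall y₀ r :=
      Metric.closedBall_subset_closedBall (half_le_self hr.le)
    set v := volume.real (Metric.closedBall y₀ (r / 2)) with hv
    have hvpos : 0 < v := ENNReal.toReal_pos
      (Metric.measure_closedBall_pos volume y₀ (half_pos hr)).ne' measure_closedBall_lt_top.ne
    have hvol : volume.real (Metric.closedBall y₀ r) = 2 ^ n * v := by
      rw [hv, Measure.addHaar_real_closedBall _ _ hr.le,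
        Measure.addHaar_real_closedBall _ _ (half_pos hr).le, ← hn, div_pow]
      field_simp
    have hup : ∫ y in Metric.closedBall y₀ r, gap π γ z₀ m y ^ 2 ≤ (2 * g) ^ 2 * (2 ^ n * v) := by
      rw [← hvol]
      refine (Real.le_norm_self _).trans
        (norm_setIntegral_le_of_norm_le_const measure_closedBall_lt_top fun y hy => ?_)
      rw [Real.norm_of_nonneg (sq_nonneg _)]
      exact pow_le_pow_left₀ (h.gap_pos hz hc (hsub hy)).le (hball y (hin y hy)).2.1.le 2
    have hlow : (K + 1)⁻¹ * (c₁ * g) ^ 2 / 2 * v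
        ≤ ∫ y in Metric.closedBall y₀ (r / 2), (pull π z₀.ρ y)⁻¹ * (c₁ * g) ^ 2 / 2 := by
      have hcst : (K + 1)⁻¹ * (c₁ * g) ^ 2 / 2 * v
          = ∫ y in Metric.closedBall y₀ (r / 2), (K + 1)⁻¹ * (c₁ * g) ^ 2 / 2 := by
        rw [setIntegral_const, smul_eq_mul, mul_comm]
      rw [hcst]
      have hss := (hhalf.trans hsub).trans (cylinder_subset_compact T xc r₀)
      refine setIntegral_mono_on (integrableOn_const measure_closedBall_lt_top.ne)
        (ContinuousOn.integrableOn_compact (isCompact_closedBall _ _)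
          ((((continuousOn_pull_inv_density hπc hc hz).mono hss).mul continuousOn_const).div_const
            2)) Metric.isClosed_closedBall.measurableSet fun y hy => ?_
      have h1 := (hbd y (hss hy)).1
      have h2 : 0 < pull π z₀.ρ y := hz.pos y.1 (hss hy).1 (π y.2)
      have h3 : (K + 1)⁻¹ ≤ (pull π z₀.ρ y)⁻¹ := inv_anti₀ h2 (h1.trans (by linarith))
      gcongr
    refine lt_of_le_of_lt (mul_le_mul_of_nonneg_left hup (by positivity)) (lt_of_lt_of_le ?_ hlow)
    have hKp : 0 < K + 1 := by linarith
    have e1 : c₁ ^ 2 / (16 * (K + 1) * 2 ^ n) * ((2 * g) ^ 2 * (2 ^ n * v))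
        = (K + 1)⁻¹ * (c₁ * g) ^ 2 / 4 * v := by
      field_simp
      ring
    rw [e1]
    have : 0 < (K + 1)⁻¹ * (c₁ * g) ^ 2 * v := by positivity
    linarith

/-- The Cauchy–Schwarz inequality against the constant 1, read off from the integral of `(v * f - A)
^ 2` being nonnegative. -/
theorem sq_setIntegral_le {Y : Type*} [MeasurableSpace Y] {μ : Measure Y} {s : Set Y}
    (hs : μ s ≠ ∞) {f : Y → ℝ} (hf : IntegrableOn f s μ)
    (hf2 : IntegrableOn (fun y => f y ^ 2) s μ) :
    (∫ y in s, f y ∂μ) ^ 2 ≤ μ.real s * ∫ y in s, f y ^ 2 ∂μ := by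
  rcases eq_or_ne (μ s) 0 with h0 | h0
  · simp [Measure.restrict_eq_zero.2 h0]
  have hv : 0 < μ.real s := ENNReal.toReal_pos h0 hs
  set v := μ.real s with hvd
  set A := ∫ y in s, f y ∂μ with hA
  have h1 : 0 ≤ ∫ y in s, (v * f y - A) ^ 2 ∂μ := integral_nonneg fun _ => sq_nonneg _
  have hc : IntegrableOn (fun _ : Y => A ^ 2) s μ := integrableOn_const hs
  have e1 : ∫ y in s, (v * f y - A) ^ 2 ∂μ
      = v ^ 2 * (∫ y in s, f y ^ 2 ∂μ) - 2 * v * A * A + v * A ^ 2 := by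
    have : ∀ y, (v * f y - A) ^ 2 = v ^ 2 * f y ^ 2 - 2 * v * A * f y + A ^ 2 := fun y => by ring
    simp_rw [this]
    have hd : IntegrableOn (fun y => v ^ 2 * f y ^ 2 - 2 * v * A * f y) s μ :=
      (hf2.const_mul _).sub (hf.const_mul _)
    rw [integral_add hd hc,
      integral_sub (hf2.const_mul _) (hf.const_mul _), integral_const_mul, integral_const_mul,
      setIntegral_const, smul_eq_mul]
  rw [e1] at h1
  have h2 : 0 ≤ v * (v * (∫ y in s, f y ^ 2 ∂μ) - A ^ 2) := by linarith
  have := nonneg_of_mul_nonneg_right h2 hv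
  linarith

/-- The cylinder is filled up to a null set by disjoint small balls. The gains of the separate
perturbations add up, and Cauchy–Schwarz converts the integral of the squared gap into the square of
its integral. -/
theorem exists_cylinder_perturbation (hπ : IsFlatCovering π) (hΩ : IsOpen Ω)
    (hz : IsStrictSubsolution π γ T Ω z₀) (hc : IsInteriorChart π Ω xc R r₀) :
    ∃ c > 0, ∀ w m M, IsFixedSubsolution π γ T Ω z₀ w m M →
      ∀ V : Set (StateSpace d 𝕏 γ T), IsOpen V → w ∈ V →
        ∃ w' m' M', IsFixedSubsolution π γ T Ω z₀ w' m' M' ∧ w' ∈ V ∧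
          kinetic π z₀ (cylinder T xc r₀) m
            + c * (∫ y in cylinder T xc r₀, gap π γ z₀ m y) ^ 2
            ≤ kinetic π z₀ (cylinder T xc r₀) m' := by
  have hπc := hπ.isOpenQuotientMap.continuous
  obtain ⟨c, hc0, hball⟩ := exists_ball_perturbation hπ hΩ hz hc
  set s := cylinder T xc r₀ with hs
  have hsm : MeasurableSet s := measurableSet_cylinder T xc r₀
  have hsfin : volume s < ∞ := volume_cylinder_lt_top T xc r₀
  set v := volume.real s with hv
  -- The 2 pays for retaining only half of `J`, the factor `v + 1` for Cauchy–Schwarz; the summand 1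
  -- avoids dividing by zero.
  refine ⟨c / (2 * (v + 1)), by positivity, fun w m M h V hV hwV => ?_⟩
  have hgc := h.continuousOn_gap hπc hc hz
  have hi1 : IntegrableOn (gap π γ z₀ m) s := integrableOn_cylinder hgc
  have hi2 : IntegrableOn (fun y => gap π γ z₀ m y ^ 2) s := integrableOn_cylinder (hgc.pow 2)
  have hCS := sq_setIntegral_le hsfin.ne hi1 hi2
  set J := ∫ y in s, gap π γ z₀ m y ^ 2 with hJ
  have hJ0 : 0 ≤ J := integral_nonneg fun _ => sq_nonneg _
  have hv0 : 0 ≤ v := measureReal_nonneg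
  have hfinal : c / (2 * (v + 1)) * (∫ y in s, gap π γ z₀ m y) ^ 2 ≤ c * (J / 2) := by
    have h1 : (∫ y in s, gap π γ z₀ m y) ^ 2 ≤ (v + 1) * J := hCS.trans (by nlinarith)
    calc c / (2 * (v + 1)) * (∫ y in s, gap π γ z₀ m y) ^ 2
        ≤ c / (2 * (v + 1)) * ((v + 1) * J) := by gcongr
      _ = c * (J / 2) := by field_simp
  rcases hJ0.eq_or_lt with hJz | hJpos
  · refine ⟨w, m, M, h, hwV, ?_⟩
    rw [← hJz] at hfinal
    linarith
  choose! ρ hρ0 hρ using hball w m M h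
  obtain ⟨t, r, htc, hts, htr, htm, htd⟩ := Besicovitch.exists_disjoint_closedBall_covering_ae
    (volume : Measure (ℝ × E d)) (fun _ => Ioi 0) s
    (fun x _ δ hδ => ⟨δ / 2, half_pos hδ, half_pos hδ, half_lt_self hδ⟩) ρ hρ0
  have hr : ∀ x ∈ t, 0 < r x ∧ r x < ρ x := fun x hx => (htr x hx).2
  have hBs : ∀ x ∈ t, Metric.closedBall x (r x) ⊆ s := fun x hx =>
    (hρ x (hts hx) (r x) (hr x hx).1 (hr x hx).2).1
  have hcover : s =ᵐ[volume] ⋃ x : t, Metric.closedBall (x : ℝ × E d) (r x) := by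
    have hsub : (⋃ x : t, Metric.closedBall (x : ℝ × E d) (r x)) ⊆ s :=
      iUnion_subset fun x => hBs x x.2
    refine Filter.EventuallyLE.antisymm ?_ hsub.eventuallyLE
    rw [ae_le_set, ← biUnion_eq_iUnion t fun x _ => Metric.closedBall x (r x)]
    exact htm
  have : Countable t := htc.to_subtype
  have hsum : HasSum (fun x : t => ∫ y in Metric.closedBall (x : ℝ × E d) (r x),
      gap π γ z₀ m y ^ 2) J := by
    rw [hJ, setIntegral_congr_set hcover]
    refine hasSum_integral_iUnion (fun x => Metric.isClosed_closedBall.measurableSet)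
      (fun x y hxy => htd x.2 y.2 (Subtype.coe_injective.ne hxy))
      (hi2.mono_set (iUnion_subset fun x => hBs x x.2))
  -- Finitely many of the balls already carry more than half of `J`, so finitely many perturbations
  -- suffice.
  obtain ⟨F, hF⟩ := (hsum.eventually (lt_mem_nhds (half_lt_self hJpos))).exists
  -- By disjointness, the perturbations made so far have not changed the fields on the next ball.
  -- Openness of `V` keeps the state inside at every stage.
  have hind : ∀ F' : Finset t, ∃ w' m' M', IsFixedSubsolution π γ T Ω z₀ w' m' M' ∧ w' ∈ V ∧
      (∀ y ∈ s, (∀ x ∈ F', y ∉ Metric.closedBall (x : ℝ × E d) (r x)) →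
        pull π m' y = pull π m y ∧ pull π M' y = pull π M y) ∧
      kinetic π z₀ s m + c * ∑ x ∈ F', ∫ y in Metric.closedBall (x : ℝ × E d) (r x),
        gap π γ z₀ m y ^ 2 ≤ kinetic π z₀ s m' := by
    intro F'
    induction F' using Finset.induction_on with
    | empty => exact ⟨w, m, M, h, hwV, fun _ _ _ => ⟨rfl, rfl⟩, by simp⟩
    | insert x F' hx ih =>
      obtain ⟨w', m', M', h', hV', hag, hen⟩ := ih
      obtain ⟨w'', m'', M'', h'', hV'', hag', hen'⟩ :=
        (hρ x (hts x.2) (r x) (hr x x.2).1 (hr x x.2).2).2 w' m' M' h' (fun y hy =>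
          hag y (hBs x x.2 hy) fun x' hx' hy' => by
            have hne : (x' : ℝ × E d) ≠ x := fun hh => hx (Subtype.coe_injective hh ▸ hx')
            exact disjoint_left.1 (htd x'.2 x.2 hne) hy' hy) V (hV.mem_nhds hV')
      refine ⟨w'', m'', M'', h'', hV'', fun y hy hyF => ?_, ?_⟩
      · obtain ⟨a1, a2⟩ := hag' y ⟨hy, hyF x (Finset.mem_insert_self _ _)⟩
        obtain ⟨b1, b2⟩ := hag y hy fun x' hx' => hyF x' (Finset.mem_insert_of_mem hx')
        exact ⟨a1.trans b1, a2.trans b2⟩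
      · rw [Finset.sum_insert hx, mul_add]
        linarith
  obtain ⟨w', m', M', h', hV', -, hen⟩ := hind F
  refine ⟨w', m', M', h', hV', ?_⟩
  have : c * (J / 2) ≤ c * ∑ x ∈ F, ∫ y in Metric.closedBall (x : ℝ × E d) (r x),
      gap π γ z₀ m y ^ 2 := mul_le_mul_of_nonneg_left hF.le hc0.le
  linarith

/-- Fixed-density subsolutions with arbitrarily small energy defect are dense. -/
theorem exists_small_gap (hπ : IsFlatCovering π) (hΩ : IsOpen Ω)
    (hz : IsStrictSubsolution π γ T Ω z₀) (hc : IsInteriorChart π Ω xc R r₀)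
    (h : IsFixedSubsolution π γ T Ω z₀ w m M) {V : Set (StateSpace d 𝕏 γ T)} (hV : IsOpen V)
    (hw : w ∈ V) {ε : ℝ} (hε : 0 < ε) :
    ∃ w' m' M', IsFixedSubsolution π γ T Ω z₀ w' m' M' ∧ w' ∈ V ∧
      ∫ y in cylinder T xc r₀, gap π γ z₀ m' y < ε := by
  have hπc := hπ.isOpenQuotientMap.continuous
  obtain ⟨c, hc0, hstep⟩ := exists_cylinder_perturbation hπ hΩ hz hc
  set s := cylinder T xc r₀ with hs
  have hgap0 : ∀ w m M, IsFixedSubsolution π γ T Ω z₀ w m M →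
      0 ≤ ∫ y in s, gap π γ z₀ m y := fun w m M h =>
    setIntegral_nonneg (measurableSet_cylinder T xc r₀) fun y hy => (h.gap_pos hz hc hy).le
  -- Rather than iterating, take a subsolution in `V` whose kinetic energy is within `c * ε ^ 2` of
  -- the supremum over `V`. If its gap were at least `ε`, one more perturbation would exceed the
  -- supremum.
  set S : Set ℝ := {a | ∃ w m M, IsFixedSubsolution π γ T Ω z₀ w m M ∧ w ∈ V ∧
    kinetic π z₀ s m = a} with hS
  have hne : S.Nonempty := ⟨_, w, m, M, h, hw, rfl⟩
  have hbdd : BddAbove S := by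
    refine ⟨d * ∫ y in s, (pull π z₀.Q y - pressure γ (pull π z₀.ρ y)), ?_⟩
    rintro _ ⟨w', m', M', h', -, rfl⟩
    rw [h'.kinetic_eq hπc hc hz]
    have := mul_nonneg (Nat.cast_nonneg (α := ℝ) d) (hgap0 w' m' M' h')
    linarith
  obtain ⟨_, ⟨w', m', M', h', hV', rfl⟩, hlt⟩ := exists_lt_of_lt_csSup hne
    (show sSup S - c * ε ^ 2 < sSup S by linarith [mul_pos hc0 (pow_pos hε 2)])
  refine ⟨w', m', M', h', hV', ?_⟩
  obtain ⟨w'', m'', M'', h'', hV'', hen⟩ := hstep w' m' M' h' V hV hV'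
  have hle := le_csSup hbdd ⟨w'', m'', M'', h'', hV'', rfl⟩
  by_contra hcon
  have h1 : ε ^ 2 ≤ (∫ y in s, gap π γ z₀ m' y) ^ 2 :=
    pow_le_pow_left₀ hε.le (not_lt.1 hcon) 2
  have h2 := mul_le_mul_of_nonneg_left h1 hc0.le
  linarith

end Density

/-! ### Lower bounds of the energy that are continuous for the weak topology -/

section LowerEnergy

set_option linter.unusedSectionVars false

variable {d : ℕ} {𝕏 : Type} [MeasureSpace 𝕏] {A : Set 𝕏}

theorem integrable_norm_sq (v : Lp (E d) 2 (volume : Measure 𝕏)) :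
    Integrable (fun x => ‖v x‖ ^ 2) (volume : Measure 𝕏) :=
  (Lp.memLp v).integrable_norm_pow two_ne_zero

theorem integral_norm_sq (v : Lp (E d) 2 (volume : Measure 𝕏)) : ∫ x, ‖v x‖ ^ 2 = ‖v‖ ^ 2 := by
  rw [← real_inner_self_eq_norm_sq, L2.inner_def]
  simp_rw [real_inner_self_eq_norm_sq]

theorem integrable_weight_mul_norm_sq (hA : MeasurableSet A) {r : 𝕏 → ℝ} {K : ℝ}
    (hr : AEStronglyMeasurable r (volume.restrict A)) (hK : ∀ x ∈ A, |r x| ≤ K)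
    (v : Lp (E d) 2 (volume : Measure 𝕏)) :
    IntegrableOn (fun x => r x * ‖v x‖ ^ 2) A :=
  (integrable_norm_sq v).integrableOn.bdd_mul (c := K) hr
    ((ae_restrict_mem hA).mono fun x hx => hK x hx)

theorem integrable_inner_Lp (v ψ : Lp (E d) 2 (volume : Measure 𝕏)) :
    Integrable (fun x => inner ℝ (ψ x) (v x)) (volume : Measure 𝕏) :=
  L2.integrable_inner ψ v

/-- Completing the square: the dual functional at `ψ` falls short of the energy by the weighted
squared distance from `ψ` to `v / r`. -/
theorem two_mul_integral_inner_sub (hA : MeasurableSet A) {r : 𝕏 → ℝ} {K : ℝ}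
    (hr : AEStronglyMeasurable r (volume.restrict A))
    (hK : ∀ x ∈ A, 0 < r x ∧ r x ≤ K ∧ (r x)⁻¹ ≤ K) (v ψ : Lp (E d) 2 (volume : Measure 𝕏)) :
    2 * (∫ x in A, inner ℝ (ψ x) (v x)) - ∫ x in A, r x * ‖ψ x‖ ^ 2
      = (∫ x in A, (r x)⁻¹ * ‖v x‖ ^ 2) - ∫ x in A, r x * ‖(r x)⁻¹ • v x - ψ x‖ ^ 2 := by
  have i1 := (integrable_inner_Lp v ψ).integrableOn (s := A)
  have i2 := integrable_weight_mul_norm_sq hA hr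
    (fun x hx => (abs_of_pos (hK x hx).1).trans_le (hK x hx).2.1) ψ
  have i3 := integrable_weight_mul_norm_sq (r := fun x => (r x)⁻¹) hA hr.aemeasurable.inv.aestronglyMeasurable
    (fun x hx => (abs_of_pos (inv_pos.2 (hK x hx).1)).trans_le (hK x hx).2.2) v
  have i4 : IntegrableOn (fun x => 2 * inner ℝ (ψ x) (v x) - r x * ‖ψ x‖ ^ 2) A :=
    (i1.const_mul 2).sub i2
  have hpt : ∀ x ∈ A, r x * ‖(r x)⁻¹ • v x - ψ x‖ ^ 2
      = (r x)⁻¹ * ‖v x‖ ^ 2 - (2 * inner ℝ (ψ x) (v x) - r x * ‖ψ x‖ ^ 2) := fun x hx => by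
    have := (hK x hx).1.ne'
    rw [norm_sub_sq_real, real_inner_smul_left, norm_smul, mul_pow, Real.norm_eq_abs, sq_abs,
      real_inner_comm]
    field_simp
    ring
  rw [setIntegral_congr_fun hA hpt, integral_sub i3 i4, integral_sub (i1.const_mul 2) i2,
    integral_const_mul]
  ring

theorem two_mul_integral_inner_sub_le (hA : MeasurableSet A) {r : 𝕏 → ℝ} {K : ℝ}
    (hr : AEStronglyMeasurable r (volume.restrict A))
    (hK : ∀ x ∈ A, 0 < r x ∧ r x ≤ K ∧ (r x)⁻¹ ≤ K) (v ψ : Lp (E d) 2 (volume : Measure 𝕏)) :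
    2 * (∫ x in A, inner ℝ (ψ x) (v x)) - ∫ x in A, r x * ‖ψ x‖ ^ 2
      ≤ ∫ x in A, (r x)⁻¹ * ‖v x‖ ^ 2 := by
  rw [two_mul_integral_inner_sub hA hr hK]
  have : 0 ≤ ∫ x in A, r x * ‖(r x)⁻¹ • v x - ψ x‖ ^ 2 :=
    setIntegral_nonneg hA fun x hx => mul_nonneg (hK x hx).1.le (sq_nonneg _)
  linarith

/-- The optimal `ψ` is `v / r` on `A`, which is square integrable because `1 / r` is bounded; a
sufficiently close element of the dense sequence is nearly optimal. -/
theorem exists_lt_two_mul_integral_inner_sub (hA : MeasurableSet A) {r : 𝕏 → ℝ} {K : ℝ}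
    (hr : AEStronglyMeasurable r (volume.restrict A))
    (hK : ∀ x ∈ A, 0 < r x ∧ r x ≤ K ∧ (r x)⁻¹ ≤ K) {ψ : ℕ → Lp (E d) 2 (volume : Measure 𝕏)}
    (hψ : DenseRange ψ) (v : Lp (E d) 2 (volume : Measure 𝕏)) {ε : ℝ} (hε : 0 < ε) :
    ∃ n, (∫ x in A, (r x)⁻¹ * ‖v x‖ ^ 2) - ε
      < 2 * (∫ x in A, inner ℝ (ψ n x) (v x)) - ∫ x in A, r x * ‖ψ n x‖ ^ 2 := by
  have hu : MemLp (A.indicator fun x => (r x)⁻¹ • v x) 2 (volume : Measure 𝕏) := by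
    refine (Lp.memLp v).of_le_mul (c := |K|) ?_ (Eventually.of_forall fun x => ?_)
    · rw [aestronglyMeasurable_indicator_iff hA]
      exact (hr.aemeasurable.inv.aestronglyMeasurable).smul (Lp.aestronglyMeasurable v).restrict
    · by_cases hx : x ∈ A
      · rw [indicator_of_mem hx, norm_smul, norm_inv, Real.norm_of_nonneg (hK x hx).1.le]
        gcongr
        exact (hK x hx).2.2.trans (le_abs_self K)
      · rw [indicator_of_notMem hx, norm_zero]
        positivity
  set u := hu.toLp with hud
  have hK1 : 0 < |K| + 1 := by positivity
  obtain ⟨n, hn⟩ := hψ.exists_dist_lt u (Real.sqrt_pos.2 (div_pos hε hK1))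
  refine ⟨n, ?_⟩
  rw [two_mul_integral_inner_sub hA hr hK]
  have h1 : ∫ x in A, r x * ‖(r x)⁻¹ • v x - ψ n x‖ ^ 2 ≤ (|K| + 1) * ‖u - ψ n‖ ^ 2 := by
    rw [← integral_norm_sq, ← integral_const_mul]
    refine le_trans ?_ (setIntegral_le_integral (s := A) ((integrable_norm_sq _).const_mul _)
      (Eventually.of_forall fun x => by simp only [Pi.zero_apply]; positivity))
    refine integral_mono_of_nonneg ((ae_restrict_mem hA).mono fun x hx =>
      mul_nonneg (hK x hx).1.le (sq_nonneg _))
      ((integrable_norm_sq (u - ψ n)).const_mul (|K| + 1)).integrableOn ?_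
    filter_upwards [ae_restrict_mem hA, ae_restrict_of_ae (Lp.coeFn_sub u (ψ n)),
      ae_restrict_of_ae hu.coeFn_toLp] with x hx h2 h3
    rw [h2, Pi.sub_apply, hud, h3, indicator_of_mem hx]
    have := (hK x hx).2.1.trans (le_abs_self K)
    gcongr
    linarith
  have h2 : ‖u - ψ n‖ ^ 2 < ε / (|K| + 1) := by
    rw [← dist_eq_norm]
    calc dist u (ψ n) ^ 2 < Real.sqrt (ε / (|K| + 1)) ^ 2 :=
          pow_lt_pow_left₀ hn dist_nonneg two_ne_zero
      _ = ε / (|K| + 1) := Real.sq_sqrt (by positivity)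
  have h3 : (|K| + 1) * ‖u - ψ n‖ ^ 2 < ε := by
    rwa [lt_div_iff₀' hK1] at h2
  linarith

/-- The functional `v ↦ ∫_A ⟨ψ, v⟩`. -/
def setDual (hA : MeasurableSet A) (ψ : Lp (E d) 2 (volume : Measure 𝕏)) :
    StrongDual ℝ (Lp (E d) 2 (volume : Measure 𝕏)) :=
  innerSL ℝ ((Lp.memLp ψ).indicator hA).toLp

theorem setDual_apply (hA : MeasurableSet A) (ψ v : Lp (E d) 2 (volume : Measure 𝕏)) :
    setDual hA ψ v = ∫ x in A, inner ℝ (ψ x) (v x) := by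
  rw [setDual, innerSL_apply_apply, L2.inner_def, ← integral_indicator hA]
  refine integral_congr_ae ?_
  filter_upwards [((Lp.memLp ψ).indicator hA).coeFn_toLp] with x hx
  rw [hx]
  by_cases h : x ∈ A
  · simp [h]
  · simp [h]

variable [TopologicalSpace 𝕏] {T : ℝ}

/-- `2 ∫_A ⟨ψ, f(t)⟩ - ∫_A ρ(t) |ψ|²`. -/
def dualEnergy (A : Set 𝕏) (ρ : ℝ → 𝕏 → ℝ) (ψ : Lp (E d) 2 (volume : Measure 𝕏))
    (f : WeaklyContinuous 𝕏 T (E d) 2) (t : ℝ) : ℝ :=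
  2 * (∫ x in A, inner ℝ (ψ x) (valueAt f t x)) - ∫ x in A, ρ t x * ‖ψ x‖ ^ 2

/-- The supremum of finitely many dual energies. -/
def lowerEnergy (A : Set 𝕏) (ρ : ℝ → 𝕏 → ℝ) (ψ : ℕ → Lp (E d) 2 (volume : Measure 𝕏))
    (f : WeaklyContinuous 𝕏 T (E d) 2) (N : ℕ) (t : ℝ) : ℝ :=
  partialSups (fun n => dualEnergy A ρ (ψ n) f t) N

theorem lowerEnergy_succ (A : Set 𝕏) (ρ : ℝ → 𝕏 → ℝ) (ψ : ℕ → Lp (E d) 2 (volume : Measure 𝕏))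
    (f : WeaklyContinuous 𝕏 T (E d) 2) (N : ℕ) (t : ℝ) :
    lowerEnergy A ρ ψ f (N + 1) t
      = max (lowerEnergy A ρ ψ f N t) (dualEnergy A ρ (ψ (N + 1)) f t) :=
  partialSups_add_one _ _

theorem valueAt_integral_inner (hA : MeasurableSet A) (ψ : Lp (E d) 2 (volume : Measure 𝕏))
    (f : WeaklyContinuous 𝕏 T (E d) 2) {t : ℝ} (ht : t ∈ Icc 0 T) :
    ∫ x in A, inner ℝ (ψ x) (valueAt f t x) = pairing (setDual hA ψ) f ⟨t, ht⟩ := by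
  rw [pairing_apply, setDual_apply, valueAt_eq f ht]

theorem abs_lowerEnergy_sub_le (hA : MeasurableSet A) (ρ : ℝ → 𝕏 → ℝ)
    (ψ : ℕ → Lp (E d) 2 (volume : Measure 𝕏)) (f g : WeaklyContinuous 𝕏 T (E d) 2) (N : ℕ) {t : ℝ}
    (ht : t ∈ Icc 0 T) :
    |lowerEnergy A ρ ψ f N t - lowerEnergy A ρ ψ g N t|
      ≤ ∑ n ∈ Finset.range (N + 1),
        2 * dist (pairing (setDual hA (ψ n)) f) (pairing (setDual hA (ψ n)) g) := by
  have hpt : ∀ n, |dualEnergy A ρ (ψ n) f t - dualEnergy A ρ (ψ n) g t|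
      ≤ 2 * dist (pairing (setDual hA (ψ n)) f) (pairing (setDual hA (ψ n)) g) := fun n => by
    rw [dualEnergy, dualEnergy, sub_sub_sub_cancel_right, ← mul_sub, abs_mul, abs_two,
      valueAt_integral_inner hA _ _ ht, valueAt_integral_inner hA _ _ ht]
    rw [← Real.dist_eq]
    exact mul_le_mul_of_nonneg_left (ContinuousMap.dist_apply_le_dist _) zero_le_two
  induction N with
  | zero =>
    rw [Finset.sum_range_one]
    exact hpt 0
  | succ N ih =>
    rw [lowerEnergy_succ, lowerEnergy_succ, Finset.sum_range_succ]
    refine (abs_max_sub_max_le_max _ _ _ _).trans (max_le (ih.trans ?_) ((hpt (N + 1)).trans ?_))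
    · exact le_add_of_nonneg_right (by positivity)
    · exact le_add_of_nonneg_left (Finset.sum_nonneg fun _ _ => by positivity)

variable [SecondCountableTopology 𝕏] [BorelSpace 𝕏] [SigmaFinite (volume : Measure 𝕏)]

theorem integrableOn_dualEnergy (hA : MeasurableSet A) {ρ : ℝ → 𝕏 → ℝ} {K : ℝ}
    (hρ : ContinuousOn (fun y : ℝ × 𝕏 => ρ y.1 y.2) (Icc 0 T ×ˢ univ))
    (hK : ∀ t ∈ Icc 0 T, ∀ x ∈ A, 0 < ρ t x ∧ ρ t x ≤ K ∧ (ρ t x)⁻¹ ≤ K)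
    (ψ : Lp (E d) 2 (volume : Measure 𝕏)) (f : WeaklyContinuous 𝕏 T (E d) 2) :
    IntegrableOn (dualEnergy A ρ ψ f) (Ioo 0 T) := by
  have h1 : IntegrableOn (fun t => ∫ x in A, inner ℝ (ψ x) (valueAt f t x)) (Ioo 0 T) := by
    refine (ContinuousOn.integrableOn_compact isCompact_Icc ?_).mono_set Ioo_subset_Icc_self
    rw [continuousOn_iff_continuous_domRestrict]
    refine (pairing (setDual hA ψ) f).continuous.congr fun t => ?_
    exact (valueAt_integral_inner hA ψ f t.2).symm
  have h2 : IntegrableOn (fun t => ∫ x in A, ρ t x * ‖ψ x‖ ^ 2) (Ioo 0 T) := by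
    have hm : AEStronglyMeasurable (fun y : ℝ × 𝕏 => ρ y.1 y.2 * ‖ψ y.2‖ ^ 2)
        ((volume.restrict (Ioo 0 T)).prod (volume.restrict A)) := by
      refine AEStronglyMeasurable.mul ?_ ?_
      · rw [Measure.prod_restrict]
        refine (hρ.mono (prod_mono Ioo_subset_Icc_self (subset_univ A))).aestronglyMeasurable
          (measurableSet_Ioo.prod hA)
      · exact ((Lp.aestronglyMeasurable ψ).restrict.norm.pow 2).comp_snd
    have hb : Integrable (fun y : ℝ × 𝕏 => ρ y.1 y.2 * ‖ψ y.2‖ ^ 2)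
        ((volume.restrict (Ioo 0 T)).prod (volume.restrict A)) := by
      have hd : Integrable (fun y : ℝ × 𝕏 => K * ‖ψ y.2‖ ^ 2)
          ((volume.restrict (Ioo 0 T)).prod (volume.restrict A)) :=
        ((integrable_norm_sq ψ).integrableOn.comp_snd (volume.restrict (Ioo 0 T))).const_mul K
      refine hd.mono' hm ?_
      rw [Measure.prod_restrict]
      refine (ae_restrict_mem (measurableSet_Ioo.prod hA)).mono fun y hy => ?_
      have h := hK y.1 (Ioo_subset_Icc_self hy.1) y.2 hy.2
      rw [norm_mul, norm_pow, norm_norm, Real.norm_of_nonneg h.1.le]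
      exact mul_le_mul_of_nonneg_right h.2.1 (by positivity)
    exact hb.integral_prod_left
  exact (h1.const_mul 2).sub h2

theorem integrableOn_lowerEnergy (hA : MeasurableSet A) {ρ : ℝ → 𝕏 → ℝ} {K : ℝ}
    (hρ : ContinuousOn (fun y : ℝ × 𝕏 => ρ y.1 y.2) (Icc 0 T ×ˢ univ))
    (hK : ∀ t ∈ Icc 0 T, ∀ x ∈ A, 0 < ρ t x ∧ ρ t x ≤ K ∧ (ρ t x)⁻¹ ≤ K)
    (ψ : ℕ → Lp (E d) 2 (volume : Measure 𝕏)) (f : WeaklyContinuous 𝕏 T (E d) 2) (N : ℕ) :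
    IntegrableOn (lowerEnergy A ρ ψ f N) (Ioo 0 T) := by
  induction N with
  | zero => exact integrableOn_dualEnergy hA hρ hK (ψ 0) f
  | succ N ih =>
    have h := ih.sup (integrableOn_dualEnergy hA hρ hK (ψ (N + 1)) f)
    refine h.congr (Eventually.of_forall fun t => ?_)
    rw [lowerEnergy_succ]
    rfl

/-- Each dual energy is affine in the state and depends on it only through one pairing, and taking
maxima does not increase the sup-distance. So the variation is bounded, uniformly in time, by
finitely many continuous quantities. The full energy would only be lower semicontinuous. -/
theorem continuous_integral_lowerEnergy (hA : MeasurableSet A) {ρ : ℝ → 𝕏 → ℝ} {K : ℝ}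
    (hρ : ContinuousOn (fun y : ℝ × 𝕏 => ρ y.1 y.2) (Icc 0 T ×ˢ univ))
    (hK : ∀ t ∈ Icc 0 T, ∀ x ∈ A, 0 < ρ t x ∧ ρ t x ≤ K ∧ (ρ t x)⁻¹ ≤ K)
    (ψ : ℕ → Lp (E d) 2 (volume : Measure 𝕏)) (N : ℕ) :
    Continuous fun f : WeaklyContinuous 𝕏 T (E d) 2 =>
      ∫ t in Ioo 0 T, lowerEnergy A ρ ψ f N t := by
  rw [continuous_iff_continuousAt]
  intro f
  have hlim : Tendsto (fun g : WeaklyContinuous 𝕏 T (E d) 2 => (∑ n ∈ Finset.range (N + 1),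
      2 * dist (pairing (setDual hA (ψ n)) g) (pairing (setDual hA (ψ n)) f))
        * volume.real (Ioo (0 : ℝ) T)) (𝓝 f) (𝓝 0) := by
    have hc : Continuous fun g : WeaklyContinuous 𝕏 T (E d) 2 => (∑ n ∈ Finset.range (N + 1),
        2 * dist (pairing (setDual hA (ψ n)) g) (pairing (setDual hA (ψ n)) f))
          * volume.real (Ioo (0 : ℝ) T) :=
      (continuous_finsetSum _ fun n _ => continuous_const.mul
        ((continuous_pairing _).dist continuous_const)).mul continuous_const
    exact hc.tendsto' _ _ (by simp)
  rw [ContinuousAt, tendsto_iff_dist_tendsto_zero]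
  refine squeeze_zero (fun _ => dist_nonneg) (fun g => ?_) hlim
  rw [dist_eq_norm, ← integral_sub (integrableOn_lowerEnergy hA hρ hK ψ g N)
    (integrableOn_lowerEnergy hA hρ hK ψ f N)]
  exact norm_setIntegral_le_of_norm_le_const measure_Ioo_lt_top fun t ht =>
    abs_lowerEnergy_sub_le hA ρ ψ g f N (Ioo_subset_Icc_self ht)

theorem lowerEnergy_le (hA : MeasurableSet A) {ρ : ℝ → 𝕏 → ℝ} {K : ℝ}
    (hρ : ContinuousOn (fun y : ℝ × 𝕏 => ρ y.1 y.2) (Icc 0 T ×ˢ univ))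
    (hK : ∀ t ∈ Icc 0 T, ∀ x ∈ A, 0 < ρ t x ∧ ρ t x ≤ K ∧ (ρ t x)⁻¹ ≤ K)
    (ψ : ℕ → Lp (E d) 2 (volume : Measure 𝕏)) (f : WeaklyContinuous 𝕏 T (E d) 2) (N : ℕ)
    {t : ℝ} (ht : t ∈ Icc 0 T) :
    lowerEnergy A ρ ψ f N t ≤ ∫ x in A, (ρ t x)⁻¹ * ‖valueAt f t x‖ ^ 2 := by
  refine partialSups_le _ _ _ fun n _ => ?_
  have hr : Continuous (ρ t) := by
    rw [← continuousOn_univ]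
    exact hρ.comp (Continuous.prodMk_right t).continuousOn fun x _ => ⟨ht, mem_univ x⟩
  rw [dualEnergy, valueAt_eq f ht]
  exact two_mul_integral_inner_sub_le hA hr.aestronglyMeasurable (hK t ht) _ _

theorem tendsto_lowerEnergy (hA : MeasurableSet A) {ρ : ℝ → 𝕏 → ℝ} {K : ℝ}
    (hρ : ContinuousOn (fun y : ℝ × 𝕏 => ρ y.1 y.2) (Icc 0 T ×ˢ univ))
    (hK : ∀ t ∈ Icc 0 T, ∀ x ∈ A, 0 < ρ t x ∧ ρ t x ≤ K ∧ (ρ t x)⁻¹ ≤ K)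
    {ψ : ℕ → Lp (E d) 2 (volume : Measure 𝕏)} (hψ : DenseRange ψ)
    (f : WeaklyContinuous 𝕏 T (E d) 2) {t : ℝ} (ht : t ∈ Icc 0 T) :
    Tendsto (fun N => lowerEnergy A ρ ψ f N t) atTop
      (𝓝 (∫ x in A, (ρ t x)⁻¹ * ‖valueAt f t x‖ ^ 2)) := by
  have hr : Continuous (ρ t) := by
    rw [← continuousOn_univ]
    exact hρ.comp (Continuous.prodMk_right t).continuousOn fun x _ => ⟨ht, mem_univ x⟩
  refine tendsto_order.2 ⟨fun a ha => ?_, fun a ha => Eventually.of_forall fun N =>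
    (lowerEnergy_le hA hρ hK ψ f N ht).trans_lt ha⟩
  rw [valueAt_eq f ht] at ha
  obtain ⟨n, hn⟩ := exists_lt_two_mul_integral_inner_sub hA hr.aestronglyMeasurable (hK t ht) hψ
    (toLpAt f ⟨t, ht⟩) (sub_pos.2 ha)
  rw [sub_sub_cancel] at hn
  filter_upwards [eventually_ge_atTop n] with N hN
  refine lt_of_lt_of_le ?_ (le_partialSups_of_le (fun n => dualEnergy A ρ (ψ n) f t) hN)
  rw [dualEnergy, valueAt_eq f ht]
  exact hn

end LowerEnergy

section Saturation

set_option linter.unusedSectionVars false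

variable {d : ℕ} {𝕏 : Type} [AddCommGroup 𝕏] [TopologicalSpace 𝕏] [MeasureSpace 𝕏] [T2Space 𝕏]
  [SecondCountableTopology 𝕏] [BorelSpace 𝕏] [IsFiniteMeasureOnCompacts (volume : Measure 𝕏)]
  [SigmaFinite (volume : Measure 𝕏)]

variable {π : E d → 𝕏} {γ T : ℝ} [Fact (1 < γ)] {Ω : Set 𝕏} {z₀ : Quadruple d 𝕏}
variable {xc : E d} {R r₀ : ℝ} {w : StateSpace d 𝕏 γ T} {m : ℝ → 𝕏 → E d}
  {M : ℝ → 𝕏 → Matrix (Fin d) (Fin d) ℝ}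

/-! ### Constraints satisfied by all limits -/

theorem valueAt_density_of_mem_closure {t : ℝ} (ht : t ∈ Icc 0 T)
    (hw : w ∈ fixedDensitySpace π γ T Ω z₀) : valueAt w.1 t =ᵐ[volume] z₀.ρ t :=
  ae_mem_of_mem_closure (A := fixedApproximatingSpace π γ T Ω z₀) (π := Prod.fst) continuous_fst
    (S := fun x => {z₀.ρ t x}) (fun _ => convex_singleton _) (fun _ => isClosed_singleton) ht
    (fun _ hv => hv.2 t ht) hw

theorem ae_mem_of_mem_fixedDensitySpace [(volume : Measure 𝕏).IsOpenPosMeasure]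
    (hΩ : IsOpen Ω) (hz : IsStrictSubsolution π γ T Ω z₀)
    {S : 𝕏 → Set (E d)} (hS : ∀ x, Convex ℝ (S x)) (hS' : ∀ x, IsClosed (S x)) {t : ℝ}
    (ht : t ∈ Icc 0 T)
    (h : ∀ w m M, IsFixedSubsolution π γ T Ω z₀ w m M → ∀ᵐ x, m t x ∈ S x)
    (hw : w ∈ fixedDensitySpace π γ T Ω z₀) : ∀ᵐ x, valueAt w.2 t x ∈ S x := by
  refine ae_mem_of_mem_closure (A := fixedApproximatingSpace π γ T Ω z₀) (π := Prod.snd)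
    continuous_snd hS hS' ht (fun v hv => ?_) hw
  obtain ⟨m, M, hm⟩ := exists_isFixedSubsolution hΩ hz hv
  filter_upwards [h v m M hm, hm.momentum t ht] with x h1 h2
  rw [h2]
  exact h1

theorem valueAt_endpoints [(volume : Measure 𝕏).IsOpenPosMeasure]
    (hT : 0 ≤ T) (hΩ : IsOpen Ω) (hz : IsStrictSubsolution π γ T Ω z₀)
    {t : ℝ} (ht : t ∈ ({0, T} : Set ℝ)) (hw : w ∈ fixedDensitySpace π γ T Ω z₀) :
    valueAt w.2 t =ᵐ[volume] z₀.m t := by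
  have ht' : t ∈ Icc 0 T := by
    rcases ht with rfl | rfl
    · exact left_mem_Icc.2 hT
    · exact right_mem_Icc.2 hT
  exact ae_mem_of_mem_fixedDensitySpace hΩ hz (S := fun x => {z₀.m t x})
    (fun _ => convex_singleton _) (fun _ => isClosed_singleton) ht'
    (fun _ _ _ h => h.endpoints t ht) hw

theorem valueAt_outside [(volume : Measure 𝕏).IsOpenPosMeasure]
    (hΩ : IsOpen Ω) (hz : IsStrictSubsolution π γ T Ω z₀)
    {t : ℝ} (ht : t ∈ Icc 0 T) (hw : w ∈ fixedDensitySpace π γ T Ω z₀) :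
    ∀ᵐ x, x ∉ Ω → valueAt w.2 t x = z₀.m t x := by
  refine ae_mem_of_mem_fixedDensitySpace hΩ hz (S := fun x => {v | x ∉ Ω → v = z₀.m t x})
    (fun x => ?_) (fun x => ?_) ht
    (fun _ _ _ h => Eventually.of_forall fun x hx => (h.outside t ht x hx).1) hw
  · by_cases hx : x ∈ Ω
    · simp [hx, convex_univ]
    · simp [hx, convex_singleton]
  · by_cases hx : x ∈ Ω
    · simp [hx]
    · simp [hx]

/-- The map v ↦ |v|²/ρ₀ is convex and continuous, so its sublevel sets are convex and closed and the
bound passes to weak limits. The lower strict inequality of X₀ and the flux itself leave no trace in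
the closure. -/
theorem norm_sq_valueAt_le [(volume : Measure 𝕏).IsOpenPosMeasure]
    (hΩ : IsOpen Ω) (hz : IsStrictSubsolution π γ T Ω z₀)
    {t : ℝ} (ht : t ∈ Ioo 0 T) (hw : w ∈ fixedDensitySpace π γ T Ω z₀) :
    ∀ᵐ x, x ∈ Ω → (z₀.ρ t x)⁻¹ * ‖valueAt w.2 t x‖ ^ 2
      ≤ d * (z₀.Q t x - pressure γ (z₀.ρ t x)) := by
  refine ae_mem_of_mem_fixedDensitySpace hΩ hz (S := fun x => {v | x ∈ Ω → (z₀.ρ t x)⁻¹ * ‖v‖ ^ 2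
      ≤ d * (z₀.Q t x - pressure γ (z₀.ρ t x))})
    (fun x => ?_) (fun x => ?_) (Ioo_subset_Icc_self ht)
    (fun _ _ _ h => Eventually.of_forall fun x hx => ?_) hw
  · by_cases hx : x ∈ Ω
    · have hc : ConvexOn ℝ univ fun v : E d => (z₀.ρ t x)⁻¹ * ‖v‖ ^ 2 :=
        ((convexOn_univ_norm (E := E d)).pow (fun _ _ => norm_nonneg _) 2).smul
          (inv_pos.2 (hz.pos t (Ioo_subset_Icc_self ht) x)).le
      simpa [hx] using hc.convex_le (d * (z₀.Q t x - pressure γ (z₀.ρ t x)))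
    · simpa [hx] using convex_univ
  · by_cases hx : x ∈ Ω
    · simp only [hx, true_imp_iff]
      exact isClosed_le (by fun_prop) continuous_const
    · simp [hx]
  · rw [← div_eq_inv_mul]
    exact (h.norm_sq_lt hz ht hx).le

/-! ### Integrals over the image of a cylinder -/

theorem setIntegral_image_ball_of_continuousOn (hπ : IsFlatCovering π)
    (hc : IsInteriorChart π Ω xc R r₀) {f : ℝ → 𝕏 → ℝ}
    (hf : ContinuousOn (fun y : ℝ × 𝕏 => f y.1 y.2) (Icc 0 T ×ˢ Ω)) {t : ℝ} (ht : t ∈ Icc 0 T) :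
    ∫ x in π '' Metric.ball xc r₀, f t x = ∫ y in Metric.ball xc r₀, pull π f (t, y) := by
  refine setIntegral_image_ball hπ hc.chart hc.lt.le (ContinuousOn.aestronglyMeasurable ?_
    (hπ.isOpenQuotientMap.isOpenMap _ Metric.isOpen_ball).measurableSet)
  exact hf.comp (Continuous.prodMk_right t).continuousOn fun x hx =>
    ⟨ht, hc.image_subset (image_mono Metric.ball_subset_closedBall hx)⟩

theorem integrableOn_image_ball (hπ : IsFlatCovering π) (hc : IsInteriorChart π Ω xc R r₀)
    {f : ℝ → 𝕏 → ℝ} (hf : ContinuousOn (fun y : ℝ × 𝕏 => f y.1 y.2) (Icc 0 T ×ˢ Ω)) {t : ℝ}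
    (ht : t ∈ Icc 0 T) : IntegrableOn (f t) (π '' Metric.ball xc r₀) := by
  have hK : IsCompact (π '' Metric.closedBall xc r₀) :=
    (isCompact_closedBall xc r₀).image hπ.isOpenQuotientMap.continuous
  refine (ContinuousOn.integrableOn_compact hK ?_).mono_set
    (image_mono Metric.ball_subset_closedBall)
  exact hf.comp (Continuous.prodMk_right t).continuousOn fun x hx => ⟨ht, hc.image_subset hx⟩

theorem integrableOn_integral_image_ball (hπ : IsFlatCovering π)
    (hc : IsInteriorChart π Ω xc R r₀) {f : ℝ → 𝕏 → ℝ}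
    (hf : ContinuousOn (fun y : ℝ × 𝕏 => f y.1 y.2) (Icc 0 T ×ˢ Ω)) :
    IntegrableOn (fun t => ∫ x in π '' Metric.ball xc r₀, f t x) (Ioo 0 T) ∧
      ∫ t in Ioo 0 T, ∫ x in π '' Metric.ball xc r₀, f t x
        = ∫ y in cylinder T xc r₀, pull π f y := by
  have hi : IntegrableOn (pull π f) (Ioo 0 T ×ˢ Metric.ball xc r₀)
      ((volume : Measure ℝ).prod (volume : Measure (E d))) :=
    integrableOn_cylinder (continuousOn_pull hπ.isOpenQuotientMap.continuous hc hf)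
  have heq : ∀ t ∈ Ioo 0 T, ∫ x in π '' Metric.ball xc r₀, f t x
      = ∫ y in Metric.ball xc r₀, pull π f (t, y) := fun t ht =>
    setIntegral_image_ball_of_continuousOn hπ hc hf (Ioo_subset_Icc_self ht)
  constructor
  · have h1 := hi
    rw [IntegrableOn, ← Measure.prod_restrict] at h1
    exact (integrableOn_congr_fun heq measurableSet_Ioo).2 h1.integral_prod_left
  · rw [setIntegral_congr_fun measurableSet_Ioo heq]
    exact (setIntegral_prod _ hi).symm

theorem continuousOn_pressure_gap (hz : IsStrictSubsolution π γ T Ω z₀) :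
    ContinuousOn (fun y : ℝ × 𝕏 => (d : ℝ) * (z₀.Q y.1 y.2 - pressure γ (z₀.ρ y.1 y.2)))
      (Icc 0 T ×ˢ Ω) :=
  ((hz.continuous_pressure.sub (continuousOn_pressure hz)).mono
    (prod_mono_right (subset_univ _))).const_mul _

theorem IsFixedSubsolution.continuousOn_energy (hz : IsStrictSubsolution π γ T Ω z₀)
    (h : IsFixedSubsolution π γ T Ω z₀ w m M) :
    ContinuousOn (fun y : ℝ × 𝕏 => (z₀.ρ y.1 y.2)⁻¹ * ‖m y.1 y.2‖ ^ 2) (Icc 0 T ×ˢ Ω) :=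
  ((hz.continuous_density.mono (prod_mono_right (subset_univ _))).inv₀ fun y hy =>
    (hz.pos y.1 hy.1 y.2).ne').mul (h.continuous_momentum.norm.pow 2)

/-! ### The generic state saturates the energy constraint -/

/-- The states whose energy is close to maximal on the image of a cylinder, as witnessed by finitely
many dual energies. -/
def energySet (π : E d → 𝕏) (γ T : ℝ) [Fact (1 < γ)] (z₀ : Quadruple d 𝕏) (xc : E d) (r₀ : ℝ)
    (ψ : ℕ → Lp (E d) 2 (volume : Measure 𝕏)) (ε : ℝ) : Set (StateSpace d 𝕏 γ T) :=
  {w | ∃ N, (∫ t in Ioo 0 T, ∫ x in π '' Metric.ball xc r₀,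
      d * (z₀.Q t x - pressure γ (z₀.ρ t x))) - ε
    < ∫ t in Ioo 0 T, lowerEnergy (π '' Metric.ball xc r₀) z₀.ρ ψ w.2 N t}

theorem measurableSet_image_ball (hπ : IsFlatCovering π) (xc : E d) (r₀ : ℝ) :
    MeasurableSet (π '' Metric.ball xc r₀) :=
  (hπ.isOpenQuotientMap.isOpenMap _ Metric.isOpen_ball).measurableSet

theorem exists_density_bound (hπ : IsFlatCovering π) (hz : IsStrictSubsolution π γ T Ω z₀)
    (xc : E d) (r₀ : ℝ) : ∃ K, ∀ t ∈ Icc 0 T, ∀ x ∈ π '' Metric.ball xc r₀,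
      0 < z₀.ρ t x ∧ z₀.ρ t x ≤ K ∧ (z₀.ρ t x)⁻¹ ≤ K := by
  obtain ⟨K, -, hK, -⟩ := exists_uniform_bound hz
    ((isCompact_closedBall xc r₀).image hπ.isOpenQuotientMap.continuous)
  refine ⟨K, fun t ht x hx => ⟨hz.pos t ht x, ?_⟩⟩
  have := hK t ht x (image_mono Metric.ball_subset_closedBall hx)
  exact ⟨this.1, this.2.1⟩

theorem isOpen_energySet (hπ : IsFlatCovering π) (hz : IsStrictSubsolution π γ T Ω z₀)
    (xc : E d) (r₀ : ℝ) (ψ : ℕ → Lp (E d) 2 (volume : Measure 𝕏)) (ε : ℝ) :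
    IsOpen (energySet π γ T z₀ xc r₀ ψ ε) := by
  obtain ⟨K, hK⟩ := exists_density_bound hπ hz xc r₀
  rw [energySet, ofPred_exists]
  exact isOpen_iUnion fun N => isOpen_lt continuous_const
    ((continuous_integral_lowerEnergy (measurableSet_image_ball hπ xc r₀) hz.continuous_density hK
      ψ N).comp continuous_snd)

/-- A small gap means nearly maximal energy, and the dual energies increase to the energy by density
of `ψ`, so finitely many of them witness it. -/
theorem exists_mem_energySet (hπ : IsFlatCovering π) (hΩ : IsOpen Ω)
    (hz : IsStrictSubsolution π γ T Ω z₀) (hc : IsInteriorChart π Ω xc R r₀)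
    {ψ : ℕ → Lp (E d) 2 (volume : Measure 𝕏)} (hψ : DenseRange ψ) {ε : ℝ} (hε : 0 < ε)
    (h : IsFixedSubsolution π γ T Ω z₀ w m M) {V : Set (StateSpace d 𝕏 γ T)} (hV : IsOpen V)
    (hw : w ∈ V) :
    ∃ w' m' M', IsFixedSubsolution π γ T Ω z₀ w' m' M' ∧ w' ∈ V ∧
      w' ∈ energySet π γ T z₀ xc r₀ ψ ε := by
  -- The energy deficit is `d` times the integrated gap; dividing by `d + 1` also covers `d = 0`.
  obtain ⟨w', m', M', h', hV', hgap⟩ := exists_small_gap hπ hΩ hz hc h hV hw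
    (show 0 < ε / (d + 1) by positivity)
  refine ⟨w', m', M', h', hV', ?_⟩
  obtain ⟨K, hK⟩ := exists_density_bound hπ hz xc r₀
  have hA := measurableSet_image_ball hπ xc r₀
  set A := π '' Metric.ball xc r₀ with hAd
  obtain ⟨he1, he2⟩ := integrableOn_integral_image_ball hπ hc
    (f := fun t x => (z₀.ρ t x)⁻¹ * ‖m' t x‖ ^ 2) (h'.continuousOn_energy hz)
  obtain ⟨hq1, hq2⟩ := integrableOn_integral_image_ball hπ hc
    (f := fun t x => d * (z₀.Q t x - pressure γ (z₀.ρ t x))) (continuousOn_pressure_gap hz)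
  have hval : ∀ t ∈ Icc 0 T, ∫ x in A, (z₀.ρ t x)⁻¹ * ‖valueAt w'.2 t x‖ ^ 2
      = ∫ x in A, (z₀.ρ t x)⁻¹ * ‖m' t x‖ ^ 2 := fun t ht => by
    refine integral_congr_ae (ae_restrict_of_ae ?_)
    filter_upwards [h'.momentum t ht] with x hx
    rw [hx]
  have hlim : Tendsto (fun N => ∫ t in Ioo 0 T, lowerEnergy A z₀.ρ ψ w'.2 N t) atTop
      (𝓝 (∫ t in Ioo 0 T, ∫ x in A, (z₀.ρ t x)⁻¹ * ‖m' t x‖ ^ 2)) := by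
    have hi := integrableOn_lowerEnergy hA hz.continuous_density hK ψ w'.2
    -- By monotonicity in `N`, the lower energies lie between the one of index 0 and the energy
    -- itself, and both are integrable in time.
    refine tendsto_integral_of_dominated_convergence
      (fun t => |lowerEnergy A z₀.ρ ψ w'.2 0 t| + |∫ x in A, (z₀.ρ t x)⁻¹ * ‖m' t x‖ ^ 2|)
      (fun N => (hi N).aestronglyMeasurable) ((hi 0).abs.add he1.abs) (fun N => ?_) ?_
    · refine (ae_restrict_mem measurableSet_Ioo).mono fun t ht => ?_
      have h1 : lowerEnergy A z₀.ρ ψ w'.2 0 t ≤ lowerEnergy A z₀.ρ ψ w'.2 N t :=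
        (partialSups _).mono (Nat.zero_le N)
      have h2 := lowerEnergy_le hA hz.continuous_density hK ψ w'.2 N (Ioo_subset_Icc_self ht)
      rw [hval t (Ioo_subset_Icc_self ht)] at h2
      rw [Real.norm_eq_abs, abs_le]
      constructor
      · linarith [neg_abs_le (lowerEnergy A z₀.ρ ψ w'.2 0 t),
          abs_nonneg (∫ x in A, (z₀.ρ t x)⁻¹ * ‖m' t x‖ ^ 2)]
      · linarith [le_abs_self (∫ x in A, (z₀.ρ t x)⁻¹ * ‖m' t x‖ ^ 2),
          abs_nonneg (lowerEnergy A z₀.ρ ψ w'.2 0 t)]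
    · refine (ae_restrict_mem measurableSet_Ioo).mono fun t ht => ?_
      rw [← hval t (Ioo_subset_Icc_self ht)]
      exact tendsto_lowerEnergy hA hz.continuous_density hK hψ w'.2 (Ioo_subset_Icc_self ht)
  have hlt : (∫ t in Ioo 0 T, ∫ x in A, d * (z₀.Q t x - pressure γ (z₀.ρ t x))) - ε
      < ∫ t in Ioo 0 T, ∫ x in A, (z₀.ρ t x)⁻¹ * ‖m' t x‖ ^ 2 := by
    have hkin : ∫ y in cylinder T xc r₀, pull π (fun t x => (z₀.ρ t x)⁻¹ * ‖m' t x‖ ^ 2) y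
        = kinetic π z₀ (cylinder T xc r₀) m' := rfl
    have hpre : ∫ y in cylinder T xc r₀,
        pull π (fun t x => (d : ℝ) * (z₀.Q t x - pressure γ (z₀.ρ t x))) y
        = d * ∫ y in cylinder T xc r₀, (pull π z₀.Q y - pressure γ (pull π z₀.ρ y)) :=
      integral_const_mul _ _
    rw [he2, hq2, hkin, hpre, h'.kinetic_eq hπ.isOpenQuotientMap.continuous hc hz]
    have h0 : 0 ≤ ∫ y in cylinder T xc r₀, gap π γ z₀ m' y :=
      setIntegral_nonneg (measurableSet_cylinder T xc r₀) fun y hy => (h'.gap_pos hz hc hy).le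
    rw [lt_div_iff₀ (by positivity)] at hgap
    nlinarith
  exact (hlim.eventually (lt_mem_nhds hlt)).exists

/-- The pointwise inequality `norm_sq_valueAt_le` is already known, so it suffices that the spatial
integrals agree at almost every time. Only the upper bound of the lower energies by the energy is
used, so `ψ` need not be dense here. -/
theorem energy_eq_of_forall_mem_energySet [(volume : Measure 𝕏).IsOpenPosMeasure]
    (hπ : IsFlatCovering π) (hΩ : IsOpen Ω)
    (hz : IsStrictSubsolution π γ T Ω z₀) (hc : IsInteriorChart π Ω xc R r₀)
    {ψ : ℕ → Lp (E d) 2 (volume : Measure 𝕏)} (hw : w ∈ fixedDensitySpace π γ T Ω z₀)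
    (hG : ∀ k : ℕ, w ∈ energySet π γ T z₀ xc r₀ ψ (1 / ((k : ℝ) + 1))) :
    ∀ᵐ t ∂(volume.restrict (Ioo 0 T)), ∀ᵐ x ∂(volume.restrict (π '' Metric.ball xc r₀)),
      (z₀.ρ t x)⁻¹ * ‖valueAt w.2 t x‖ ^ 2 = d * (z₀.Q t x - pressure γ (z₀.ρ t x)) := by
  obtain ⟨K, hK⟩ := exists_density_bound hπ hz xc r₀
  have hA := measurableSet_image_ball hπ xc r₀
  set A := π '' Metric.ball xc r₀ with hAd
  have hAΩ : A ⊆ Ω := (image_mono Metric.ball_subset_closedBall).trans hc.image_subset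
  obtain ⟨hq1, -⟩ := integrableOn_integral_image_ball hπ hc
    (f := fun t x => d * (z₀.Q t x - pressure γ (z₀.ρ t x))) (continuousOn_pressure_gap hz)
  choose N hN using hG
  set q : ℝ → 𝕏 → ℝ := fun t x => d * (z₀.Q t x - pressure γ (z₀.ρ t x)) with hq
  have hvi : ∀ t ∈ Icc 0 T, IntegrableOn (fun x => (z₀.ρ t x)⁻¹ * ‖valueAt w.2 t x‖ ^ 2) A := by
    intro t ht
    rw [valueAt_eq w.2 ht]
    have hr : Continuous (z₀.ρ t) := by
      rw [← continuousOn_univ]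
      exact hz.continuous_density.comp (Continuous.prodMk_right t).continuousOn
        fun x _ => ⟨ht, mem_univ x⟩
    exact integrable_weight_mul_norm_sq (r := fun x => (z₀.ρ t x)⁻¹) hA
      hr.aestronglyMeasurable.aemeasurable.inv.aestronglyMeasurable
      (fun x hx => (abs_of_pos (inv_pos.2 (hK t ht x hx).1)).trans_le (hK t ht x hx).2.2) _
  have hle : ∀ t ∈ Ioo 0 T, ∀ᵐ x ∂(volume.restrict A),
      (z₀.ρ t x)⁻¹ * ‖valueAt w.2 t x‖ ^ 2 ≤ q t x := fun t ht => by
    filter_upwards [ae_restrict_of_ae (norm_sq_valueAt_le hΩ hz ht hw), ae_restrict_mem hA]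
      with x h1 h2
    exact h1 (hAΩ h2)
  have hmono : ∀ t ∈ Ioo 0 T, ∫ x in A, (z₀.ρ t x)⁻¹ * ‖valueAt w.2 t x‖ ^ 2 ≤ ∫ x in A, q t x :=
    fun t ht => integral_mono_ae (hvi t (Ioo_subset_Icc_self ht))
      (integrableOn_image_ball hπ hc (f := q) (continuousOn_pressure_gap hz) (Ioo_subset_Icc_self ht))
      (hle t ht)
  set u : ℕ → ℝ → ℝ := fun k t => (∫ x in A, q t x) - lowerEnergy A z₀.ρ ψ w.2 (N k) t with hu
  have hui : ∀ k, IntegrableOn (u k) (Ioo 0 T) := fun k =>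
    hq1.sub (integrableOn_lowerEnergy hA hz.continuous_density hK ψ w.2 (N k))
  have hu0 : ∀ k, ∀ t ∈ Ioo 0 T, 0 ≤ u k t := fun k t ht => sub_nonneg.2
    ((lowerEnergy_le hA hz.continuous_density hK ψ w.2 (N k) (Ioo_subset_Icc_self ht)).trans
      (hmono t ht))
  have hul : ∀ k, ∫⁻ t in Ioo 0 T, ENNReal.ofReal (u k t) ≤ ENNReal.ofReal (1 / ((k : ℝ) + 1)) := by
    intro k
    rw [← ofReal_integral_eq_lintegral_ofReal (hui k)
      ((ae_restrict_mem measurableSet_Ioo).mono (hu0 k))]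
    refine ENNReal.ofReal_le_ofReal ?_
    rw [integral_sub hq1 (integrableOn_lowerEnergy hA hz.continuous_density hK ψ w.2 (N k))]
    linarith [hN k]
  -- The deficits `u k` are nonnegative with integrals tending to zero, but nothing relates the
  -- indices `N k` to one another. The infimum over `k` avoids passing to an almost everywhere
  -- convergent subsequence.
  have hinf : ∫⁻ t in Ioo 0 T, ⨅ k, ENNReal.ofReal (u k t) = 0 := by
    have hlim : Tendsto (fun k : ℕ => ENNReal.ofReal (1 / ((k : ℝ) + 1))) atTop (𝓝 0) := by
      simpa using ENNReal.tendsto_ofReal tendsto_one_div_add_atTop_nhds_zero_nat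
    refine le_antisymm (ge_of_tendsto' hlim fun k => ?_) (zero_le)
    exact (lintegral_mono fun t => iInf_le _ k).trans (hul k)
  rw [lintegral_eq_zero_iff' (AEMeasurable.iInf fun k =>
    (hui k).aestronglyMeasurable.aemeasurable.ennreal_ofReal)] at hinf
  filter_upwards [hinf, ae_restrict_mem measurableSet_Ioo] with t ht htI
  have hge : ∫ x in A, q t x ≤ ∫ x in A, (z₀.ρ t x)⁻¹ * ‖valueAt w.2 t x‖ ^ 2 := by
    refine le_of_forall_pos_lt_add fun ε hε => ?_
    have h1 : ⨅ k, ENNReal.ofReal (u k t) < ENNReal.ofReal ε := by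
      rw [ht]
      simpa using hε
    obtain ⟨k, hk⟩ := iInf_lt_iff.1 h1
    have h2 := (ENNReal.ofReal_lt_ofReal_iff hε).1 hk
    have h3 := lowerEnergy_le hA hz.continuous_density hK ψ w.2 (N k) (Ioo_subset_Icc_self htI)
    simp only [hu] at h2
    linarith
  exact (integral_eq_iff_of_ae_le (hvi t (Ioo_subset_Icc_self htI))
    (integrableOn_image_ball hπ hc (f := q) (continuousOn_pressure_gap hz) (Ioo_subset_Icc_self htI))
    (hle t htI)).1 (le_antisymm (hmono t htI) hge)

end Saturation

/-! ### Passing to the limit in the equations -/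

section WeakLimits

/-- For a bounded sequence, convergence of the inner products with a dense set of vectors implies it
for all vectors. -/
theorem tendsto_inner_of_denseRange {H : Type*} [NormedAddCommGroup H] [InnerProductSpace ℝ H]
    {χ : ℕ → H} (hχ : DenseRange χ) {u : ℕ → H} {B : ℝ} (hB : ∀ k, ‖u k‖ ≤ B)
    (h : ∀ n, Tendsto (fun k => (inner ℝ (χ n) (u k) : ℝ)) atTop (𝓝 0)) (f : H) :
    Tendsto (fun k => (inner ℝ f (u k) : ℝ)) atTop (𝓝 0) := by
  have hB0 : 0 ≤ B := (norm_nonneg _).trans (hB 0)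
  rw [Metric.tendsto_nhds]
  intro ε hε
  obtain ⟨n, hn⟩ := hχ.exists_dist_lt f (show 0 < ε / (2 * (B + 1)) by positivity)
  filter_upwards [(Metric.tendsto_nhds.1 (h n)) (ε / 2) (half_pos hε)] with k hk
  rw [Real.dist_0_eq_abs] at hk ⊢
  have h1 : inner ℝ f (u k) = inner ℝ (f - χ n) (u k) + inner ℝ (χ n) (u k) := by
    rw [inner_sub_left]
    ring
  have h2 : |inner ℝ (f - χ n) (u k)| ≤ ε / (2 * (B + 1)) * B := by
    refine (abs_real_inner_le_norm _ _).trans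
      (mul_le_mul ?_ (hB k) (norm_nonneg _) (by positivity))
    rw [← dist_eq_norm]
    exact hn.le
  have h3 : ε / (2 * (B + 1)) * B ≤ ε / 2 := by
    rw [div_mul_eq_mul_div, div_le_div_iff₀ (by positivity) two_pos]
    nlinarith
  rw [h1]
  exact (abs_add_le _ _).trans_lt (by linarith)

variable {d : ℕ} {𝕏 : Type} [MeasureSpace 𝕏] {A : Set 𝕏}

/-- The product of an `L²` function with an indicator function. -/
def cutLp (hA : MeasurableSet A) (v : Lp (E d) 2 (volume : Measure 𝕏)) :
    Lp (E d) 2 (volume : Measure 𝕏) :=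
  ((Lp.memLp v).indicator hA).toLp

theorem inner_cutLp (hA : MeasurableSet A) (f v : Lp (E d) 2 (volume : Measure 𝕏)) :
    inner ℝ f (cutLp hA v) = ∫ x in A, inner ℝ (f x) (v x) := by
  rw [L2.inner_def, ← integral_indicator hA]
  refine integral_congr_ae ?_
  filter_upwards [((Lp.memLp v).indicator hA).coeFn_toLp] with x hx
  rw [cutLp, hx]
  by_cases h : x ∈ A
  · simp [h]
  · simp [h]

theorem norm_cutLp_sq_le (hA : MeasurableSet A) (hAfin : volume A ≠ ∞)
    {v : Lp (E d) 2 (volume : Measure 𝕏)} {K : ℝ} (hK : ∀ᵐ x ∂(volume.restrict A), ‖v x‖ ≤ K) :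
    ‖cutLp hA v‖ ^ 2 ≤ K ^ 2 * volume.real A := by
  rw [← real_inner_self_eq_norm_sq, inner_cutLp]
  have h1 : ∀ᵐ x ∂(volume.restrict A), ‖(inner ℝ (cutLp hA v x) (v x) : ℝ)‖ ≤ K ^ 2 := by
    filter_upwards [hK, ae_restrict_mem hA,
      ae_restrict_of_ae ((Lp.memLp v).indicator hA).coeFn_toLp] with x h1 h2 h3
    rw [cutLp, h3, indicator_of_mem h2, real_inner_self_eq_norm_sq, norm_pow, norm_norm]
    exact pow_le_pow_left₀ (norm_nonneg _) h1 2
  exact (Real.le_norm_self _).trans (norm_setIntegral_le_of_norm_le_const_ae hAfin.lt_top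
    h1)

/-- The pointwise bounds on the finite measure set `A` make the truncated differences bounded in
`L²`, so convergence against the dense sequence extends to every bounded `f`. In the application `f`
may depend on the limit `v`. -/
theorem tendsto_setIntegral_inner (hA : MeasurableSet A) (hAfin : volume A ≠ ∞)
    {χ : ℕ → Lp (E d) 2 (volume : Measure 𝕏)} (hχ : DenseRange χ)
    {a : ℕ → Lp (E d) 2 (volume : Measure 𝕏)} {v : Lp (E d) 2 (volume : Measure 𝕏)}
    (h : ∀ n, Tendsto (fun k => setDual hA (χ n) (a k)) atTop (𝓝 (setDual hA (χ n) v))) {K : ℝ}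
    (ha : ∀ k, ∀ᵐ x ∂(volume.restrict A), ‖a k x‖ ≤ K) (hv : ∀ᵐ x ∂(volume.restrict A), ‖v x‖ ≤ K)
    {f : 𝕏 → E d} (hf : AEStronglyMeasurable f (volume.restrict A)) {L : ℝ}
    (hL : ∀ᵐ x ∂(volume.restrict A), ‖f x‖ ≤ L) :
    (∀ k, IntegrableOn (fun x => inner ℝ (f x) (a k x - v x)) A) ∧
      Tendsto (fun k => ∫ x in A, inner ℝ (f x) (a k x - v x)) atTop (𝓝 0) := by
  have : IsFiniteMeasure ((volume : Measure 𝕏).restrict A) := isFiniteMeasure_restrict.2 hAfin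
  have hmem : MemLp (A.indicator f) 2 (volume : Measure 𝕏) :=
    (memLp_indicator_iff_restrict hA).2 (MemLp.of_bound hf L hL)
  set F := hmem.toLp with hF
  have hpt : ∀ k, ∀ᵐ x ∂(volume.restrict A),
      inner ℝ (F x) ((a k - v : Lp (E d) 2 (volume : Measure 𝕏)) x)
        = (inner ℝ (f x) (a k x - v x) : ℝ) := fun k => by
    filter_upwards [ae_restrict_mem hA, ae_restrict_of_ae hmem.coeFn_toLp,
      ae_restrict_of_ae (Lp.coeFn_sub (a k) v)] with x h1 h2 h3
    rw [hF, h2, indicator_of_mem h1, h3, Pi.sub_apply]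
  refine ⟨fun k => ((integrable_inner_Lp (a k - v) F).integrableOn (s := A)).congr (hpt k), ?_⟩
  have hnorm : ∀ k, ‖cutLp hA (a k - v)‖ ≤ Real.sqrt ((K + K) ^ 2 * volume.real A) := fun k => by
    refine Real.le_sqrt_of_sq_le (norm_cutLp_sq_le hA hAfin ?_)
    filter_upwards [ha k, hv, ae_restrict_of_ae (Lp.coeFn_sub (a k) v)] with x h1 h2 h3
    rw [h3, Pi.sub_apply]
    exact (norm_sub_le _ _).trans (add_le_add h1 h2)
  have hconv : ∀ n, Tendsto (fun k => (inner ℝ (χ n) (cutLp hA (a k - v)) : ℝ)) atTop (𝓝 0) := by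
    intro n
    have h1 := (h n).sub_const (setDual hA (χ n) v)
    rw [sub_self] at h1
    refine h1.congr fun k => ?_
    rw [← map_sub, setDual_apply, inner_cutLp]
  refine (tendsto_inner_of_denseRange hχ hnorm hconv F).congr fun k => ?_
  rw [inner_cutLp]
  exact integral_congr_ae (hpt k)

/-- The error is a linear expression plus a remainder that is itself dominated by a linear
expression; both vanish in the weak limit. No strong convergence of `a k` is required. -/
theorem tendsto_integral_of_abs_sub_le (hA : MeasurableSet A) {g : ℕ → 𝕏 → ℝ} {G : 𝕏 → ℝ}
    {f₁ f₂ v : 𝕏 → E d} {a : ℕ → 𝕏 → E d} {c : ℝ} (hg : ∀ k, Integrable (g k))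
    (hG : Integrable G) (h0 : ∀ k, ∀ᵐ x, x ∉ A → g k x = G x)
    (hb : ∀ k, ∀ᵐ x ∂(volume.restrict A), |g k x - G x - inner ℝ (f₁ x) (a k x - v x)|
      ≤ c * inner ℝ (f₂ x) (a k x - v x))
    (h₁ : (∀ k, IntegrableOn (fun x => inner ℝ (f₁ x) (a k x - v x)) A) ∧
      Tendsto (fun k => ∫ x in A, inner ℝ (f₁ x) (a k x - v x)) atTop (𝓝 0))
    (h₂ : (∀ k, IntegrableOn (fun x => inner ℝ (f₂ x) (a k x - v x)) A) ∧
      Tendsto (fun k => ∫ x in A, inner ℝ (f₂ x) (a k x - v x)) atTop (𝓝 0)) :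
    Tendsto (fun k => ∫ x, g k x) atTop (𝓝 (∫ x, G x)) := by
  rw [tendsto_iff_dist_tendsto_zero]
  have hlim : Tendsto (fun k => c * (∫ x in A, inner ℝ (f₂ x) (a k x - v x))
      + |∫ x in A, inner ℝ (f₁ x) (a k x - v x)|) atTop (𝓝 0) := by
    simpa using (h₂.2.const_mul c).add h₁.2.abs
  refine squeeze_zero (fun _ => dist_nonneg) (fun k => ?_) hlim
  have e1 : ∫ x, (g k x - G x) = ∫ x in A, (g k x - G x) := by
    rw [← integral_indicator hA]
    refine integral_congr_ae ((h0 k).mono fun x hx => ?_)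
    by_cases h : x ∈ A
    · rw [indicator_of_mem h]
    · simp only [indicator_of_notMem h, hx h, sub_self]
  have i1 : IntegrableOn (fun x => g k x - G x) A := ((hg k).sub hG).integrableOn
  have e2 : ∫ x in A, (g k x - G x) = (∫ x in A, (g k x - G x - inner ℝ (f₁ x) (a k x - v x)))
      + ∫ x in A, inner ℝ (f₁ x) (a k x - v x) := by
    rw [integral_sub i1 (h₁.1 k), sub_add_cancel]
  rw [Real.dist_eq, ← integral_sub (hg k) hG, e1, e2, ← integral_const_mul]
  refine (abs_add_le _ _).trans (add_le_add ?_ le_rfl)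
  rw [← Real.norm_eq_abs]
  exact norm_integral_le_of_norm_le ((h₂.1 k).const_mul c) (hb k)

end WeakLimits

/-! ### Comparing fluxes at a saturated state. -/

section Algebra

variable {d : ℕ}

/-- The linearisation at `v` of the flux tested with `h₀, h`. -/
def linearFlux (r : ℝ) (v : E d) (i : Fin d) (h₀ : ℝ) (h : Fin d → ℝ) : E d :=
  h₀ • EuclideanSpace.single i (1 : ℝ) + ∑ j, (r⁻¹ * h j) •
    (v i • EuclideanSpace.single j (1 : ℝ) + v j • EuclideanSpace.single i (1 : ℝ))

theorem inner_linearFlux (r : ℝ) (v u : E d) (i : Fin d) (h₀ : ℝ) (h : Fin d → ℝ) :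
    inner ℝ (linearFlux r v i h₀ h) u
      = h₀ * u i + ∑ j, r⁻¹ * h j * (v i * u j + v j * u i) := by
  simp only [linearFlux, inner_add_left, sum_inner, real_inner_smul_left,
    EuclideanSpace.inner_single_left, map_one, one_mul]

theorem norm_linearFlux_le {r K L : ℝ} (hr : 0 < r) (hrK : r⁻¹ ≤ K) {v : E d} (hv : ‖v‖ ≤ K)
    (i : Fin d) {h₀ : ℝ} (h0 : |h₀| ≤ L) {h : Fin d → ℝ} (hL : ∀ j, |h j| ≤ L) :
    ‖linearFlux r v i h₀ h‖ ≤ L + d * (K * L * (K + K)) := by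
  have hs : ∀ j : Fin d, ‖EuclideanSpace.single j (1 : ℝ)‖ = 1 := fun j => by simp
  have hK0 : 0 ≤ K := (norm_nonneg _).trans hv
  have hL0 : 0 ≤ L := (abs_nonneg _).trans h0
  have hc : ∀ j, |v j| ≤ K := fun j => (PiLp.norm_apply_le v j).trans hv
  refine (norm_add_le _ _).trans (add_le_add ?_ ((norm_sum_le _ _).trans ?_))
  · rw [norm_smul, hs, mul_one]
    exact h0
  · refine (Finset.sum_le_card_nsmul _ _ (K * L * (K + K)) fun j _ => ?_).trans_eq (by simp)
    rw [norm_smul, norm_mul, Real.norm_eq_abs, Real.norm_eq_abs, abs_of_pos (inv_pos.2 hr)]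
    refine mul_le_mul (mul_le_mul hrK (hL j) (abs_nonneg _) hK0) ((norm_add_le _ _).trans ?_)
      (norm_nonneg _) (by positivity)
    rw [norm_smul, norm_smul, hs, hs, mul_one, mul_one]
    exact add_le_add (hc i) (hc j)

/-- At points where `v` saturates the energy constraint, the flux of a subsolution is, up to its
linearisation at `v`, controlled by a linear expression. -/
theorem abs_flux_sub_le {r Q p L : ℝ} (hr : 0 < r) {v a : E d} {B : Matrix (Fin d) (Fin d) ℝ}
    (htr : B.trace = 0) (hP : (defect (Q - p) r a B).PosSemidef)
    (hsat : r⁻¹ * ‖v‖ ^ 2 = d * (Q - p)) (i : Fin d) (h₀ : ℝ) {h : Fin d → ℝ}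
    (hL : ∀ j, |h j| ≤ L) :
    |(a i * h₀ + ∑ j, (B + Q • (1 : Matrix (Fin d) (Fin d) ℝ)) i j * h j)
      - (v i * h₀ + ∑ j, (r⁻¹ • tensorSq v + p • (1 : Matrix (Fin d) (Fin d) ℝ)) i j * h j)
      - inner ℝ (linearFlux r v i h₀ h) (a - v)|
      ≤ (-(2 * d * L)) * inner ℝ (r⁻¹ • v) (a - v) := by
  have hrn := hr.ne'
  set P := defect (Q - p) r a B with hPd
  -- By definition of the defect, B + Q I equals P + p I + a ⊗ a / r. Expanding a ⊗ a around v puts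
  -- the first order terms into `linearFlux` and leaves P + (a - v) ⊗ (a - v) / r.
  have key : (a i * h₀ + ∑ j, (B + Q • (1 : Matrix (Fin d) (Fin d) ℝ)) i j * h j)
      - (v i * h₀ + ∑ j, (r⁻¹ • tensorSq v + p • (1 : Matrix (Fin d) (Fin d) ℝ)) i j * h j)
      - inner ℝ (linearFlux r v i h₀ h) (a - v)
      = ∑ j, (P i j + r⁻¹ * ((a - v) i * (a - v) j)) * h j := by
    have hsum : ∑ j, (P i j + r⁻¹ * ((a - v) i * (a - v) j)) * h j
        = (∑ j, (B + Q • (1 : Matrix (Fin d) (Fin d) ℝ)) i j * h j)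
          - (∑ j, (r⁻¹ • tensorSq v + p • (1 : Matrix (Fin d) (Fin d) ℝ)) i j * h j)
          - ∑ j, r⁻¹ * h j * (v i * (a - v) j + v j * (a - v) i) := by
      rw [← Finset.sum_sub_distrib, ← Finset.sum_sub_distrib]
      refine Finset.sum_congr rfl fun j _ => ?_
      simp only [hPd, defect, tensorSq, Matrix.sub_apply, Matrix.add_apply, Matrix.smul_apply,
        Matrix.of_apply, smul_eq_mul, PiLp.sub_apply]
      ring
    rw [inner_linearFlux, hsum]
    simp only [PiLp.sub_apply]
    ring
  rw [key]
  -- Saturation replaces d (Q - p) by |v|²/r, and |v|² - |a|² + |a - v|² is linear in a - v. This is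
  -- the only place where saturation enters.
  have htrace : P.trace + r⁻¹ * ‖a - v‖ ^ 2 = -2 * inner ℝ (r⁻¹ • v) (a - v) := by
    rw [hPd, trace_defect htr, ← hsat, norm_sub_sq_real, real_inner_smul_left, inner_sub_right,
      real_inner_self_eq_norm_sq, real_inner_comm]
    ring
  have h1 : ∀ j, |(P i j + r⁻¹ * ((a - v) i * (a - v) j)) * h j|
      ≤ (P.trace + r⁻¹ * ‖a - v‖ ^ 2) * L := fun j => by
    rw [abs_mul]
    refine mul_le_mul ((abs_add_le _ _).trans (add_le_add (abs_entry_le_trace hP i j) ?_)) (hL j)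
      (abs_nonneg _) (add_nonneg hP.trace_nonneg (by positivity))
    rw [abs_mul, abs_of_pos (inv_pos.2 hr)]
    exact mul_le_mul_of_nonneg_left (abs_mul_le_norm_sq _ i j) (inv_pos.2 hr).le
  refine (Finset.abs_sum_le_sum_abs _ _).trans
    ((Finset.sum_le_card_nsmul _ _ _ fun j _ => h1 j).trans_eq ?_)
  rw [htrace, Finset.card_univ, Fintype.card_fin, nsmul_eq_mul]
  ring

end Algebra

/-! ### Saturated elements of the closure solve the Euler system. -/

section Exactness

set_option linter.unusedSectionVars false

variable {d : ℕ} {𝕏 : Type} [AddCommGroup 𝕏] [TopologicalSpace 𝕏] [MeasureSpace 𝕏] [T2Space 𝕏]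
  [SecondCountableTopology 𝕏] [BorelSpace 𝕏] [IsFiniteMeasureOnCompacts (volume : Measure 𝕏)]
  [SigmaFinite (volume : Measure 𝕏)] [(volume : Measure 𝕏).IsOpenPosMeasure]

variable {π : E d → 𝕏} {γ T : ℝ} [Fact (1 < γ)] {Ω : Set 𝕏} {z₀ : Quadruple d 𝕏}
variable {w : StateSpace d 𝕏 γ T}

theorem flux_eq_of_mem_constitutiveSet {r q : ℝ} {a : E d} {B : Matrix (Fin d) (Fin d) ℝ}
    (h : (r, a, B, q) ∈ constitutiveSet d γ) :
    B + q • (1 : Matrix (Fin d) (Fin d) ℝ)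
      = r⁻¹ • tensorSq a + pressure γ r • (1 : Matrix (Fin d) (Fin d) ℝ) := by
  obtain ⟨-, h1, h2⟩ := h
  simp only at h1 h2
  rw [h1, h2, circSq, smul_sub, smul_smul, add_smul]
  have : r⁻¹ * (‖a‖ ^ 2 / (d : ℝ)) = ‖a‖ ^ 2 / (r * d) := by
    rw [div_eq_mul_inv, div_eq_mul_inv, mul_inv]
    ring
  rw [this]
  abel

theorem exists_deriv_bound (hπ : IsFlatCovering π) {φ : ℝ × 𝕏 → ℝ} (hφ : IsTestFunction π T φ) :
    ∃ L, 0 ≤ L ∧ ∀ t x, |dt φ t x| ≤ L ∧ ∀ j, |dx π j φ t x| ≤ L := by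
  obtain ⟨L₀, hL₀, h₀⟩ := (isLiftedDeriv_dt hφ).exists_bound hπ hφ
  choose L hL h using fun j => (isLiftedDeriv_dx hπ hφ j).exists_bound hπ hφ
  have hs : 0 ≤ ∑ j, L j := Finset.sum_nonneg fun j _ => hL j
  refine ⟨L₀ + ∑ j, L j, add_nonneg hL₀ hs, fun t x => ⟨(h₀ t x).trans (by linarith), fun j => ?_⟩⟩
  have : L j ≤ ∑ j, L j := Finset.single_le_sum (fun j _ => hL j) (Finset.mem_univ j)
  exact (h j t x).trans (by linarith)

theorem integrable_of_bound_of_compact {C : Set 𝕏} (hC : IsCompact C) {f : 𝕏 → ℝ} {b : ℝ}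
    (hf : AEStronglyMeasurable f volume) (hb : ∀ᵐ x, x ∈ C → |f x| ≤ b) (h0 : ∀ x ∉ C, f x = 0) :
    Integrable f :=
  (Measure.integrableOn_of_bounded hC.measure_lt_top.ne hf
    ((ae_restrict_iff' hC.measurableSet).2 hb)).integrable_of_forall_notMem_eq_zero h0

theorem norm_integral_le_of_compact {C : Set 𝕏} (hC : IsCompact C) {f : 𝕏 → ℝ} {b : ℝ}
    (hb : ∀ x ∈ C, |f x| ≤ b) (h0 : ∀ x ∉ C, f x = 0) : ‖∫ x, f x‖ ≤ b * volume.real C := by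
  rw [← setIntegral_eq_integral_of_forall_compl_eq_zero h0]
  exact norm_setIntegral_le_of_norm_le_const hC.measure_lt_top hb

theorem integral_eq_zero_of_tendsto {F : ℕ → ℝ → ℝ} {G : ℝ → ℝ} {b : ℝ}
    (hm : ∀ k, AEStronglyMeasurable (F k) (volume.restrict (Ioo 0 T)))
    (hb : ∀ k, ∀ t ∈ Ioo 0 T, ‖F k t‖ ≤ b) (h0 : ∀ k, ∫ t in Ioo 0 T, F k t = 0)
    (hlim : ∀ᵐ t ∂(volume.restrict (Ioo 0 T)), Tendsto (fun k => F k t) atTop (𝓝 (G t))) :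
    ∫ t in Ioo 0 T, G t = 0 := by
  have h := tendsto_integral_of_dominated_convergence (μ := volume.restrict (Ioo 0 T))
    (fun _ => b) hm (integrableOn_const measure_Ioo_lt_top.ne)
    (fun k => (ae_restrict_mem measurableSet_Ioo).mono fun t ht => hb k t ht) hlim
  simp only [h0] at h
  exact tendsto_nhds_unique h tendsto_const_nhds

theorem IsTestFunction.deriv_eq_zero (hπ : IsFlatCovering π) {φ : ℝ × 𝕏 → ℝ}
    (hφ : IsTestFunction π T φ) {t : ℝ} {x : 𝕏} (hx : x ∉ spatialSupport φ) :
    dt φ t x = 0 ∧ ∀ j, dx π j φ t x = 0 :=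
  ⟨(isLiftedDeriv_dt hφ).eq_zero_of_notMem_spatialSupport hπ hx,
    fun j => (isLiftedDeriv_dx hπ hφ j).eq_zero_of_notMem_spatialSupport hπ hx⟩

theorem norm_valueAt_le (hΩ : IsOpen Ω) (hz : IsStrictSubsolution π γ T Ω z₀) {C : Set 𝕏} {K : ℝ}
    (hK : ∀ w m M, IsFixedSubsolution π γ T Ω z₀ w m M → ∀ t ∈ Ioo 0 T, ∀ x ∈ C,
      ‖m t x‖ ≤ K ∧ ∀ i j, |M t x i j| ≤ K) {t : ℝ} (ht : t ∈ Ioo 0 T)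
    (hw : w ∈ fixedDensitySpace π γ T Ω z₀) : ∀ᵐ x, x ∈ C → ‖valueAt w.2 t x‖ ≤ K := by
  refine ae_mem_of_mem_fixedDensitySpace hΩ hz (S := fun x => {v | x ∈ C → ‖v‖ ≤ K})
    (fun x => ?_) (fun x => ?_) (Ioo_subset_Icc_self ht)
    (fun w m M h => Eventually.of_forall fun x hx => (hK w m M h t ht x hx).1) hw
  · by_cases hx : x ∈ C
    · simpa [hx] using (convexOn_univ_norm (E := E d)).convex_le K
    · simp [hx, convex_univ]
  · by_cases hx : x ∈ C
    · simp only [hx, true_imp_iff]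
      exact isClosed_le continuous_norm continuous_const
    · simp [hx]

/-- An approximating sequence of subsolutions whose momenta converge weakly on `A` at every
time. -/
theorem exists_approximating_sequence (hΩ : IsOpen Ω) (hz : IsStrictSubsolution π γ T Ω z₀)
    {A : Set 𝕏} (hA : MeasurableSet A) (hAfin : volume A ≠ ∞) {K : ℝ}
    (hK : ∀ w m M, IsFixedSubsolution π γ T Ω z₀ w m M → ∀ t ∈ Ioo 0 T, ∀ x ∈ A,
      ‖m t x‖ ≤ K ∧ ∀ i j, |M t x i j| ≤ K)
    {χ : ℕ → Lp (E d) 2 (volume : Measure 𝕏)} (hχ : DenseRange χ)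
    (hw : w ∈ fixedDensitySpace π γ T Ω z₀) :
    ∃ (v : ℕ → StateSpace d 𝕏 γ T) (m : ℕ → ℝ → 𝕏 → E d)
      (M : ℕ → ℝ → 𝕏 → Matrix (Fin d) (Fin d) ℝ),
      (∀ k, IsFixedSubsolution π γ T Ω z₀ (v k) (m k) (M k)) ∧
      ∀ t ∈ Ioo 0 T, ∀ (f : 𝕏 → E d) (L : ℝ), AEStronglyMeasurable f (volume.restrict A) →
        (∀ᵐ x ∂(volume.restrict A), ‖f x‖ ≤ L) →
        (∀ k, IntegrableOn (fun x => inner ℝ (f x) (m k t x - valueAt w.2 t x)) A) ∧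
        Tendsto (fun k => ∫ x in A, inner ℝ (f x) (m k t x - valueAt w.2 t x)) atTop (𝓝 0) := by
  obtain ⟨v, hv, hconv⟩ := exists_seq_pairing_lt (A := fixedApproximatingSpace π γ T Ω z₀)
    (π := Prod.snd) continuous_snd (fun n => setDual hA (χ n)) hw
  choose m M hm using fun k => exists_isFixedSubsolution hΩ hz (hv k)
  refine ⟨v, m, M, hm, fun t ht f L hf hL => ?_⟩
  have ht' := Ioo_subset_Icc_self ht
  have hae : ∀ k, toLpAt (v k).2 ⟨t, ht'⟩ =ᵐ[volume] m k t := fun k => by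
    have := (hm k).momentum t ht'
    rwa [valueAt_eq (v k).2 ht'] at this
  have hwv : valueAt w.2 t = toLpAt w.2 ⟨t, ht'⟩ := valueAt_eq w.2 ht'
  have hwK := norm_valueAt_le hΩ hz hK ht hw
  -- The sequence was chosen for countably many functionals only; the uniform bound `K` upgrades
  -- this to every bounded test field.
  obtain ⟨h1, h2⟩ := tendsto_setIntegral_inner hA hAfin hχ (fun n => hconv n ⟨t, ht'⟩) (K := K)
    (fun k => by
      filter_upwards [ae_restrict_of_ae (hae k), ae_restrict_mem hA] with x h1 h2
      rw [h1]
      exact (hK _ _ _ (hm k) t ht x h2).1)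
    (by
      rw [← hwv]
      exact (ae_restrict_iff' hA).2 hwK) hf hL
  have hc : ∀ k, ∀ᵐ x ∂(volume.restrict A),
      (inner ℝ (f x) (toLpAt (v k).2 ⟨t, ht'⟩ x - toLpAt w.2 ⟨t, ht'⟩ x) : ℝ)
        = inner ℝ (f x) (m k t x - valueAt w.2 t x) := fun k => by
    filter_upwards [ae_restrict_of_ae (hae k)] with x h1
    rw [h1, hwv]
  exact ⟨fun k => (h1 k).congr (hc k), h2.congr fun k => integral_congr_ae (hc k)⟩

theorem integral_mass_equation (hπ : IsFlatCovering π) (hΩ : IsOpen Ω)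
    (hz : IsStrictSubsolution π γ T Ω z₀) {χ : ℕ → Lp (E d) 2 (volume : Measure 𝕏)}
    (hχ : DenseRange χ) (hw : w ∈ fixedDensitySpace π γ T Ω z₀) {φ : ℝ × 𝕏 → ℝ}
    (hφ : IsTestFunction π T φ) :
    ∫ t in Ioo 0 T, ∫ x, (z₀.ρ t x * dt φ t x + ∑ j, valueAt w.2 t x j * dx π j φ t x) = 0 := by
  have hC := hφ.isCompact_spatialSupport
  obtain ⟨K, hK0, hK1, hK2⟩ := exists_uniform_bound hz hC
  obtain ⟨L, hL0, hL⟩ := exists_deriv_bound hπ hφ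
  set C := spatialSupport φ with hCd
  obtain ⟨v, m, M, hm, hweak⟩ := exists_approximating_sequence hΩ hz hC.measurableSet
    hC.measure_lt_top.ne hK2 hχ hw
  refine integral_eq_zero_of_tendsto (b := (K * L + d * (K * L)) * volume.real C)
    (F := fun k t => ∫ x, (z₀.ρ t x * dt φ t x + ∑ j, m k t x j * dx π j φ t x))
    (fun k => ((hm k).integrable_mass_equation hπ hΩ hz hφ).integral_prod_left.aestronglyMeasurable)
    (fun k t ht => norm_integral_le_of_compact hC (fun x hx => ?_) fun x hx => ?_)
    (fun k => ((hm k).relaxed φ hφ).2) ?_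
  · refine (abs_add_le _ _).trans (add_le_add ?_ ((Finset.abs_sum_le_sum_abs _ _).trans
      ((Finset.sum_le_card_nsmul _ _ (K * L) fun j _ => ?_).trans_eq (by simp))))
    · rw [abs_mul, abs_of_pos (hz.pos t (Ioo_subset_Icc_self ht) x)]
      exact mul_le_mul (hK1 t (Ioo_subset_Icc_self ht) x hx).1 (hL t x).1 (abs_nonneg _) hK0
    · rw [abs_mul]
      exact mul_le_mul ((PiLp.norm_apply_le _ j).trans (hK2 _ _ _ (hm k) t ht x hx).1)
        ((hL t x).2 j) (abs_nonneg _) hK0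
  · obtain ⟨h1, h2⟩ := hφ.deriv_eq_zero hπ (t := t) hx
    simp [h1, h2]
  · have hae : ∀ᵐ t ∂(volume.restrict (Ioo 0 T)), ∀ k, Integrable
        fun x => z₀.ρ t x * dt φ t x + ∑ j, m k t x j * dx π j φ t x :=
      ae_all_iff.2 fun k => ((hm k).integrable_mass_equation hπ hΩ hz hφ).prod_right_ae
    filter_upwards [hae, ae_restrict_mem measurableSet_Ioo] with t hint ht
    have ht' := Ioo_subset_Icc_self ht
    have hcdx : ∀ j, Continuous (dx π j φ t) := fun j =>
      ((isLiftedDeriv_dx hπ hφ j).continuous hπ hφ).comp (Continuous.prodMk_right t)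
    have hcdt : Continuous (dt φ t) :=
      ((isLiftedDeriv_dt hφ).continuous hπ hφ).comp (Continuous.prodMk_right t)
    have hcρ : Continuous (z₀.ρ t) := by
      rw [← continuousOn_univ]
      exact hz.continuous_density.comp (Continuous.prodMk_right t).continuousOn
        fun x _ => ⟨ht', mem_univ x⟩
    have hvm : AEStronglyMeasurable (valueAt w.2 t) (volume : Measure 𝕏) := by
      rw [valueAt_eq w.2 ht']
      exact Lp.aestronglyMeasurable _
    have hvK := norm_valueAt_le hΩ hz hK2 ht hw
    set f : 𝕏 → E d := fun x => WithLp.toLp 2 fun j => dx π j φ t x with hf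
    have hinner : ∀ x (u : E d), inner ℝ (f x) u = ∑ j, u j * dx π j φ t x := fun x u => by
      rw [inner_eq_sum]
      exact Finset.sum_congr rfl fun j _ => mul_comm _ _
    have hfc : Continuous f := (PiLp.continuous_toLp 2 _).comp (continuous_pi hcdx)
    obtain ⟨L', hL'⟩ := hC.exists_bound_of_continuousOn hfc.continuousOn
    have hw1 := hweak t ht f L' hfc.aestronglyMeasurable
      ((ae_restrict_mem hC.measurableSet).mono fun x hx => hL' x hx)
    -- The continuity equation is linear in the momentum, so the remainder vanishes identically.
    refine tendsto_integral_of_abs_sub_le hC.measurableSet (c := 0) hint ?_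
      (fun k => Eventually.of_forall fun x hx => ?_)
      (fun k => Eventually.of_forall fun x => ?_) hw1 hw1
    · refine integrable_of_bound_of_compact (b := K * L + d * (K * L)) hC ?_ ?_ fun x hx => ?_
      · exact (hcρ.mul hcdt).aestronglyMeasurable.add
          (Finset.aestronglyMeasurable_fun_sum _ fun j _ =>
            ((continuous_coord j).comp_aestronglyMeasurable hvm).mul
              (hcdx j).aestronglyMeasurable)
      · filter_upwards [hvK] with x hx hxC
        refine (abs_add_le _ _).trans (add_le_add ?_ ((Finset.abs_sum_le_sum_abs _ _).trans
          ((Finset.sum_le_card_nsmul _ _ (K * L) fun j _ => ?_).trans_eq (by simp))))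
        · rw [abs_mul, abs_of_pos (hz.pos t ht' x)]
          exact mul_le_mul (hK1 t ht' x hxC).1 (hL t x).1 (abs_nonneg _) hK0
        · rw [abs_mul]
          exact mul_le_mul ((PiLp.norm_apply_le _ j).trans (hx hxC)) ((hL t x).2 j)
            (abs_nonneg _) hK0
      · obtain ⟨h1, h2⟩ := hφ.deriv_eq_zero hπ (t := t) hx
        simp [h1, h2]
    · obtain ⟨h1, h2⟩ := hφ.deriv_eq_zero hπ (t := t) hx
      simp [h1, h2]
    · rw [inner_sub_right, hinner, hinner, zero_mul]
      refine le_of_eq ?_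
      rw [abs_eq_zero]
      ring

/-- The subsolution equations pass to the limit at almost every time separately, and then in time by
dominated convergence through the uniform bounds on the support of `φ`. -/
theorem integral_momentum_equation (hπ : IsFlatCovering π) (hΩ : IsOpen Ω)
    (hz : IsStrictSubsolution π γ T Ω z₀) {χ : ℕ → Lp (E d) 2 (volume : Measure 𝕏)}
    (hχ : DenseRange χ) (hw : w ∈ fixedDensitySpace π γ T Ω z₀)
    (hsat : ∀ᵐ t ∂(volume.restrict (Ioo 0 T)), ∀ᵐ x ∂(volume.restrict Ω),
      (z₀.ρ t x)⁻¹ * ‖valueAt w.2 t x‖ ^ 2 = d * (z₀.Q t x - pressure γ (z₀.ρ t x)))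
    {φ : ℝ × 𝕏 → ℝ} (hφ : IsTestFunction π T φ) (i : Fin d) :
    ∫ t in Ioo 0 T, ∫ x, (valueAt w.2 t x i * dt φ t x
      + ∑ j, ((z₀.ρ t x)⁻¹ • tensorSq (valueAt w.2 t x)
        + pressure γ (z₀.ρ t x) • (1 : Matrix (Fin d) (Fin d) ℝ)) i j * dx π j φ t x) = 0 := by
  have hC := hφ.isCompact_spatialSupport
  obtain ⟨K, hK0, hK1, hK2⟩ := exists_uniform_bound hz hC
  obtain ⟨L, hL0, hL⟩ := exists_deriv_bound hπ hφ
  set C := spatialSupport φ with hCd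
  set A := C ∩ Ω with hAd
  have hA : MeasurableSet A := hC.measurableSet.inter hΩ.measurableSet
  have hAfin : volume A ≠ ∞ := ((measure_mono inter_subset_left).trans_lt hC.measure_lt_top).ne
  obtain ⟨v, m, M, hm, hweak⟩ := exists_approximating_sequence hΩ hz hA hAfin
    (fun w m M h t ht x hx => hK2 w m M h t ht x hx.1) hχ hw
  refine integral_eq_zero_of_tendsto (b := (K * L + d * (2 * K * L)) * volume.real C)
    (F := fun k t => ∫ x, (m k t x i * dt φ t x
      + ∑ j, (M k t x + z₀.Q t x • (1 : Matrix (Fin d) (Fin d) ℝ)) i j * dx π j φ t x))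
    (fun k => ((hm k).integrable_momentum_equation hπ hΩ hz hφ
      i).integral_prod_left.aestronglyMeasurable)
    (fun k t ht => norm_integral_le_of_compact hC (fun x hx => ?_) fun x hx => ?_)
    (fun k => ((hm k).relaxed φ hφ).1 i) ?_
  · obtain ⟨hmK, hMK⟩ := hK2 _ _ _ (hm k) t ht x hx
    refine (abs_add_le _ _).trans (add_le_add ?_ ((Finset.abs_sum_le_sum_abs _ _).trans
      ((Finset.sum_le_card_nsmul _ _ (2 * K * L) fun j _ => ?_).trans_eq (by simp))))
    · rw [abs_mul]
      exact mul_le_mul ((PiLp.norm_apply_le _ i).trans hmK) (hL t x).1 (abs_nonneg _) hK0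
    · rw [abs_mul]
      exact mul_le_mul (abs_flux_add_pressure_le hK0 (hMK i j)
        (hK1 t (Ioo_subset_Icc_self ht) x hx).2.2.2.1) ((hL t x).2 j) (abs_nonneg _)
        (by positivity)
  · obtain ⟨h1, h2⟩ := hφ.deriv_eq_zero hπ (t := t) hx
    simp [h1, h2]
  · have hae : ∀ᵐ t ∂(volume.restrict (Ioo 0 T)), ∀ k, Integrable
        fun x => m k t x i * dt φ t x
          + ∑ j, (M k t x + z₀.Q t x • (1 : Matrix (Fin d) (Fin d) ℝ)) i j * dx π j φ t x :=
      ae_all_iff.2 fun k => ((hm k).integrable_momentum_equation hπ hΩ hz hφ i).prod_right_ae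
    filter_upwards [hae, hsat, ae_restrict_mem measurableSet_Ioo] with t hint hsatt ht
    have ht' := Ioo_subset_Icc_self ht
    have hcdx : ∀ j, Continuous (dx π j φ t) := fun j =>
      ((isLiftedDeriv_dx hπ hφ j).continuous hπ hφ).comp (Continuous.prodMk_right t)
    have hcdt : Continuous (dt φ t) :=
      ((isLiftedDeriv_dt hφ).continuous hπ hφ).comp (Continuous.prodMk_right t)
    have hslice : ∀ x ∈ (univ : Set 𝕏), ((t, x) : ℝ × 𝕏) ∈ Icc 0 T ×ˢ (univ : Set 𝕏) :=
      fun x _ => ⟨ht', mem_univ x⟩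
    have hcρ : Continuous (z₀.ρ t) := by
      rw [← continuousOn_univ]
      exact hz.continuous_density.comp (Continuous.prodMk_right t).continuousOn hslice
    have hcp : Continuous fun x => pressure γ (z₀.ρ t x) := by
      rw [← continuousOn_univ]
      exact (continuousOn_pressure hz).comp (Continuous.prodMk_right t).continuousOn hslice
    have hcρi : Continuous fun x => (z₀.ρ t x)⁻¹ := hcρ.inv₀ fun x => (hz.pos t ht' x).ne'
    have hvm : AEStronglyMeasurable (valueAt w.2 t) (volume : Measure 𝕏) := by
      rw [valueAt_eq w.2 ht']
      exact Lp.aestronglyMeasurable _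
    have hvi : ∀ j, AEStronglyMeasurable (fun x => valueAt w.2 t x j) (volume : Measure 𝕏) :=
      fun j => (continuous_coord j).comp_aestronglyMeasurable hvm
    have hvK := norm_valueAt_le hΩ hz hK2 ht hw
    have hwf := hweak t ht (fun x => linearFlux (z₀.ρ t x) (valueAt w.2 t x) i (dt φ t x)
      fun j => dx π j φ t x) (L + d * (K * L * (K + K))) (by
        refine AEStronglyMeasurable.restrict ?_
        refine (hcdt.aestronglyMeasurable.smul aestronglyMeasurable_const).add
          (Finset.aestronglyMeasurable_fun_sum _ fun j _ =>
            (hcρi.mul (hcdx j)).aestronglyMeasurable.smul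
              (((hvi i).smul aestronglyMeasurable_const).add
                ((hvi j).smul aestronglyMeasurable_const))))
      ((ae_restrict_iff' hA).2 (hvK.mono fun x hx hxA => norm_linearFlux_le (hz.pos t ht' x)
        (hK1 t ht' x hxA.1).2.1 (hx hxA.1) i (hL t x).1 (hL t x).2))
    have hwv := hweak t ht (fun x => (z₀.ρ t x)⁻¹ • valueAt w.2 t x) (K * K)
      (hcρi.aestronglyMeasurable.smul hvm).restrict
      ((ae_restrict_iff' hA).2 (hvK.mono fun x hx hxA => by
        rw [norm_smul, Real.norm_of_nonneg (inv_pos.2 (hz.pos t ht' x)).le]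
        exact mul_le_mul (hK1 t ht' x hxA.1).2.1 (hx hxA.1) (norm_nonneg _) hK0))
    -- The two test fields are the linearised flux at the limit and the limit divided by the
    -- density; the constant is that of `abs_flux_sub_le`.
    refine tendsto_integral_of_abs_sub_le hA (c := -(2 * d * L)) hint ?_ (fun k => ?_)
      (fun k => ?_) hwf hwv
    · refine integrable_of_bound_of_compact (b := K * L + d * ((K * K ^ 2 + K) * L)) hC ?_ ?_
        fun x hx => ?_
      · refine ((hvi i).mul hcdt.aestronglyMeasurable).add
          (Finset.aestronglyMeasurable_fun_sum _ fun j _ => AEStronglyMeasurable.mul ?_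
            (hcdx j).aestronglyMeasurable)
        exact (hcρi.aestronglyMeasurable.mul ((hvi i).mul (hvi j))).add
          (hcp.aestronglyMeasurable.mul aestronglyMeasurable_const)
      · filter_upwards [hvK] with x hx hxC
        obtain ⟨-, hρK, -, -, hpK⟩ := hK1 t ht' x hxC
        have hρ0 := hz.pos t ht' x
        refine (abs_add_le _ _).trans (add_le_add ?_ ((Finset.abs_sum_le_sum_abs _ _).trans
          ((Finset.sum_le_card_nsmul _ _ ((K * K ^ 2 + K) * L) fun j _ => ?_).trans_eq
            (by simp))))
        · rw [abs_mul]
          exact mul_le_mul ((PiLp.norm_apply_le _ i).trans (hx hxC)) (hL t x).1 (abs_nonneg _) hK0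
        · rw [abs_mul]
          refine mul_le_mul ?_ ((hL t x).2 j) (abs_nonneg _) (by positivity)
          simp only [Matrix.add_apply, Matrix.smul_apply, tensorSq, Matrix.of_apply, smul_eq_mul]
          refine (abs_add_le _ _).trans (add_le_add ?_ ?_)
          · rw [abs_mul, abs_of_pos (inv_pos.2 hρ0)]
            exact mul_le_mul hρK ((abs_mul_le_norm_sq _ i j).trans
              (pow_le_pow_left₀ (norm_nonneg _) (hx hxC) 2)) (abs_nonneg _) hK0
          · rw [abs_mul, Matrix.one_apply]
            split_ifs
            · rw [mul_comm, abs_one, one_mul]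
              exact (abs_of_nonneg (Real.rpow_nonneg hρ0.le γ)).trans_le hpK
            · simpa using hK0
      · obtain ⟨h1, h2⟩ := hφ.deriv_eq_zero hπ (t := t) hx
        simp [h1, h2]
    -- Off `A`, either the derivatives of `φ` vanish, or the point lies outside Ω. There both
    -- momenta equal that of `z₀`, whose values lie in the constitutive set, so the fluxes agree
    -- exactly.
    · filter_upwards [valueAt_outside hΩ hz ht' hw] with x hx hxA
      by_cases hxC : x ∈ C
      · have hxΩ : x ∉ Ω := fun h => hxA ⟨hxC, h⟩
        obtain ⟨h1, h2⟩ := (hm k).outside t ht' x hxΩ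
        rw [h1, h2, hx hxΩ, flux_eq_of_mem_constitutiveSet (hz.outside t ht' x hxΩ)]
      · obtain ⟨h1, h2⟩ := hφ.deriv_eq_zero hπ (t := t) hxC
        simp [h1, h2]
    · have hs : ∀ᵐ x ∂(volume.restrict A), (z₀.ρ t x)⁻¹ * ‖valueAt w.2 t x‖ ^ 2
          = d * (z₀.Q t x - pressure γ (z₀.ρ t x)) :=
        ae_restrict_of_ae_restrict_of_subset inter_subset_right hsatt
      filter_upwards [hs, ae_restrict_mem hA] with x h1 h2
      exact abs_flux_sub_le (hz.pos t ht' x) ((hm k).traceFree t ht' x)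
        ((hm k).posDef ht h2.2).posSemidef h1 i _ (hL t x).2

theorem isExactSolution_of_energy_eq (hT : 0 < T) (hπ : IsFlatCovering π) (hΩ : IsOpen Ω)
    (hz : IsStrictSubsolution π γ T Ω z₀) {χ : ℕ → Lp (E d) 2 (volume : Measure 𝕏)}
    (hχ : DenseRange χ) (hw : w ∈ fixedDensitySpace π γ T Ω z₀)
    (hsat : ∀ᵐ t ∂(volume.restrict (Ioo 0 T)), ∀ᵐ x ∂(volume.restrict Ω),
      (z₀.ρ t x)⁻¹ * ‖valueAt w.2 t x‖ ^ 2 = d * (z₀.Q t x - pressure γ (z₀.ρ t x))) :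
    IsExactSolution π γ T Ω z₀ w := by
  have hρ : ∀ t ∈ Ioo 0 T, valueAt w.1 t =ᵐ[volume] z₀.ρ t := fun t ht =>
    valueAt_density_of_mem_closure (Ioo_subset_Icc_self ht) hw
  refine ⟨⟨?_, fun C hC => ?_, fun φ hφ i => ?_, fun φ hφ => ?_⟩,
    fun t ht => valueAt_density_of_mem_closure ht hw,
    fun t ht => valueAt_endpoints hT.le hΩ hz ht hw,
    fun t ht => valueAt_outside hΩ hz (Ioo_subset_Icc_self ht) hw, ?_⟩
  · refine (ae_restrict_mem measurableSet_Ioo).mono fun t ht => (hρ t ht).mono fun x hx => ?_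
    rw [hx]
    exact hz.pos t (Ioo_subset_Icc_self ht) x
  · obtain ⟨K, hK0, hK1, hK2⟩ := exists_uniform_bound hz hC
    have hle : ∀ᵐ t ∂(volume.restrict (Ioo 0 T)),
        ∫⁻ x in C, ENNReal.ofReal (‖valueAt w.2 t x‖ ^ 2 / valueAt w.1 t x)
          ≤ ENNReal.ofReal (K ^ 2 * K) * volume C := by
      refine (ae_restrict_mem measurableSet_Ioo).mono fun t ht => ?_
      rw [← setLIntegral_const]
      refine lintegral_mono_ae ((ae_restrict_iff' hC.measurableSet).2 ?_)
      filter_upwards [hρ t ht, norm_valueAt_le hΩ hz hK2 ht hw] with x h1 h2 hx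
      refine ENNReal.ofReal_le_ofReal ?_
      rw [h1, div_eq_mul_inv]
      exact mul_le_mul (pow_le_pow_left₀ (norm_nonneg _) (h2 hx) 2)
        (hK1 t (Ioo_subset_Icc_self ht) x hx).2.1
        (inv_pos.2 (hz.pos t (Ioo_subset_Icc_self ht) x)).le (by positivity)
    refine (lintegral_mono_ae hle).trans_lt ?_
    rw [setLIntegral_const]
    exact ENNReal.mul_lt_top (ENNReal.mul_lt_top ENNReal.ofReal_lt_top hC.measure_lt_top)
      measure_Ioo_lt_top
  · refine Eq.trans (setIntegral_congr_fun measurableSet_Ioo fun t ht => integral_congr_ae ?_)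
      (integral_momentum_equation hπ hΩ hz hχ hw hsat hφ i)
    filter_upwards [hρ t ht] with x hx
    rw [hx]
  · refine Eq.trans (setIntegral_congr_fun measurableSet_Ioo fun t ht => integral_congr_ae ?_)
      (integral_mass_equation hπ hΩ hz hχ hw hφ)
    filter_upwards [hρ t ht] with x hx
    rw [hx]
  · rw [← Measure.restrict_congr_set Ioo_ae_eq_Icc]
    filter_upwards [hsat, ae_restrict_mem measurableSet_Ioo] with t h1 ht
    filter_upwards [h1, ae_restrict_mem hΩ.measurableSet] with x hx hxΩ
    -- Division by `d` needs `d ≠ 0`, which follows from the existence of one strict subsolution at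
    -- a point of Ω.
    obtain ⟨v, hv⟩ := closure_nonempty_iff.1 ⟨w, hw⟩
    obtain ⟨m, M, hm⟩ := exists_isFixedSubsolution hΩ hz hv
    have := hm.neZero ht hxΩ
    have hd : (d : ℝ) ≠ 0 := NeZero.ne _
    have hρ0 := (hz.pos t (Ioo_subset_Icc_self ht) x).ne'
    have h2 : ‖valueAt w.2 t x‖ ^ 2 / (z₀.ρ t x * d)
        = ((z₀.ρ t x)⁻¹ * ‖valueAt w.2 t x‖ ^ 2) / d := by
      field_simp
    rw [h2, hx, mul_div_cancel_left₀ _ hd]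
    ring

end Exactness

/-! ### Residuality -/

section Residual

set_option linter.unusedSectionVars false

variable {d : ℕ} {𝕏 : Type} [AddCommGroup 𝕏] [TopologicalSpace 𝕏] [MeasureSpace 𝕏] [T2Space 𝕏]
  [SecondCountableTopology 𝕏] [BorelSpace 𝕏] [IsFiniteMeasureOnCompacts (volume : Measure 𝕏)]
  [SigmaFinite (volume : Measure 𝕏)] [(volume : Measure 𝕏).IsOpenPosMeasure]

variable {π : E d → 𝕏} {γ T : ℝ} [Fact (1 < γ)] {Ω : Set 𝕏} {z₀ : Quadruple d 𝕏}

/-- The images of balls are open, so by second countability countably many interior charts cover Ω.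
This reduces saturation on Ω to countably many cylinders. -/
theorem exists_countable_interiorCharts (hπ : IsFlatCovering π) (hΩ : IsOpen Ω) :
    ∃ (R : ℝ) (S : Set (E d × ℝ)), S.Countable ∧ (∀ p ∈ S, IsInteriorChart π Ω p.1 R p.2) ∧
      Ω ⊆ ⋃ p ∈ S, π '' Metric.ball p.1 p.2 := by
  obtain ⟨R, hR, hchart⟩ := hπ.exists_chart
  obtain ⟨S, hSc, hS⟩ := TopologicalSpace.isOpen_iUnion_countable
    (fun p : {p : E d × ℝ // IsInteriorChart π Ω p.1 R p.2} => π '' Metric.ball p.1.1 p.1.2)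
    fun p => hπ.isOpenQuotientMap.isOpenMap _ Metric.isOpen_ball
  refine ⟨R, Subtype.val '' S, hSc.image _, ?_, fun x hx => ?_⟩
  · rintro _ ⟨p, -, rfl⟩
    exact p.2
  · obtain ⟨y, rfl⟩ := hπ.isOpenQuotientMap.surjective x
    obtain ⟨r, hr, hball⟩ := Metric.isOpen_iff.1
      (hΩ.preimage hπ.isOpenQuotientMap.continuous) y hx
    have hmin : 0 < min (r / 2) (R / 2) := lt_min (half_pos hr) (half_pos hR)
    have hic : IsInteriorChart π Ω y R (min (r / 2) (R / 2)) := by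
      refine ⟨hchart y, (min_le_right _ _).trans_lt (half_lt_self hR), ?_⟩
      rintro _ ⟨z, hz, rfl⟩
      exact hball (Metric.closedBall_subset_ball
        ((min_le_left _ _).trans_lt (half_lt_self hr)) hz)
    have hmem : π y ∈ ⋃ p : {p : E d × ℝ // IsInteriorChart π Ω p.1 R p.2},
        π '' Metric.ball p.1.1 p.1.2 :=
      mem_iUnion.2 ⟨⟨(y, min (r / 2) (R / 2)), hic⟩, y, Metric.mem_ball_self hmin, rfl⟩
    rw [← hS] at hmem
    obtain ⟨p, hp, hyp⟩ := mem_iUnion₂.1 hmem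
    exact mem_iUnion₂.2 ⟨p.1, ⟨p, hp, rfl⟩, hyp⟩

theorem residual_isExactSolution (hT : 0 < T) (hπ : IsFlatCovering π) (hΩ : IsOpen Ω)
    (hz : IsStrictSubsolution π γ T Ω z₀) :
    {w : fixedDensitySpace π γ T Ω z₀ | IsExactSolution π γ T Ω z₀ w} ∈ residual _ := by
  have : Fact ((2 : ℝ≥0∞) ≠ ∞) := ⟨by simp⟩
  set χ := TopologicalSpace.denseSeq (Lp (E d) 2 (volume : Measure 𝕏)) with hχd
  have hχ : DenseRange χ := TopologicalSpace.denseRange_denseSeq _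
  obtain ⟨R, S, hSc, hS, hcover⟩ := exists_countable_interiorCharts hπ hΩ
  have hres : ∀ p ∈ S, ∀ k : ℕ, {w : fixedDensitySpace π γ T Ω z₀ |
      (w : StateSpace d 𝕏 γ T) ∈ energySet π γ T z₀ p.1 p.2 χ (1 / ((k : ℝ) + 1))}
        ∈ residual (fixedDensitySpace π γ T Ω z₀) := by
    intro p hp k
    refine residual_of_dense_open ((isOpen_energySet hπ hz p.1 p.2 χ _).preimage
      continuous_subtype_val) (dense_iff_inter_open.2 ?_)
    -- An open set meeting the closure contains a genuine strict subsolution, which can then be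
    -- perturbed inside that open set to reach the energy level.
    rintro _ ⟨V, hV, rfl⟩ ⟨w, hw⟩
    obtain ⟨v, hvV, hv⟩ := mem_closure_iff.1 w.2 V hV hw
    obtain ⟨m, M, hm⟩ := exists_isFixedSubsolution hΩ hz hv
    obtain ⟨w', m', M', hm', hw'V, hw'⟩ := exists_mem_energySet hπ hΩ hz (hS p hp) hχ
      (show (0 : ℝ) < 1 / ((k : ℝ) + 1) by positivity) hm hV hvV
    exact ⟨⟨w', subset_closure (hm'.mem hz)⟩, hw'V, hw'⟩
  have hall : ∀ᶠ w : fixedDensitySpace π γ T Ω z₀ in residual _, ∀ p ∈ S, ∀ k : ℕ,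
      (w : StateSpace d 𝕏 γ T) ∈ energySet π γ T z₀ p.1 p.2 χ (1 / ((k : ℝ) + 1)) :=
    (eventually_countable_ball hSc).2 fun p hp => eventually_countable_forall.2 (hres p hp)
  refine hall.mono fun w hw => ?_
  refine isExactSolution_of_energy_eq hT hπ hΩ hz hχ w.2 ?_
  have h1 : ∀ᵐ t ∂(volume.restrict (Ioo 0 T)), ∀ p ∈ S,
      ∀ᵐ x ∂(volume.restrict (π '' Metric.ball p.1 p.2)),
        (z₀.ρ t x)⁻¹ * ‖valueAt (w : StateSpace d 𝕏 γ T).2 t x‖ ^ 2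
          = d * (z₀.Q t x - pressure γ (z₀.ρ t x)) :=
    (ae_ball_iff hSc).2 fun p hp =>
      energy_eq_of_forall_mem_energySet hπ hΩ hz (hS p hp) w.2 (hw p hp)
  filter_upwards [h1] with t ht
  exact ae_restrict_of_ae_restrict_of_subset hcover
    ((ae_restrict_biUnion_iff _ hSc _).2 ht)

end Residual

end IsentropicEuler

end

theorem mainTheorem2 (d : ℕ) (γ T : ℝ) [hγ : Fact (1 < γ)] (hT : 0 < T) :
    (∀ (Ω : Set (IsentropicEuler.E d)) (z₀ : IsentropicEuler.Quadruple d (IsentropicEuler.E d)),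
      IsOpen Ω →
      IsentropicEuler.IsStrictSubsolution (IsentropicEuler.spaceProj d) γ T Ω z₀ →
      {w : IsentropicEuler.fixedDensitySpace (IsentropicEuler.spaceProj d) γ T Ω z₀ |
        IsentropicEuler.IsExactSolution (IsentropicEuler.spaceProj d) γ T Ω z₀ w} ∈ residual _) ∧
    (∀ (Ω : Set (IsentropicEuler.Torus d))
        (z₀ : IsentropicEuler.Quadruple d (IsentropicEuler.Torus d)),
      IsOpen Ω →
      IsentropicEuler.IsStrictSubsolution (IsentropicEuler.torusProj d) γ T Ω z₀ →
      {w : IsentropicEuler.fixedDensitySpace (IsentropicEuler.torusProj d) γ T Ω z₀ |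
        IsentropicEuler.IsExactSolution (IsentropicEuler.torusProj d) γ T Ω z₀ w} ∈ residual _) :=
  ⟨fun _ _ hΩ hz => IsentropicEuler.residual_isExactSolution hT
      (IsentropicEuler.isFlatCovering_spaceProj d) hΩ hz,
    fun _ _ hΩ hz => IsentropicEuler.residual_isExactSolution hT
      (IsentropicEuler.isFlatCovering_torusProj d) hΩ hz⟩
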